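/- Fix a prime $p$. A $p$-adic formal scheme $Y$ is given by the system of its reductions $Y_n$ modulo $p^n$ (schemes with $p^n=0$ on $Y_n$, and $Y_n$ the closed subscheme of $Y_{n+1}$ defined by $p^n$); $\overline Y:=Y_1$. A \emph{formal $\phi$-scheme} is a $p$-torsion free $p$-adic formal scheme $T$ with an endomorphism $\phi$ reducing to the absolute Frobenius of $\overline T$; morphisms of formal $\phi$-schemes commute with $\phi$. Consider triples $(Y,\psi,X)$ where $Y$ is a $p$-torsion free $p$-adic formal scheme, $\psi$ is an endomorphism of $Y$, and $i\colon X\to Y$ is a closed immersion of an $\mathbf F_p$-scheme (so $i$ factors through $\overline Y$) with $\psi\circ i=i\circ F_X$, where $F_X$ is the absolute Frobenius of $X$. An \emph{$X$-prism over $Y$} is a formal $\phi$-scheme $T$ with morphisms $z_T\colon\overline T\to X$ and $\pi_T\colon T\to Y$ such that $i\circ z_T=\pi_T|_{\overline T}$ and $\psi\circ\pi_T=\pi_T\circ\phi$; morphisms are morphisms of formal $\phi$-schemes compatible with $z$ and $\pi$. The \emph{prismatic envelope} $(\Delta_X(Y),z_\Delta,\pi_\Delta)$ is the final object of this category. The \emph{$p$-adic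 dilatation} of $X$ in $Y$ is the final object of the category of $p$-torsion free $p$-adic formal schemes $T$ with morphisms $z_T\colon\overline T\to X$, $\pi_T\colon T\to Y$ such that $i\circ z_T=\pi_T|_{\overline T}$. \textbf{Theorem.} For every triple $(Y,\psi,X)$ as above, the prismatic envelope $\Delta_X(Y)$ exists. The morphisms $\pi_\Delta\colon\Delta_X(Y)\to Y$ and $z_\Delta\colon\overline\Delta_X(Y)\to X$ are affine, but not necessarily of finite type: for every $p$ there is a triple for which neither is of finite type. There is a sequence of morphisms of pairs $$\cdots\to(X^{(n+1)}\subseteq Y^{(n+1)})\to(X^{(n)}\subseteq Y^{(n)})\to\cdots\to(X^{(0)}\subseteq Y^{(0)})=(X\subseteq Y),$$ in which each $Y^{(n)}$ is a $p$-torsion free $p$-adic formal scheme and $X^{(n)}$ is a closed subscheme of $\overline{Y^{(n)}}$, such that each $Y^{(n+1)}\to Y^{(n)}$ is the $p$-adic dilatation of $X^{(n)}$ in $Y^{(n)}$ and such that $\Delta_X(Y)$, with projection $\pi_\Delta$ to $Y^{(0)}=Y$, is the $p$-adic completion of $\varprojlim_n Y^{(n)}$, i.e. for every $m$ the scheme $\Delta_X(Y)_m$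 is the limit of the schemes $Y^{(n)}_m$. Furthermore: (1) Let $g\colon Y'\to Y$ be a morphism sending $X'\subseteq Y'$ to $X\subseteq Y$, where $(Y',\psi',X')$ is another such triple and $g\circ\psi'=\psi\circ g$. Then there is a unique morphism of formal $\phi$-schemes $\Delta_{X'}(Y')\to\Delta_X(Y)$ compatible with $g$ via the projections $\pi_\Delta$ and $z_\Delta$. If $g$ is $p$-completely flat (as $Y$ and $Y'$ are $p$-torsion free, this means that each $g_n\colon Y'_n\to Y_n$ is flat) and $X'=g^{-1}(X)$, then the resulting morphism $\Delta_{X'}(Y')\to\Delta_X(Y)\times_Y Y'$ is an isomorphism. (2) Suppose that $X\to\overline Y$ is a regular immersion, i.e. that each point of $X$ has an affine open neighbourhood in $\overline Y$ on which the ideal of $X$ is generated by a regular sequence. Then the same is true of each $X^{(n)}\to\overline{Y^{(n)}}$ (for the sequence of pairs above), and $z_\Delta\colon\overline\Delta_X(Y)\to X$ is faithfully flat; in particular $\Delta_X(Y)$ is small, i.e. $z_\Delta$ is flat. -/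

import Mathlib

open CategoryTheory CategoryTheory.Limits AlgebraicGeometry Opposite

universe u

namespace PrismEnv

/-! ### The absolute Frobenius of a scheme of characteristic `p` -/

/-- The `p`-th power map of a commutative ring in which `p = 0`. -/
def powHom (p : ℕ) [hp : Fact p.Prime] (R : Type*) [CommRing R] (h : (p : R) = 0) : R →+* R where
  toFun x := x ^ p
  map_one' := one_pow p
  map_mul' x y := mul_pow x y p
  map_zero' := zero_pow hp.out.ne_zero
  map_add' x y := by
    obtain ⟨r, hr⟩ := exists_add_pow_prime_eq hp.out x y
    rw [hr, h]
    ring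

theorem natCast_section_eq_zero {p : ℕ} {X : Scheme.{u}} (h : (p : Γ(X, ⊤)) = 0) (U : X.Opens) :
    (p : Γ(X, U)) = 0 := by
  have := congrArg (X.presheaf.map (homOfLE (le_top : U ≤ ⊤)).op).hom h
  simpa using this

/-- The `p`-th power endomorphism of a scheme on which `p = 0`, as a morphism of ringed spaces. -/
def frobRinged (p : ℕ) [Fact p.Prime] (X : Scheme.{u}) (h : (p : Γ(X, ⊤)) = 0) :
    X.toPresheafedSpace ⟶ X.toPresheafedSpace where
  base := 𝟙 _
  c :=
    { app := fun U => CommRingCat.ofHom (powHom p Γ(X, U.unop) (natCast_section_eq_zero h U.unop))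
      naturality := fun U V f => by
        ext x
        exact (map_pow (X.presheaf.map f).hom x p).symm }

/-- The absolute Frobenius endomorphism of a scheme `X` on which `p = 0`: the identity on the
underlying space and the `p`-th power map on sections. -/
def absFrob (p : ℕ) [hp : Fact p.Prime] (X : Scheme.{u}) (h : (p : Γ(X, ⊤)) = 0) : X ⟶ X where
  toHom := frobRinged p X h
  prop x := by
    constructor
    intro s hs
    obtain ⟨U, hxU, t, rfl⟩ := X.presheaf.exists_germ_eq s
    have h1 : IsUnit ((X.presheaf.germ U x hxU).hom (t ^ p)) :=
      (PresheafedSpace.stalkMap_germ_apply (frobRinged p X h) U x hxU t) ▸ hs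
    rw [map_pow] at h1
    exact (isUnit_pow_iff hp.out.ne_zero).1 h1

/-! ### `p`-adic formal schemes -/

/-- A `p`-adic formal scheme `Y`, given as the inductive system of its reductions: `level n` is the
closed subscheme `Y_n` of `Y` defined by `p ^ n` (so `Y_0` is empty and `Y_1` is the reduction of
`Y` modulo `p`), and `Y_n` is the closed subscheme of `Y_{n+1}` defined by the ideal `(p ^ n)`. -/
structure PadicFormalScheme (p : ℕ) where
  level : ℕ → Scheme.{u}
  incl : ∀ n, level n ⟶ level (n + 1)
  isClosedImmersion_incl : ∀ n, IsClosedImmersion (incl n)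
  pow_eq_zero : ∀ n, (p : Γ(level n, ⊤)) ^ n = 0
  ker_incl : ∀ (n : ℕ) (U : (level (n + 1)).affineOpens),
    (incl n).ker.ideal U = Ideal.span {(p : Γ(level (n + 1), U.1)) ^ n}

namespace PadicFormalScheme

variable {p : ℕ}

/-- A morphism of `p`-adic formal schemes is a compatible family of morphisms of their reductions
modulo the powers of `p`. -/
@[ext]
structure Hom (Y Z : PadicFormalScheme.{u} p) where
  app : ∀ n, Y.level n ⟶ Z.level n
  comm : ∀ n, Y.incl n ≫ app (n + 1) = app n ≫ Z.incl n

instance : Category (PadicFormalScheme.{u} p) where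
  Hom := Hom
  id Y := { app := fun _ => 𝟙 _, comm := fun n => by simp }
  comp f g :=
    { app := fun n => f.app n ≫ g.app n
      comm := fun n => by rw [← Category.assoc, f.comm, Category.assoc, g.comm, Category.assoc] }
  id_comp f := Hom.ext (funext fun n => Category.id_comp (f.app n))
  comp_id f := Hom.ext (funext fun n => Category.comp_id (f.app n))
  assoc f g h := Hom.ext (funext fun n => Category.assoc (f.app n) (g.app n) (h.app n))

/-- The functor of reduction modulo `p ^ n`. -/
def reduction (p n : ℕ) : PadicFormalScheme.{u} p ⥤ Scheme.{u} where
  obj Y := Y.level n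
  map f := f.app n

/-- An open subset of a `p`-adic formal scheme, given by its traces on all reductions. -/
structure FormalOpen (Y : PadicFormalScheme.{u} p) where
  trace : ∀ n, (Y.level n).Opens
  preimage_trace : ∀ n, Y.incl n ⁻¹ᵁ trace (n + 1) = trace n

/-- The ring `𝒪_Y(U) = lim_n 𝒪_{Y_n}(U)` of sections of the structure sheaf over an open subset. -/
def sections (Y : PadicFormalScheme.{u} p) (U : Y.FormalOpen) :
    Subring (∀ n, Γ(Y.level n, U.trace n)) where
  carrier := {s | ∀ n, ((Y.incl n).appLE (U.trace (n + 1)) (U.trace n)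
    (U.preimage_trace n).ge).hom (s (n + 1)) = s n}
  mul_mem' hs ht n := by simp [hs n, ht n]
  one_mem' n := by simp
  add_mem' hs ht n := by simp [hs n, ht n]
  zero_mem' n := by simp
  neg_mem' hs n := by simp [hs n]

/-- `Y` is `p`-torsion free: multiplication by `p` is injective on its structure sheaf. -/
def IsPTorsionFree (Y : PadicFormalScheme.{u} p) : Prop :=
  ∀ (U : Y.FormalOpen) (s : Y.sections U), (p : Y.sections U) * s = 0 → s = 0

theorem natCast_level_one (Y : PadicFormalScheme.{u} p) : (p : Γ(Y.level 1, ⊤)) = 0 := by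
  simpa using Y.pow_eq_zero 1

/-- A morphism `f : Y ⟶ Z` of `p`-adic formal schemes is affine if all its reductions are. -/
def IsAffineMorphism {Y Z : PadicFormalScheme.{u} p} (f : Y ⟶ Z) : Prop :=
  ∀ n, IsAffineHom (f.app n)

/-- A morphism `f : Y ⟶ Z` of `p`-adic formal schemes is of finite type if all its reductions
are. -/
def IsOfFiniteType {Y Z : PadicFormalScheme.{u} p} (f : Y ⟶ Z) : Prop :=
  ∀ n, LocallyOfFiniteType (f.app n) ∧ QuasiCompact (f.app n)

/-- A morphism `f : Y ⟶ Z` of `p`-adic formal schemes (with `Z` being `p`-torsion free) is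
`p`-completely flat if `Y` is `p`-torsion free and `f` is flat modulo each power of `p`. -/
def IsPCompletelyFlat {Y Z : PadicFormalScheme.{u} p} (f : Y ⟶ Z) : Prop :=
  Y.IsPTorsionFree ∧ ∀ n, Flat (f.app n)

end PadicFormalScheme

/-! ### Closed subschemes and regular immersions -/

/-- A closed immersion `i : X ⟶ Z` is regular if locally around each point of `X` the ideal of `X`
in `Z` is generated by a regular sequence. -/
def IsRegularImmersion {X Z : Scheme.{u}} (i : X ⟶ Z) : Prop :=
  IsClosedImmersion i ∧ ∀ x : X, ∃ U : Z.affineOpens, i x ∈ U.1 ∧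
    ∃ rs : List Γ(Z, U.1), RingTheory.Sequence.IsRegular Γ(Z, U.1) rs ∧
      i.ker.ideal U = Ideal.ofList rs

/-- A `p`-torsion free `p`-adic formal scheme `Y` with a closed subscheme `X` of characteristic `p`.
As `p = 0` on `X`, the closed immersion of `X` in `Y` is a closed immersion `i` of `X` in the
reduction `Y_1` of `Y` modulo `p`. -/
structure ClosedPair (p : ℕ) where
  Y : PadicFormalScheme.{u} p
  torsionFree : Y.IsPTorsionFree
  X : Scheme.{u}
  i : X ⟶ Y.level 1
  isClosedImmersion_i : IsClosedImmersion i

theorem ClosedPair.natCast_X {p : ℕ} (P : ClosedPair.{u} p) : (p : Γ(P.X, ⊤)) = 0 := by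
  simpa using congrArg P.i.appTop.hom P.Y.natCast_level_one

/-- A morphism of pairs `(X' ⊆ Y') ⟶ (X ⊆ Y)`: a morphism `Y' ⟶ Y` sending `X'` to `X`. -/
structure ClosedPair.Hom {p : ℕ} (P' P : ClosedPair.{u} p) where
  hom : P'.Y ⟶ P.Y
  homX : P'.X ⟶ P.X
  comm : homX ≫ P.i = P'.i ≫ hom.app 1

/-! ### `p`-adic dilatations -/

namespace ClosedPair

variable {p : ℕ} (P : ClosedPair.{u} p)

/-- A `p`-adic enlargement of `X` in `Y`: a `p`-torsion free `p`-adic formal scheme `T` with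
morphisms `z : T_1 ⟶ X` and `π : T ⟶ Y` such that `i ∘ z` is the reduction of `π`. -/
structure Enlargement where
  T : PadicFormalScheme.{u} p
  torsionFree : T.IsPTorsionFree
  z : T.level 1 ⟶ P.X
  π : T ⟶ P.Y
  comm : z ≫ P.i = π.app 1

namespace Enlargement

variable {P}

/-- A morphism of `p`-adic enlargements of `X` in `Y`. -/
@[ext]
structure Hom (E E' : P.Enlargement) where
  hom : E.T ⟶ E'.T
  comm_z : hom.app 1 ≫ E'.z = E.z
  comm_π : hom ≫ E'.π = E.π

instance : Category P.Enlargement where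
  Hom := Hom
  id E := ⟨𝟙 _, Category.id_comp _, Category.id_comp _⟩
  comp f g :=
    ⟨f.hom ≫ g.hom,
      (Category.assoc (f.hom.app 1) (g.hom.app 1) _).trans (by rw [g.comm_z, f.comm_z]),
      by rw [Category.assoc, g.comm_π, f.comm_π]⟩
  id_comp f := Hom.ext (Category.id_comp f.hom)
  comp_id f := Hom.ext (Category.comp_id f.hom)
  assoc f g h := Hom.ext (Category.assoc f.hom g.hom h.hom)

end Enlargement

/-- `f : Y' ⟶ Y` is the `p`-adic dilatation of `X` in `Y`: together with a suitable morphism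
`Y'_1 ⟶ X`, it is the final object of the category of `p`-adic enlargements of `X` in `Y`. -/
def IsDilatation {Y' : PadicFormalScheme.{u} p} (f : Y' ⟶ P.Y) : Prop :=
  ∃ (h : Y'.IsPTorsionFree) (z : Y'.level 1 ⟶ P.X) (comm : z ≫ P.i = f.app 1),
    Nonempty (IsTerminal (⟨Y', h, z, f, comm⟩ : P.Enlargement))

/-- The sequence of pairs with zeroth term `P`, followed by the terms of the sequence `E`. -/
def stage (E : ℕ → ClosedPair.{u} p) : ℕ → ClosedPair.{u} p
  | 0 => P
  | n + 1 => E n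

/-- A sequence of pairs `⋯ ⟶ (X⁽²⁾ ⊆ Y⁽²⁾) ⟶ (X⁽¹⁾ ⊆ Y⁽¹⁾) ⟶ (X⁽⁰⁾ ⊆ Y⁽⁰⁾) = (X ⊆ Y)` such that
each `Y⁽ⁿ⁺¹⁾ ⟶ Y⁽ⁿ⁾` is the `p`-adic dilatation of `X⁽ⁿ⁾` in `Y⁽ⁿ⁾`. -/
structure DilatationTower where
  next : ℕ → ClosedPair.{u} p
  map : ∀ n, Hom (P.stage next (n + 1)) (P.stage next n)
  isDilatation : ∀ n, (P.stage next n).IsDilatation (map n).hom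

/-- The `n`-th pair `(X⁽ⁿ⁾ ⊆ Y⁽ⁿ⁾)` of a tower of dilatations. -/
def DilatationTower.pair {P : ClosedPair.{u} p} (D : P.DilatationTower) (n : ℕ) :
    ClosedPair.{u} p :=
  P.stage D.next n

/-- The inverse system `⋯ ⟶ Y⁽²⁾ ⟶ Y⁽¹⁾ ⟶ Y⁽⁰⁾ = Y` of a tower of dilatations. -/
def DilatationTower.system {P : ClosedPair.{u} p} (D : P.DilatationTower) :
    ℕᵒᵖ ⥤ PadicFormalScheme.{u} p :=
  Functor.ofOpSequence (X := fun n => (D.pair n).Y) fun n => (D.map n).hom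

end ClosedPair

/-! ### Formal `φ`-schemes, prisms and prismatic envelopes -/

/-- A formal `φ`-scheme: a `p`-torsion free `p`-adic formal scheme with an endomorphism lifting
the absolute Frobenius endomorphism of its reduction modulo `p`. -/
structure FormalPhiScheme (p : ℕ) [Fact p.Prime] where
  T : PadicFormalScheme.{u} p
  torsionFree : T.IsPTorsionFree
  φ : T ⟶ T
  lifts : φ.app 1 = absFrob p (T.level 1) T.natCast_level_one

namespace FormalPhiScheme

variable {p : ℕ} [Fact p.Prime]

/-- A morphism of formal `φ`-schemes is a morphism of formal schemes compatible with the Frobenius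
lifts. -/
@[ext]
structure Hom (T T' : FormalPhiScheme.{u} p) where
  hom : T.T ⟶ T'.T
  comm : T.φ ≫ hom = hom ≫ T'.φ

instance : Category (FormalPhiScheme.{u} p) where
  Hom := Hom
  id T := ⟨𝟙 _, (Category.comp_id _).trans (Category.id_comp _).symm⟩
  comp f g := ⟨f.hom ≫ g.hom, by
    rw [← Category.assoc, f.comm, Category.assoc, g.comm, Category.assoc]⟩
  id_comp f := Hom.ext (Category.id_comp f.hom)
  comp_id f := Hom.ext (Category.comp_id f.hom)
  assoc f g h := Hom.ext (Category.assoc f.hom g.hom h.hom)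

end FormalPhiScheme

/-- A pair `(X ⊆ Y)` with an endomorphism `ψ` of `Y` which restricts on `X` to the absolute
Frobenius endomorphism of `X`. -/
structure FrobeniusPair (p : ℕ) [Fact p.Prime] extends ClosedPair.{u} p where
  ψ : Y ⟶ Y
  restricts : absFrob p X toClosedPair.natCast_X ≫ i = i ≫ ψ.app 1

namespace FrobeniusPair

variable {p : ℕ} [Fact p.Prime]

/-- A morphism of pairs which is compatible with the given endomorphisms. -/
structure Hom (P' P : FrobeniusPair.{u} p) extends
    ClosedPair.Hom P'.toClosedPair P.toClosedPair where
  comm_ψ : P'.ψ ≫ hom = hom ≫ P.ψ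

variable (P : FrobeniusPair.{u} p)

/-- An `X`-prism over `Y`: a formal `φ`-scheme `T` with a morphism `z : T_1 ⟶ X` and a morphism
of formal schemes `π : T ⟶ Y` such that `i ∘ z` is the reduction of `π` and `ψ ∘ π = π ∘ φ`. -/
structure Prism where
  T : FormalPhiScheme.{u} p
  z : T.T.level 1 ⟶ P.X
  π : T.T ⟶ P.Y
  comm : z ≫ P.i = π.app 1
  comm_φ : T.φ ≫ π = π ≫ P.ψ

namespace Prism

variable {P}

/-- A morphism of `X`-prisms over `Y`. -/
@[ext]
structure Hom (E E' : P.Prism) where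
  hom : E.T ⟶ E'.T
  comm_z : hom.hom.app 1 ≫ E'.z = E.z
  comm_π : hom.hom ≫ E'.π = E.π

instance : Category P.Prism where
  Hom := Hom
  id E := ⟨𝟙 _, Category.id_comp _, Category.id_comp _⟩
  comp f g :=
    ⟨f.hom ≫ g.hom,
      (Category.assoc (f.hom.hom.app 1) (g.hom.hom.app 1) _).trans (by rw [g.comm_z, f.comm_z]),
      (Category.assoc f.hom.hom g.hom.hom _).trans (by rw [g.comm_π, f.comm_π])⟩
  id_comp f := Hom.ext (Category.id_comp f.hom)
  comp_id f := Hom.ext (Category.comp_id f.hom)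
  assoc f g h := Hom.ext (Category.assoc f.hom g.hom h.hom)

/-- An `X`-prism over `Y` is the prismatic envelope of `X` in `Y` if it is a final object of the
category of `X`-prisms over `Y`. -/
def IsPrismaticEnvelope (E : P.Prism) : Prop :=
  Nonempty (IsTerminal E)

/-- An `X`-prism is small if `z : T_1 ⟶ X` is flat. -/
def IsSmall (E : P.Prism) : Prop :=
  Flat E.z

end Prism

end FrobeniusPair

end PrismEnv

/-! Locally `Y` is the formal spectrum of a `p`-torsion free ring `A`, and `X` is cut out by an
ideal `I` containing `p`. For `p`-torsion free `T` over `Y`, the reduction `T_1` maps into `X`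
exactly when every element of `I` becomes divisible by `p` on `T`. Hence the dilatation of `X` is
the formal spectrum of the subring `A[I/p]` of `A[1/p]` (`dilAlgebra`, `exists_dilAlgebra_hom`,
`exists_dilatation`). A formal scheme being the system of its reductions, no completion has to be
formed, but rings of sections then localize only modulo powers of `p`. `IsPLocalization` records
this; `A[I/p]` inherits it from `A`, so its reductions glue (`exists_relSpec`, `exists_formalSpec`).

Since `ψ ∘ i = i ∘ F`, the endomorphism `ψ` lifts to an endomorphism `ψ'` of the dilatation `Y'`. On
`Y'_1` the morphisms `ψ'` and Frobenius agree after composition with the affine morphism `z : Y'_1 →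
X`, so the locus `X'` where they agree is closed, and `(Y', ψ', X')` is again a triple
(`exists_isFrobeniusStep`). Iteration gives the tower. A prism `T → Y` lifts uniquely to `Y'`; by
uniqueness the lift commutes with the endomorphisms, so `T_1` lands in `X'`, and the argument
repeats (`exists_prism_hom`). Conversely the `ψ` induce an endomorphism of the limit. It reduces to
Frobenius, because the map from the special fibre of the limit to that of `Y⁽ⁿ⁾` passes through that
of `Y⁽ⁿ⁺¹⁾` and hence through `X⁽ⁿ⁾`. So the limit is the final prism (`exists_envelope`). For flat
base change, the fibre product of the envelope with `Y'` is again `p`-torsion free and a prism over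
`Y'`, and finality produces inverse morphisms (`isPullback_envelope`).

The envelope of the origin of the special fibre in the formal affine line over `ℤ_p` with `ψ = id`
is not of finite type. Each integer `a` gives a point `p * a` which is a prism, hence a section of
`z` over `𝔽_p`. If `φ = id` on `T`, a morphism `f` of formal `φ`-schemes satisfies `f(d) = f(d)^p +
p f(e)` whenever `φ(d) = d^p + p e`, so it is determined by its reduction modulo `p`. Different `a`
thus give different sections, whereas a scheme of finite type over `𝔽_p` has only finitely many
(`not_locallyOfFiniteType`).

If `F_1, ..., F_r` lift a regular sequence generating the ideal of `X`, then `A[I/p]` modulo `p` is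
the polynomial ring over `A/I` in the classes `t_i = F_i/p` (`bijective_eval₂Hom_dilAlgebra`).
Writing `ψ(F_i) = c_i p + ∑ a_ij F_j` and dividing by `p` shows that `ψ'(t_i)` is affine linear in
the `t_j`, so `X'` has the equations `t_i^p - ∑ a_ij t_j - c_i`. These have leading forms `t_i^p`;
therefore they form a regular sequence and their quotient is free and nonzero over `A/I`
(`MvPoly.exists_basis_prodFamily`). So regularity passes up the tower, `X' → X` and `Y'_1 → X` are
faithfully flat, and `z_Δ` is a limit of faithfully flat affine morphisms
(`faithfullyFlat_of_seqColimit`). -/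

namespace PrismEnv

/-! ### Gluing over directed families of open subsets -/

/-- A directed open cover of a scheme, indexed by a preorder. -/
structure DirectedCover (S : Scheme.{u}) (ι : Type u) [Preorder ι] where
  opens : ι → S.Opens
  mono : ∀ {i j : ι}, i ≤ j → opens i ≤ opens j
  iSup_eq_top : ⨆ i, opens i = ⊤
  directed : ∀ (i j : ι) (x : S), x ∈ opens i → x ∈ opens j → ∃ k, k ≤ i ∧ k ≤ j ∧ x ∈ opens k

namespace DirectedCover

variable {S T Q : Scheme.{u}} {ι : Type u} [Preorder ι]

/-- The preimage of a directed open cover. -/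
@[simps]
def comap (W : DirectedCover S ι) (f : T ⟶ S) : DirectedCover T ι where
  opens i := f ⁻¹ᵁ W.opens i
  mono h := f.preimage_mono (W.mono h)
  iSup_eq_top := by
    rw [← Scheme.Hom.preimage_iSup, W.iSup_eq_top]; rfl
  directed i j x hi hj := W.directed i j (f x) hi hj

/-- The open cover associated with a directed open cover. -/
noncomputable abbrev cover (W : DirectedCover S ι) : S.OpenCover where
  I₀ := ι
  X i := (W.opens i).toScheme
  f i := (W.opens i).ι
  mem₀ := by
    rw [Scheme.presieve₀_mem_precoverage_iff]
    refine ⟨fun x => ?_, inferInstance⟩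
    obtain ⟨i, hx⟩ := TopologicalSpace.Opens.mem_iSup.mp (W.iSup_eq_top.ge (Set.mem_univ x))
    exact ⟨i, ⟨x, hx⟩, rfl⟩

noncomputable instance (W : DirectedCover S ι) : W.cover.LocallyDirected where
  trans h := S.homOfLE (W.mono (leOfHom h))
  directed {i j} x := by
    have hai : (pullback.fst (W.opens i).ι (W.opens j).ι ≫ (W.opens i).ι) x ∈ W.opens i :=
      (pullback.fst (W.opens i).ι (W.opens j).ι x).2
    have haj : (pullback.fst (W.opens i).ι (W.opens j).ι ≫ (W.opens i).ι) x ∈ W.opens j := by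
      rw [pullback.condition]
      exact (pullback.snd (W.opens i).ι (W.opens j).ι x).2
    obtain ⟨k, hki, hkj, hk⟩ := W.directed i j _ hai haj
    refine ⟨k, homOfLE hki, homOfLE hkj, ⟨_, hk⟩, ?_⟩
    apply (pullback.fst (W.opens i).ι (W.opens j).ι ≫ (W.opens i).ι).isOpenEmbedding.injective
    have h : pullback.lift (S.homOfLE (W.mono hki)) (S.homOfLE (W.mono hkj))
          (by rw [Scheme.homOfLE_ι, Scheme.homOfLE_ι]) ≫
        pullback.fst (W.opens i).ι (W.opens j).ι ≫ (W.opens i).ι = (W.opens k).ι := by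
      rw [pullback.lift_fst_assoc, Scheme.homOfLE_ι]
    exact congrArg (fun f : (W.opens k).toScheme ⟶ S => f ⟨_, hk⟩) h

end DirectedCover

theorem ι_comp_eq {T Q : Scheme.{u}} (g : T ⟶ Q) {W : T.Opens} {V : Q.Opens} (hV : IsAffineOpen V)
    (e : W ≤ g ⁻¹ᵁ V) : W.ι ≫ g = W.toSpecΓ ≫ Spec.map (g.appLE V W e) ≫ hV.fromSpec := by
  rw [Scheme.Opens.toSpecΓ_SpecMap_appLE_assoc, hV.toSpecΓ_fromSpec, Scheme.Hom.resLE_comp_ι]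

/-- Morphisms of schemes are equal if they agree on sections over suitable affine opens. -/
theorem hom_ext_of_appLE {T Q : Scheme.{u}} (g g' : T ⟶ Q) {ι : Type*} (W : ι → T.Opens)
    (hW : ⨆ i, W i = ⊤) (V : ι → Q.Opens) (hV : ∀ i, IsAffineOpen (V i))
    (e : ∀ i, W i ≤ g ⁻¹ᵁ V i) (e' : ∀ i, W i ≤ g' ⁻¹ᵁ V i)
    (H : ∀ i, g.appLE (V i) (W i) (e i) = g'.appLE (V i) (W i) (e' i)) : g = g' := by
  refine Scheme.Cover.hom_ext (T.openCoverOfIsOpenCover W hW) _ _ fun i => ?_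
  have := ι_comp_eq g (hV i) (e i)
  rw [H i] at this
  exact this.trans (ι_comp_eq g' (hV i) (e' i)).symm

/-- Morphisms of schemes can be glued from compatible ring homomorphisms on sections. -/
theorem exists_hom_of_appLE {T Q : Scheme.{u}} {ι : Type u} [Preorder ι] (W : DirectedCover T ι)
    (V : ι → Q.Opens) (hVm : ∀ {i j : ι}, i ≤ j → V i ≤ V j) (hV : ∀ i, IsAffineOpen (V i))
    (β : ∀ i, Γ(Q, V i) ⟶ Γ(T, W.opens i))
    (hβ : ∀ i j (h : i ≤ j), Q.presheaf.map (homOfLE (hVm h)).op ≫ β i =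
      β j ≫ T.presheaf.map (homOfLE (W.mono h)).op) :
    ∃ g : T ⟶ Q, ∀ i, ∃ e : W.opens i ≤ g ⁻¹ᵁ V i, g.appLE (V i) (W.opens i) e = β i := by
  let G : ∀ i : ι, (W.opens i).toScheme ⟶ Q := fun i =>
    (W.opens i).toSpecΓ ≫ Spec.map (β i) ≫ (hV i).fromSpec
  have hG : ∀ {i j : ι} (h : i ⟶ j), W.cover.trans (i := i) (j := j) h ≫ G j = G i := by
    intro i j h
    change T.homOfLE (W.mono (leOfHom h)) ≫ (W.opens j).toSpecΓ ≫ Spec.map (β j) ≫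
      (hV j).fromSpec = (W.opens i).toSpecΓ ≫ Spec.map (β i) ≫ (hV i).fromSpec
    rw [← Scheme.Opens.toSpecΓ_SpecMap_presheaf_map_assoc, ← Spec.map_comp_assoc,
        ← hβ i j (leOfHom h),
      Spec.map_comp_assoc, IsAffineOpen.map_fromSpec _ (hV i)]
  let g := Scheme.OpenCover.glueMorphismsOfLocallyDirected W.cover G hG
  have hg (i : ι) : (W.opens i).ι ≫ g = G i :=
    Scheme.OpenCover.map_glueMorphismsOfLocallyDirected W.cover G hG i
  refine ⟨g, fun i => ?_⟩
  have e : W.opens i ≤ g ⁻¹ᵁ V i := by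
    intro x hx
    have h1 : g x = G i ⟨x, hx⟩ := by
      rw [← hg i]; rfl
    change g x ∈ V i
    rw [h1]
    have h2 : G i ⟨x, hx⟩ ∈ Set.range (hV i).fromSpec := ⟨_, rfl⟩
    rwa [(hV i).range_fromSpec] at h2
  refine ⟨e, ?_⟩
  have h3 := (ι_comp_eq g (hV i) e).symm.trans (hg i)
  simp only [G, ← Category.assoc] at h3
  rw [cancel_mono] at h3
  have h4 := congrArg Scheme.Hom.appTop h3
  simp only [Scheme.Hom.comp_appTop, Scheme.Opens.toSpecΓ_appTop] at h4
  rw [Scheme.ΓSpecIso_naturality_assoc, Scheme.ΓSpecIso_naturality_assoc] at h4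
  rw [Iso.cancel_iso_hom_left, cancel_mono] at h4
  exact h4

end PrismEnv

/-! ### Relative spectra over a directed affine cover -/

namespace PrismEnv

section RelativeSpec

/-- Stated in an abstract category so that its use below only needs the objects involved to agree up
to unfolding. -/
theorem comp_eq_of_eq_id {C : Type*} [Category C] {A B D E F : C} (a : A ⟶ B) (x : B ⟶ D)
    (y : D ⟶ B) (g : B ⟶ E) (m : E ⟶ E) (e : E ⟶ F) (h : x ≫ y = 𝟙 B) (hm : m = 𝟙 E) :
    (((a ≫ x) ≫ y) ≫ g ≫ m) ≫ e = a ≫ g ≫ e := by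
  simp [h, hm]

variable {S : Scheme.{u}} {ι : Type u} [Preorder ι] (W : DirectedCover S ι)
  (hW : ∀ i, IsAffineOpen (W.opens i)) (F : ιᵒᵖ ⥤ CommRingCat.{u})
  (α : ∀ i, Γ(S, W.opens i) ⟶ F.obj (op i))
  (hα : ∀ {i j : ι} (h : i ≤ j), IsPushout (S.presheaf.map (homOfLE (W.mono h)).op) (α j) (α i)
    (F.map (homOfLE h).op))

/-- The natural transformation underlying the gluing data of a relative spectrum. -/
noncomputable def relSpecNatTrans : F.rightOp ⋙ Scheme.Spec ⟶ W.cover.functorOfLocallyDirected where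
  app i := Spec.map (α i) ≫ (hW i).isoSpec.inv
  naturality i j h := by
    change Spec.map (F.map h.op) ≫ Spec.map (α j) ≫ (hW j).isoSpec.inv =
      (Spec.map (α i) ≫ (hW i).isoSpec.inv) ≫ S.homOfLE (W.mono (leOfHom h))
    rw [← cancel_mono (hW j).isoSpec.hom]
    simp only [Category.assoc, Iso.inv_hom_id, Category.comp_id]
    rw [IsAffineOpen.isoSpec_hom, ← Scheme.Opens.toSpecΓ_SpecMap_presheaf_map,
      IsAffineOpen.isoSpec_inv_toSpecΓ_assoc, ← Spec.map_comp, ← Spec.map_comp]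
    exact congrArg Spec.map (hα (leOfHom h)).w.symm

/-- The gluing data of a relative spectrum. -/
noncomputable def relSpecData : W.cover.RelativeGluingData where
  functor := F.rightOp ⋙ Scheme.Spec
  natTrans := relSpecNatTrans W hW F α hα
  equifibered i j h := by
    have h1 : IsPullback (Spec.map (F.map h.op)) (Spec.map (α i)) (Spec.map (α j))
        (Spec.map (S.presheaf.map (homOfLE (W.mono (leOfHom h))).op)) :=
      (isPullback_SpecMap_of_isPushout _ _ _ _ (hα (leOfHom h))).flip
    have h2 : IsPullback (Spec.map (S.presheaf.map (homOfLE (W.mono (leOfHom h))).op))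
        (hW i).isoSpec.inv (hW j).isoSpec.inv (S.homOfLE (W.mono (leOfHom h))) := by
      refine IsPullback.of_vert_isIso ⟨?_⟩
      rw [← cancel_mono (hW j).isoSpec.hom]
      simp only [Category.assoc, Iso.inv_hom_id, Category.comp_id]
      rw [IsAffineOpen.isoSpec_hom, ← Scheme.Opens.toSpecΓ_SpecMap_presheaf_map,
        IsAffineOpen.isoSpec_inv_toSpecΓ_assoc]
    exact h1.paste_vert h2

/-- The pushout squares say that the spectrum over the larger open set restricts to the spectrum
over the smaller one, so the affine pieces glue to a scheme affine over `S`. -/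
theorem exists_relSpec {S : Scheme.{u}} {ι : Type u} [Preorder ι] (W : DirectedCover S ι)
    (hW : ∀ i, IsAffineOpen (W.opens i)) (F : ιᵒᵖ ⥤ CommRingCat.{u})
    (α : ∀ i, Γ(S, W.opens i) ⟶ F.obj (op i))
    (hα : ∀ {i j : ι} (h : i ≤ j), IsPushout (S.presheaf.map (homOfLE (W.mono h)).op) (α j) (α i)
      (F.map (homOfLE h).op)) : ∃ (Q : Scheme.{u}) (q : Q ⟶ S)
    (e : ∀ i, Γ(Q, q ⁻¹ᵁ W.opens i) ≅ F.obj (op i)), IsAffineHom q ∧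
      (∀ i, q.app (W.opens i) ≫ (e i).hom = α i) ∧
      ∀ {i j : ι} (h : i ≤ j), Q.presheaf.map (homOfLE (q.preimage_mono (W.mono h))).op ≫
        (e i).hom = (e j).hom ≫ F.map (homOfLE h).op := by
  let d := relSpecData W hW F α hα
  let Q : Scheme.{u} := d.glued
  let q : Q ⟶ S := d.toBase
  let c (i : ι) : Spec (F.obj (op i)) ⟶ Q := d.cover.f i
  have hc (i : ι) : IsOpenImmersion (c i) := d.cover.map_prop i
  have hcq (i : ι) : c i ≫ q = Spec.map (α i) ≫ (hW i).fromSpec :=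
    (d.ι_toBase i).trans ((Category.assoc _ _ _).trans (congrArg (Spec.map (α i) ≫ ·)
        ((hW i).isoSpec_inv_ι)))
  have hcc {i j : ι} (h : i ≤ j) : Spec.map (F.map (homOfLE h).op) ≫ c j = c i :=
    Scheme.Cover.trans_map d.cover (i := i) (j := j) (show @Quiver.Hom ι _ i j from homOfLE h)
  have hr (i : ι) : q ⁻¹ᵁ W.opens i = (c i).opensRange := by
    refine Eq.trans ?_ (d.toBase_preimage_eq_opensRange_ι i)
    rw [show (W.cover.f i).opensRange = W.opens i from Scheme.Opens.opensRange_ι _]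
  have hle (i : ι) : ⊤ ≤ c i ⁻¹ᵁ q ⁻¹ᵁ W.opens i := by
    rw [hr]; intro x _; exact ⟨x, rfl⟩
  -- The chart `c i` is an open immersion with image the preimage of `W.opens i`, so it identifies
  -- the sections there with the global sections of a spectrum.
  have hiso (i : ι) : IsIso ((c i).appLE (q ⁻¹ᵁ W.opens i) ⊤ (hle i)) := by
    have : IsIso ((c i).app (q ⁻¹ᵁ W.opens i)) := (c i).isIso_app _ (hr i).le
    rw [Scheme.Hom.appLE]
    have h : IsIso (homOfLE (hle i)) := ⟨homOfLE le_top, rfl, rfl⟩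
    infer_instance
  refine ⟨Q, q, fun i => asIso ((c i).appLE (q ⁻¹ᵁ W.opens i) ⊤ (hle i)) ≪≫
    Scheme.ΓSpecIso (F.obj (op i)), ?_, fun i => ?_, fun {i j} h => ?_⟩
  · apply isAffineHom_of_forall_exists_isAffineOpen
    intro x
    obtain ⟨i, hx⟩ := TopologicalSpace.Opens.mem_iSup.mp (W.iSup_eq_top.ge (Set.mem_univ x))
    refine ⟨W.opens i, hx, hW i, ?_⟩
    rw [hr]
    exact isAffineOpen_opensRange _
  · simp only [Iso.trans_hom, asIso_hom]
    rw [Scheme.Hom.app_eq_appLE, Scheme.Hom.appLE_comp_appLE_assoc]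
    have : (c i ≫ q).appLE (W.opens i) ⊤ ((hle i).trans (by rfl)) =
      (Spec.map (α i) ≫ (hW i).fromSpec).appLE (W.opens i) ⊤
        (by rw [← hcq i]; exact (hle i).trans (by rfl)) := by
      simp only [hcq i]
    rw [this, ← Scheme.Hom.appLE_comp_appLE _ _ _ ⊤ _ (by simp) le_top]
    have h2 := Scheme.ΓSpecIso_naturality (α i)
    simp only [Scheme.Hom.appTop] at h2
    simp only [Scheme.Hom.appLE, IsAffineOpen.fromSpec_app_self]
    have h3 : (Spec Γ(S, W.opens i)).presheaf.map (eqToHom ((hW i).fromSpec_preimage_self)).op ≫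
        (Spec Γ(S, W.opens i)).presheaf.map (homOfLE (by simp)).op = 𝟙 Γ(Spec Γ(S, W.opens i),
            ⊤) := by
      rw [← Functor.map_comp]
      exact (Spec Γ(S, W.opens i)).presheaf.map_id _
    have h4 : (Spec (F.obj (op i))).presheaf.map (homOfLE le_top : (⊤ : (Spec (F.obj (op i))).Opens) ⟶ _).op =
        𝟙 Γ(Spec (F.obj (op i)), ⊤) := (Spec (F.obj (op i))).presheaf.map_id _
    have h5 : (Scheme.ΓSpecIso Γ(S, W.opens i)).inv ≫ (Scheme.Hom.app (Spec.map (α i)) ⊤ ≫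
        (Scheme.ΓSpecIso (F.obj (op i))).hom) = α i :=
            (congrArg (_ ≫ ·) h2).trans (Iso.inv_hom_id_assoc _ _)
    exact (comp_eq_of_eq_id _ _ _ _ _ _ h3 h4).trans h5
  · simp only [Iso.trans_hom, asIso_hom, Category.assoc]
    rw [← Scheme.ΓSpecIso_naturality, Scheme.Hom.map_appLE_assoc]
    have h1 : (Spec.map (F.map (homOfLE h).op) ≫ c j).appLE (q ⁻¹ᵁ W.opens j) ⊤
        (by rw [hcc h]; exact (hle i).trans ((c i).preimage_mono (q.preimage_mono (W.mono h)))) =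
        (c i).appLE (q ⁻¹ᵁ W.opens j) ⊤
          ((hle i).trans ((c i).preimage_mono (q.preimage_mono (W.mono h)))) := by
      simp only [hcc h]
    rw [← h1, ← Scheme.Hom.appLE_comp_appLE _ _ _ ⊤ _ (hle j) le_top, Category.assoc]
    have h2 := Scheme.ΓSpecIso_naturality (F.map (homOfLE h).op)
    simp only [Scheme.Hom.appTop] at h2
    simp only [Scheme.Hom.appLE]
    have h4 : (Spec (F.obj (op i))).presheaf.map (homOfLE le_top : (⊤ : (Spec (F.obj (op i))).Opens) ⟶ _).op =
        𝟙 Γ(Spec (F.obj (op i)), ⊤) := (Spec (F.obj (op i))).presheaf.map_id _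
    refine congrArg (_ ≫ ·) ((congrArg (· ≫ _) (congrArg (_ ≫ ·) h4)).trans ?_)
    rfl

end RelativeSpec

end PrismEnv

/-! ### Limits of inverse sequences of schemes with affine transition morphisms -/

namespace PrismEnv

/-- The directed cover of a scheme by its affine opens, ordered by the relation of being a basic
open subset. -/
abbrev zariskiCover (S : Scheme.{u}) : DirectedCover S S.AffineZariskiSite where
  opens U := U.toOpens
  mono h := Scheme.AffineZariskiSite.toOpens_mono h
  iSup_eq_top := by
    rw [eq_top_iff]
    intro x _
    obtain ⟨U, hU, hx, -⟩ := exists_isAffineOpen_mem_and_subset (x := x) (U := ⊤) trivial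
    exact TopologicalSpace.Opens.mem_iSup.mpr ⟨⟨U, hU⟩, hx⟩
  directed U V x hU hV := by
    obtain ⟨f, g, h, hx⟩ := exists_basicOpen_le_affine_inter U.2 V.2 x ⟨hU, hV⟩
    exact ⟨U.basicOpen f, U.basicOpen_le f, ⟨g, h.symm⟩, hx⟩

/-- The sections of an affine morphism over a basic open subset form a pushout. -/
theorem isPushout_app_basicOpen {S Q : Scheme.{u}} (q : Q ⟶ S) [IsAffineHom q]
    {U V : S.AffineZariskiSite} (h : U ≤ V) :
    IsPushout (S.presheaf.map (homOfLE ((zariskiCover S).mono h)).op) (q.app V.toOpens)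
        (q.app U.toOpens)
      (Q.presheaf.map (homOfLE (q.preimage_mono ((zariskiCover S).mono h))).op) := by
  obtain ⟨f, hf⟩ := h
  obtain ⟨U, hU⟩ := U
  obtain ⟨V, hV⟩ := V
  change S.basicOpen f = U at hf
  subst hf
  have h2 : IsAffineOpen (q ⁻¹ᵁ V) := hV.preimage q
  let := (S.presheaf.map (homOfLE (S.basicOpen_le f)).op).hom.toAlgebra
  let := (Q.presheaf.map (homOfLE (q.preimage_mono (S.basicOpen_le f))).op).hom.toAlgebra
  have h3 : IsLocalization.Away f Γ(S, S.basicOpen f) := hV.isLocalization_basicOpen f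
  have h4 : IsLocalization.Away (q.app V f) Γ(Q, q ⁻¹ᵁ S.basicOpen f) := by
    have := h2.isLocalization_of_eq_basicOpen (q.app V f)
      (homOfLE (q.preimage_mono (S.basicOpen_le f))) (Scheme.preimage_basicOpen q f)
    exact this
  have h5 : IsLocalization ((Submonoid.powers f).map (q.app V).hom) Γ(Q, q ⁻¹ᵁ S.basicOpen f) := by
    rw [Submonoid.map_powers]
    exact h4
  refine (CommRingCat.isPushout_of_isLocalization (q.app V).hom (q.app (S.basicOpen f)).hom ?_
    (Submonoid.powers f)).flip
  exact congrArg CommRingCat.Hom.hom (q.naturality (homOfLE (S.basicOpen_le f)).op)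

section Limit

variable (D : ℕᵒᵖ ⥤ Scheme.{u})

/-- The sections of the terms of an inverse sequence of schemes over the preimages of an open
subset of the zeroth term. -/
noncomputable def seqSections (U : (D.obj (op 0)).Opens) : ℕ ⥤ CommRingCat.{u} where
  obj n := Γ(D.obj (op n), D.map (homOfLE n.zero_le).op ⁻¹ᵁ U)
  map {m n} f := (D.map f.op).appLE _ _ (by
    rw [← Scheme.Hom.comp_preimage, ← D.map_comp]; rfl)
  map_id n := by
    simp only [op_id, D.map_id]
    simp only [Scheme.Hom.appLE]
    exact (Category.id_comp _).trans ((D.obj (op n)).presheaf.map_id _)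
  map_comp f g := by
    rw [Scheme.Hom.appLE_comp_appLE]
    simp only [op_comp, D.map_comp]

variable {D}

theorem seqSections_le (c : Cone D) (U : (D.obj (op 0)).Opens) (n : ℕ) :
    c.π.app (op 0) ⁻¹ᵁ U ≤ c.π.app (op n) ⁻¹ᵁ (D.map (homOfLE n.zero_le).op ⁻¹ᵁ U) := by
  rw [← Scheme.Hom.comp_preimage, c.w]

/-- The sections of the vertex of a cone over an inverse sequence of schemes. -/
noncomputable def seqSectionsCocone (c : Cone D) (U : (D.obj (op 0)).Opens) :
    Cocone (seqSections D U) where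
  pt := Γ(c.pt, c.π.app (op 0) ⁻¹ᵁ U)
  ι :=
    { app n := (c.π.app (op n)).appLE _ _ (seqSections_le c U n)
      naturality m n f := by
        change (D.map f.op).appLE _ _ _ ≫ (c.π.app (op n)).appLE _ _ _ = _ ≫ 𝟙 _
        rw [Scheme.Hom.appLE_comp_appLE, Category.comp_id]
        simp only [c.w] }

/-- Restriction of sections to a smaller open subset. -/
noncomputable def seqSectionsMap {U V : (D.obj (op 0)).Opens} (h : U ≤ V) :
    seqSections D V ⟶ seqSections D U where
  app n := (D.obj (op n)).presheaf.map (homOfLE (Scheme.Hom.preimage_mono _ h)).op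
  naturality m n f := by
    change (D.map f.op).appLE _ _ _ ≫ _ = _ ≫ (D.map f.op).appLE _ _ _
    rw [Scheme.Hom.appLE_map, Scheme.Hom.map_appLE]

theorem seqSectionsMap_comp {U V W : (D.obj (op 0)).Opens} (h : U ≤ V) (h' : V ≤ W) :
    seqSectionsMap (D := D) h' ≫ seqSectionsMap h = seqSectionsMap (h.trans h') := by
  ext n : 2
  exact ((D.obj (op n)).presheaf.map_comp _ _).symm

theorem seqSectionsMap_id (U : (D.obj (op 0)).Opens) :
    seqSectionsMap (D := D) (le_refl U) = 𝟙 _ := by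
  ext n : 2
  exact (D.obj (op n)).presheaf.map_id _

variable (D) in
/-- The colimits of the rings of sections over affine open subsets of the zeroth term. -/
noncomputable def seqColimit : (D.obj (op 0)).AffineZariskiSiteᵒᵖ ⥤ CommRingCat.{u} where
  obj U := colim.obj (seqSections D U.unop.toOpens)
  map f := colim.map (seqSectionsMap ((zariskiCover _).mono (leOfHom f.unop)))
  map_id _ := (congrArg colim.map (seqSectionsMap_id _)).trans (colim.map_id _)
  map_comp _ _ := (congrArg colim.map (seqSectionsMap_comp _ _).symm).trans (colim.map_comp _ _)

/-- The structure map of the colimits of the rings of sections. -/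
noncomputable def toSeqColimit (n : ℕ) (U : (D.obj (op 0)).AffineZariskiSite) :
    Γ(D.obj (op n), D.map (homOfLE n.zero_le).op ⁻¹ᵁ U.toOpens) ⟶ (seqColimit D).obj (op U) :=
  colimit.ι (seqSections D U.toOpens) n

theorem toSeqColimit_map {U V : (D.obj (op 0)).AffineZariskiSite} (h : U ≤ V) (n : ℕ) :
    toSeqColimit n V ≫ (seqColimit D).map (homOfLE h).op =
      (D.obj (op n)).presheaf.map
        (homOfLE (Scheme.Hom.preimage_mono _ ((zariskiCover _).mono h))).op ≫ toSeqColimit n U :=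
  ι_colimMap _ _

theorem seqColimit_hom_ext {U : (D.obj (op 0)).AffineZariskiSite} {R : CommRingCat.{u}}
    {f g : (seqColimit D).obj (op U) ⟶ R} (h : ∀ n, toSeqColimit n U ≫ f = toSeqColimit n U ≫ g) :
    f = g :=
  colimit.hom_ext h

/-- The map out of a colimit of rings of sections which is induced by a cone. -/
noncomputable def seqColimitDesc {T : Scheme.{u}} (π : (Functor.const ℕᵒᵖ).obj T ⟶ D)
    (a : T ⟶ D.obj (op 0)) (ha : a = π.app (op 0)) (U : (D.obj (op 0)).AffineZariskiSite) :
    (seqColimit D).obj (op U) ⟶ Γ(T, a ⁻¹ᵁ U.toOpens) :=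
  colimit.desc (seqSections D U.toOpens) (seqSectionsCocone ⟨T, π⟩ U.toOpens) ≫
    T.presheaf.map (eqToHom (by rw [ha])).op

theorem toSeqColimit_desc {T : Scheme.{u}} (π : (Functor.const ℕᵒᵖ).obj T ⟶ D)
    (a : T ⟶ D.obj (op 0)) (ha : a = π.app (op 0)) (U : (D.obj (op 0)).AffineZariskiSite) (n : ℕ)
    (b : T ⟶ D.obj (op n)) (hb : b = π.app (op n)) (e) :
    toSeqColimit n U ≫ seqColimitDesc π a ha U =
      b.appLE (D.map (homOfLE n.zero_le).op ⁻¹ᵁ U.toOpens) (a ⁻¹ᵁ U.toOpens) e := by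
  subst ha hb
  refine (Category.assoc _ _ _).symm.trans ((congrArg (· ≫ _) (colimit.ι_desc _ _)).trans ?_)
  exact (congrArg (_ ≫ ·) (T.presheaf.map_id _)).trans (Category.comp_id _)

theorem seq_map_zero : D.map (homOfLE (Nat.zero_le 0)).op = 𝟙 (D.obj (op 0)) := D.map_id _

/-- Colimits commute with pushouts, and a sequential colimit of a constant object is that object.
With `a` the restriction to a basic open set, the statement says that the colimit of the rings of
sections localizes correctly. -/
theorem isPushout_colimMap {C : Type*} [Category C] {G G' : ℕ ⥤ C} [HasColimit G] [HasColimit G']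
    (τ : G ⟶ G') {R R' : C} (a : R ⟶ R') (b : ∀ n, R ⟶ G.obj n) (b' : ∀ n, R' ⟶ G'.obj n)
    (hb : ∀ {m n : ℕ} (f : m ⟶ n), b m ≫ G.map f = b n)
    (hb' : ∀ {m n : ℕ} (f : m ⟶ n), b' m ≫ G'.map f = b' n)
    (h : ∀ n, IsPushout a (b n) (b' n) (τ.app n)) :
    IsPushout a (b 0 ≫ colimit.ι G 0) (b' 0 ≫ colimit.ι G' 0) (colimMap τ) := by
  have hι (n : ℕ) : b 0 ≫ colimit.ι G 0 = b n ≫ colimit.ι G n := by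
    rw [← hb (homOfLE n.zero_le), Category.assoc, colimit.w]
  have hι' (n : ℕ) : b' 0 ≫ colimit.ι G' 0 = b' n ≫ colimit.ι G' n := by
    rw [← hb' (homOfLE n.zero_le), Category.assoc, colimit.w]
  refine IsPushout.mk' ?_ ?_ ?_
  · rw [Category.assoc, ι_colimMap, ← Category.assoc, ← Category.assoc, (h 0).w]
  · intro T x y h1 h2
    refine colimit.hom_ext fun n => (h n).hom_ext ?_ ?_
    · rw [hι' n, Category.assoc, Category.assoc] at h1
      exact h1
    · rw [← Category.assoc, ← Category.assoc, ← ι_colimMap, Category.assoc, Category.assoc, h2]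
  · intro T x y hxy
    have w (n : ℕ) : a ≫ x = b n ≫ colimit.ι G n ≫ y := by
      rw [hxy, hι n, Category.assoc]
    have hn {m n : ℕ} (f : m ⟶ n) : G'.map f ≫ (h n).desc x (colimit.ι G n ≫ y) (w n) =
        (h m).desc x (colimit.ι G m ≫ y) (w m) := by
      refine (h m).hom_ext ?_ ?_
      · rw [← Category.assoc, hb', IsPushout.inl_desc, IsPushout.inl_desc]
      · rw [← Category.assoc, ← τ.naturality, Category.assoc, IsPushout.inr_desc,
          IsPushout.inr_desc, ← Category.assoc, colimit.w]
    refine ⟨colimit.desc G' ⟨T, ⟨fun n => (h n).desc x (colimit.ι G n ≫ y) (w n), fun m n f => ?_⟩⟩,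
      ?_, ?_⟩
    · exact (hn f).trans (Category.comp_id _).symm
    · rw [Category.assoc, colimit.ι_desc]
      exact IsPushout.inl_desc _ _ _ _
    · refine colimit.hom_ext fun n => ?_
      rw [← Category.assoc, ι_colimMap, Category.assoc, colimit.ι_desc]
      exact IsPushout.inr_desc _ _ _ _

/-- Inverse sequences of schemes with affine transition morphisms have limits, and the sections
over the preimages of affine open subsets are the colimits of the rings of sections. -/
theorem exists_isLimit (D : ℕᵒᵖ ⥤ Scheme.{u}) (hD : ∀ {m n : ℕᵒᵖ} (f : m ⟶ n),
    IsAffineHom (D.map f)) :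
    ∃ c : Cone D, Nonempty (IsLimit c) ∧ IsAffineHom (c.π.app (op 0)) ∧
      ∀ U : (D.obj (op 0)).Opens, IsAffineOpen U →
        Nonempty (IsColimit (seqSectionsCocone c U)) := by
  let d (n : ℕ) : D.obj (op n) ⟶ D.obj (op 0) := D.map (homOfLE n.zero_le).op
  have hd0 : d 0 = 𝟙 _ := seq_map_zero
  let α (U : (D.obj (op 0)).AffineZariskiSite) :
      Γ(D.obj (op 0), U.toOpens) ⟶ (seqColimit D).obj (op U) :=
    (d 0).app U.toOpens ≫ toSeqColimit 0 U
  have hb (U : (D.obj (op 0)).AffineZariskiSite) {m n : ℕ} (f : m ⟶ n) :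
      (d m).app U.toOpens ≫ (seqSections D U.toOpens).map f = (d n).app U.toOpens := by
    change (d m).app U.toOpens ≫ (D.map f.op).appLE _ _ _ = _
    rw [Scheme.Hom.app_eq_appLE, Scheme.Hom.app_eq_appLE, Scheme.Hom.appLE_comp_appLE]
    have : D.map f.op ≫ d m = d n := (D.map_comp _ _).symm
    simp only [this]
    rfl
  have hαn (U : (D.obj (op 0)).AffineZariskiSite) (n : ℕ) :
      (d n).app U.toOpens ≫ toSeqColimit n U = α U := by
    rw [← hb U (homOfLE n.zero_le)]
    refine (Category.assoc _ _ _).trans ?_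
    exact congrArg ((d 0).app U.toOpens ≫ ·) (colimit.w (seqSections D U.toOpens) _)
  have hα {U V : (D.obj (op 0)).AffineZariskiSite} (h : U ≤ V) :
      IsPushout ((D.obj (op 0)).presheaf.map (homOfLE ((zariskiCover _).mono h)).op) (α V) (α U)
        ((seqColimit D).map (homOfLE h).op) :=
    isPushout_colimMap (seqSectionsMap ((zariskiCover _).mono h)) _ (fun n => (d n).app V.toOpens)
      (fun n => (d n).app U.toOpens) (hb V) (hb U) fun n =>
        have := hD (homOfLE n.zero_le).op
        isPushout_app_basicOpen (d n) h
  obtain ⟨Q, q, e, hq, hqe, hqm⟩ := exists_relSpec (zariskiCover _) (fun U => U.2) (seqColimit D)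
    α hα
  -- Over the preimage of `U`, the projection to the `n`-th term is given by the structure map from
  -- stage `n` into the colimit of rings.
  have key (n : ℕ) : ∃ g : Q ⟶ D.obj (op n), ∀ U : (D.obj (op 0)).AffineZariskiSite,
      ∃ h : q ⁻¹ᵁ U.toOpens ≤ g ⁻¹ᵁ (d n ⁻¹ᵁ U.toOpens),
      g.appLE (d n ⁻¹ᵁ U.toOpens) (q ⁻¹ᵁ U.toOpens) h = toSeqColimit n U ≫ (e U).inv := by
    have := hD (homOfLE n.zero_le).op
    refine exists_hom_of_appLE ((zariskiCover _).comap q) (fun U => d n ⁻¹ᵁ U.toOpens)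
      (fun h => Scheme.Hom.preimage_mono _ ((zariskiCover _).mono h)) (fun U => U.2.preimage (d n))
      _ ?_
    intro U V h
    have h1 := hqm h
    have h2 := toSeqColimit_map (D := D) h n
    have h3 : (e V).inv ≫ Q.presheaf.map (homOfLE (q.preimage_mono ((zariskiCover _).mono h))).op =
        (seqColimit D).map (homOfLE h).op ≫ (e U).inv := by
      rw [Iso.inv_comp_eq, ← Category.assoc, ← h1, Category.assoc, Iso.hom_inv_id]
      exact (Category.comp_id _).symm
    refine Eq.trans ?_ (Eq.trans (congrArg (toSeqColimit n V ≫ ·) h3.symm)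
        (Category.assoc _ _ _).symm)
    refine (Category.assoc _ _ _).symm.trans (Eq.trans ?_ (Category.assoc _ _ _))
    exact congrArg (· ≫ (e U).inv) h2.symm
  choose g hg hge using key
  have hqcov : ⨆ U : (D.obj (op 0)).AffineZariskiSite, q ⁻¹ᵁ U.toOpens = ⊤ :=
    ((zariskiCover _).comap q).iSup_eq_top
  have hg0 : g 0 = q := by
    have hgd : g 0 ≫ d 0 = q := by
      refine hom_ext_of_appLE _ _ _ hqcov (fun U => U.toOpens) (fun U => U.2) (fun U => hg 0 U)
        (fun U => le_rfl) fun U => ?_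
      rw [← Scheme.Hom.appLE_comp_appLE _ _ _ _ _ le_rfl (hg 0 U), hge 0 U,
        ← Scheme.Hom.app_eq_appLE, ← Scheme.Hom.app_eq_appLE, ← Category.assoc, Iso.comp_inv_eq]
      exact (hqe U).symm
    rw [← hgd, hd0, Category.comp_id]
  have hgD {m n : ℕ} (f : m ⟶ n) : g n ≫ D.map f.op = g m := by
    have hdd : D.map f.op ≫ d m = d n := (D.map_comp _ _).symm
    have hle (U : (D.obj (op 0)).AffineZariskiSite)
        : d n ⁻¹ᵁ U.toOpens ≤ D.map f.op ⁻¹ᵁ d m ⁻¹ᵁ U.toOpens := by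
      rw [← hdd]; rfl
    have := hD (homOfLE m.zero_le).op
    refine hom_ext_of_appLE _ _ _ hqcov (fun U => d m ⁻¹ᵁ U.toOpens) (fun U => U.2.preimage (d m))
      (fun U => (hg n U).trans (Scheme.Hom.preimage_mono _ (hle U))) (fun U => hg m U) fun U => ?_
    rw [← Scheme.Hom.appLE_comp_appLE _ _ _ _ _ (hle U) (hg n U), hge n U, hge m U,
      ← Category.assoc]
    exact congrArg (· ≫ (e U).inv) (colimit.w (seqSections D U.toOpens) f)
  subst hg0
  let c : Cone D := ⟨Q, ⟨fun n => g n.unop, fun m n f => (Category.id_comp _).trans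
    (hgD f.unop).symm⟩⟩
  refine ⟨c, ⟨IsLimit.ofExistsUnique fun s => ?_⟩, hq, ?_⟩
  · obtain ⟨T, π⟩ := s
    let b (n : ℕ) : T ⟶ D.obj (op n) := π.app (op n)
    have hbcov : ⨆ U : (D.obj (op 0)).AffineZariskiSite, b 0 ⁻¹ᵁ U.toOpens = ⊤ :=
      ((zariskiCover _).comap (b 0)).iSup_eq_top
    have hble (U : (D.obj (op 0)).AffineZariskiSite) (n : ℕ) :
        b 0 ⁻¹ᵁ U.toOpens ≤ b n ⁻¹ᵁ d n ⁻¹ᵁ U.toOpens :=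
      seqSections_le ⟨T, π⟩ U.toOpens n
    let dsc (U : (D.obj (op 0)).AffineZariskiSite) :
      (seqColimit D).obj (op U) ⟶ Γ(T, b 0 ⁻¹ᵁ U.toOpens) := seqColimitDesc π (b 0) rfl U
    have hdsc (n : ℕ) (U : (D.obj (op 0)).AffineZariskiSite) : toSeqColimit n U ≫ dsc U =
      (b n).appLE (d n ⁻¹ᵁ U.toOpens) (b 0 ⁻¹ᵁ U.toOpens) (hble U n) :=
        toSeqColimit_desc π (b 0) rfl U n (b n) rfl _
    obtain ⟨l, hl⟩ := exists_hom_of_appLE ((zariskiCover _).comap (b 0))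
      (fun U => g 0 ⁻¹ᵁ U.toOpens) (fun h => Scheme.Hom.preimage_mono _ ((zariskiCover _).mono h))
      (fun U => U.2.preimage (g 0))
      (fun U => (e U).hom ≫ dsc U)
      (fun U V h => by
        have h1 : (seqColimit D).map (homOfLE h).op ≫ dsc U = dsc V ≫
            T.presheaf.map (homOfLE (Scheme.Hom.preimage_mono _ ((zariskiCover _).mono h))).op := by
          refine seqColimit_hom_ext fun n => ?_
          rw [← Category.assoc, toSeqColimit_map, Category.assoc, hdsc, ← Category.assoc, hdsc,
            Scheme.Hom.map_appLE, Scheme.Hom.appLE_map]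
        have h2 := congrArg (· ≫ dsc U) (hqm h)
        have h3 := congrArg ((e V).hom ≫ ·) h1
        simp only [Category.assoc] at h2 h3
        refine h2.trans (h3.trans (Category.assoc _ _ _).symm))
    choose hle hla using hl
    have hla' (U : (D.obj (op 0)).AffineZariskiSite) :
      l.appLE (g 0 ⁻¹ᵁ U.toOpens) (b 0 ⁻¹ᵁ U.toOpens) (hle U) = (e U).hom ≫ dsc U := hla U
    have hge' (n : ℕ) (U : (D.obj (op 0)).AffineZariskiSite) :
        (g n).appLE (d n ⁻¹ᵁ U.toOpens) (g 0 ⁻¹ᵁ U.toOpens) (hg n U) ≫ (e U).hom =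
          toSeqColimit n U := by
      rw [hge n U, Category.assoc, Iso.inv_hom_id, Category.comp_id]
    have hfac (n : ℕ) : l ≫ g n = b n := by
      have := hD (homOfLE n.zero_le).op
      refine hom_ext_of_appLE _ _ _ hbcov (fun U => d n ⁻¹ᵁ U.toOpens)
        (fun U => U.2.preimage (d n))
        (fun U => (hle U).trans (Scheme.Hom.preimage_mono _ (hg n U))) (hble · n) fun U => ?_
      refine (Scheme.Hom.appLE_comp_appLE _ _ _ _ _ (hg n U) (hle U)).symm.trans ?_
      rw [← hdsc, ← hge', Category.assoc, ← hla']
      rfl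
    refine ⟨l, fun n => hfac n.unop, fun l' hl' => ?_⟩
    replace hl' (n : ℕ) : l' ≫ g n = b n := hl' (op n)
    have hle' (U : (D.obj (op 0)).AffineZariskiSite) :
        b 0 ⁻¹ᵁ U.toOpens ≤ l' ⁻¹ᵁ g 0 ⁻¹ᵁ U.toOpens := by
      rw [← hl' 0]; rfl
    refine hom_ext_of_appLE l' l _ hbcov (fun U => g 0 ⁻¹ᵁ U.toOpens)
      (fun U => U.2.preimage (g 0)) hle' hle fun U => ?_
    have h1 : (e U).inv ≫ l'.appLE (g 0 ⁻¹ᵁ U.toOpens) (b 0 ⁻¹ᵁ U.toOpens) (hle' U) = dsc U := by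
      refine seqColimit_hom_ext fun n => ?_
      rw [← Category.assoc, ← hge n U, hdsc, Scheme.Hom.appLE_comp_appLE]
      simp only [hl' n]
    rw [hla' U, ← h1, Iso.hom_inv_id_assoc]
  · intro U hU
    refine ⟨IsColimit.ofIsoColimit (colimit.isColimit _) (Cocone.ext (e ⟨U, hU⟩).symm fun n => ?_)⟩
    exact (hge n ⟨U, hU⟩).symm

/-- This allows elements of a sequential colimit of rings, and equalities between them, to be
represented at a finite stage. -/
instance : PreservesColimitsOfShape ℕ (forget CommRingCat.{u}) :=
  have := preservesFilteredColimitsOfSize_shrink.{0, u, 0, u} (forget CommRingCat.{u})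
  inferInstance

theorem exists_appLE_eq_of_isColimit {c : Cone D} {U : (D.obj (op 0)).Opens}
    (hc : IsColimit (seqSectionsCocone c U)) (s : Γ(c.pt, c.π.app (op 0) ⁻¹ᵁ U)) :
    ∃ (n : ℕ) (t : Γ(D.obj (op n), D.map (homOfLE n.zero_le).op ⁻¹ᵁ U)),
      (c.π.app (op n)).appLE _ _ (seqSections_le c U n) t = s :=
  Concrete.isColimit_exists_rep _ hc s

theorem exists_appLE_eq_zero_of_isColimit {c : Cone D} {U : (D.obj (op 0)).Opens}
    (hc : IsColimit (seqSectionsCocone c U)) {n : ℕ}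
    (t : Γ(D.obj (op n), D.map (homOfLE n.zero_le).op ⁻¹ᵁ U))
    (ht : (c.π.app (op n)).appLE _ _ (seqSections_le c U n) t = 0) :
    ∃ (m : ℕ) (h : n ≤ m), (seqSections D U).map (homOfLE h) t = 0 := by
  obtain ⟨m, f, g, hm⟩ := Concrete.isColimit_exists_of_rep_eq (seqSections D U) hc t
    (0 : (seqSections D U).obj n) (ht.trans (map_zero _).symm)
  exact ⟨m, leOfHom f, hm.trans (map_zero _)⟩

end Limit

end PrismEnv

namespace PrismEnv

/-! ### Sections -/

/-- Restriction of sections of the structure sheaf. -/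
abbrev res {X : Scheme.{u}} {U V : X.Opens} (h : V ≤ U) : Γ(X, U) →+* Γ(X, V) :=
  (X.presheaf.map (homOfLE h).op).hom

theorem res_res {X : Scheme.{u}} {U V W : X.Opens} (h : V ≤ U) (h' : W ≤ V) (s : Γ(X, U)) :
    res h' (res h s) = res (h'.trans h) s :=
  (congrArg (fun f => f.hom s) (X.presheaf.map_comp (homOfLE h).op (homOfLE h').op)).symm

theorem res_self {X : Scheme.{u}} {U : X.Opens} (h : U ≤ U) (s : Γ(X, U)) : res h s = s :=
  congrArg (fun f => f.hom s) (X.presheaf.map_id (op U))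

theorem app_res {X Y : Scheme.{u}} (f : X ⟶ Y) {U V : Y.Opens} (h : V ≤ U) (s : Γ(Y, U)) :
    (f.app V).hom (res h s) = res (f.preimage_mono h) ((f.app U).hom s) :=
  congrArg (fun g => g.hom s) (f.naturality (homOfLE h).op)

theorem appLE_eq_res_app {X Y : Scheme.{u}} (f : X ⟶ Y) {U : Y.Opens} {V : X.Opens}
    (h : V ≤ f ⁻¹ᵁ U) (s : Γ(Y, U)) : (f.appLE U V h).hom s = res h ((f.app U).hom s) := rfl

theorem section_ext {X : Scheme.{u}} {U : X.Opens} {s t : Γ(X, U)}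
    (H : ∀ (V : X.Opens) (h : V ≤ U), IsAffineOpen V → res h s = res h t) : s = t := by
  refine X.IsSheaf.section_ext fun x hx => ?_
  obtain ⟨V, hV, hxV, hVU⟩ := exists_isAffineOpen_mem_and_subset hx
  exact ⟨V, hVU, hxV, H V hVU hV⟩

theorem section_ext_of_iSup {X : Scheme.{u}} {U : X.Opens} {ι : Type*} (V : ι → X.Opens)
    (hV : ∀ i, V i ≤ U) (hU : U ≤ ⨆ i, V i) {s t : Γ(X, U)}
    (H : ∀ i, res (hV i) s = res (hV i) t) : s = t := by
  refine X.IsSheaf.section_ext fun x hx => ?_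
  obtain ⟨i, hi⟩ := TopologicalSpace.Opens.mem_iSup.mp (hU hx)
  exact ⟨V i, hV i, hi, H i⟩

/-- Compatible sections over the members of an affine cover can be glued. -/
theorem exists_section {X : Scheme.{u}} {U : X.Opens} {ι : Type u} (V : ι → X.Opens)
    (hV : ∀ i, V i ≤ U) (hU : U ≤ ⨆ i, V i) (s : ∀ i, Γ(X, V i))
    (H : ∀ (i j : ι) (W : X.Opens) (hi : W ≤ V i) (hj : W ≤ V j), IsAffineOpen W →
      res hi (s i) = res hj (s j)) :
    ∃ t : Γ(X, U), ∀ i, res (hV i) t = s i := by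
  obtain ⟨t, ht, -⟩ := X.sheaf.existsUnique_gluing' V U (fun i => homOfLE (hV i)) hU s (by
    intro i j
    refine section_ext fun W hW hWa => ?_
    have h1 := H i j W (hW.trans inf_le_left) (hW.trans inf_le_right) hWa
    exact (res_res _ _ _).trans (h1.trans (res_res _ _ _).symm))
  exact ⟨t, ht⟩

theorem natCast_pow_eq_zero_of_le {X : Scheme.{u}} {p n : ℕ} {U V : X.Opens} (h : V ≤ U)
    (H : (p : Γ(X, U)) ^ n = 0) : (p : Γ(X, V)) ^ n = 0 := by
  simpa using congrArg (res h) H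

theorem natCast_pow_eq_zero_of_hom {X Y : Scheme.{u}} (f : X ⟶ Y) {p n : ℕ}
    (H : (p : Γ(Y, ⊤)) ^ n = 0) : (p : Γ(X, ⊤)) ^ n = 0 := by
  simpa using congrArg f.appTop.hom H

/-! ### The ideal sheaf generated by a power of `p` -/

/-- The ideal sheaf generated by `p ^ n`. -/
noncomputable def powIdeal (p n : ℕ) (X : Scheme.{u}) : X.IdealSheafData :=
  Scheme.IdealSheafData.ofIdealTop (Ideal.span {(p : Γ(X, ⊤)) ^ n})

theorem powIdeal_ideal (p n : ℕ) (X : Scheme.{u}) (U : X.affineOpens) :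
    (powIdeal p n X).ideal U = Ideal.span {(p : Γ(X, U.1)) ^ n} := by
  simp [powIdeal, Ideal.map_span]

theorem powIdeal_le_ker_iff {p n : ℕ} {X Y : Scheme.{u}} (f : X ⟶ Y) :
    powIdeal p n Y ≤ f.ker ↔ (p : Γ(X, ⊤)) ^ n = 0 := by
  rw [Scheme.Hom.ker, Scheme.IdealSheafData.le_ofIdeals_iff]
  have h (U : Y.affineOpens) : (powIdeal p n Y).ideal U ≤ RingHom.ker (f.app U.1).hom ↔
      (p : Γ(X, f ⁻¹ᵁ U.1)) ^ n = 0 := by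
    rw [powIdeal_ideal, Ideal.span_singleton_le_iff_mem, RingHom.mem_ker, map_pow, map_natCast]
  constructor
  · intro H
    refine section_ext_of_iSup (fun U : Y.affineOpens => f ⁻¹ᵁ U.1) (fun U => le_top) ?_ fun U => ?_
    · have := ((zariskiCover Y).comap f).iSup_eq_top
      exact this.ge
    · simpa using (h U).1 (H U)
  · intro H U
    exact (h U).2 (natCast_pow_eq_zero_of_le le_top H)

/-- Either ideal sheaf is contained in `I` exactly when `p ^ n` vanishes on the closed subscheme
defined by `I`. -/
theorem powIdeal_comap {p n : ℕ} {X Y : Scheme.{u}} (f : X ⟶ Y) :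
    (powIdeal p n Y).comap f = powIdeal p n X := by
  refine eq_of_forall_ge_iff fun I => ?_
  rw [← Scheme.IdealSheafData.le_map_iff_comap_le, Scheme.IdealSheafData.map, powIdeal_le_ker_iff]
  conv_rhs => rw [← I.ker_subschemeι]
  rw [powIdeal_le_ker_iff]

theorem ker_eq_powIdeal_iff {p n : ℕ} {X Y : Scheme.{u}} (f : X ⟶ Y) :
    f.ker = powIdeal p n Y ↔
      ∀ U : Y.affineOpens, f.ker.ideal U = Ideal.span {(p : Γ(Y, U.1)) ^ n} := by
  refine ⟨fun h U => by rw [h, powIdeal_ideal], fun h => ?_⟩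
  ext U : 2
  rw [h, powIdeal_ideal]

theorem ker_eq_powIdeal_of_isPullback {p n : ℕ} {Z Z' X Y : Scheme.{u}} {i : Z ⟶ X} {g : Z ⟶ Z'}
    {f : X ⟶ Y} {j : Z' ⟶ Y} (h : IsPullback i g f j) [IsClosedImmersion j]
    (hj : j.ker = powIdeal p n Y) : i.ker = powIdeal p n X := by
  rw [← h.isoPullback_hom_fst, Scheme.Hom.ker_comp_of_isIso,
    Scheme.IdealSheafData.ker_fst_of_isClosedImmersion, hj, powIdeal_comap]

theorem isPullback_of_ker_eq_powIdeal {p n : ℕ} {Z Z' X Y : Scheme.{u}} {i : Z ⟶ X} {g : Z ⟶ Z'}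
    {f : X ⟶ Y} {j : Z' ⟶ Y} [IsClosedImmersion i] [IsClosedImmersion j] (h : i ≫ f = g ≫ j)
    (hi : i.ker = powIdeal p n X) (hj : j.ker = powIdeal p n Y) : IsPullback i g f j :=
  isPullback_of_isClosedImmersion _ _ _ _ h (by rw [hi, hj, powIdeal_comap])

/-! ### Affineness of thickenings -/

/-- As `p` is nilpotent on `X` and `n ≠ 0`, the zero locus of `p ^ n` is the whole space. -/
theorem surjective_of_ker_eq_powIdeal {p n : ℕ} {Z X : Scheme.{u}} (i : Z ⟶ X)
    [IsClosedImmersion i] (hn : n ≠ 0) (hi : i.ker = powIdeal p n X) {N : ℕ}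
    (hN : (p : Γ(X, ⊤)) ^ N = 0) : Function.Surjective i := by
  have h := Scheme.Hom.support_ker i
  rw [i.isClosedEmbedding.isClosed_range.closure_eq, hi, powIdeal,
    Scheme.IdealSheafData.coe_support_ofIdealTop] at h
  rw [← Set.range_eq_univ, ← h, Scheme.zeroLocus_span, Scheme.zeroLocus_singleton]
  have h1 : X.basicOpen ((p : Γ(X, ⊤)) ^ n) = ⊥ := by
    rw [← Scheme.basicOpen_pow _ _ N.succ_pos, ← pow_mul, mul_comm, pow_mul, pow_succ, hN, zero_mul,
      zero_pow hn, Scheme.basicOpen_zero]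
  rw [h1]
  simp

theorem app_surjective_of_ker {p n : ℕ} {Z X : Scheme.{u}} (i : Z ⟶ X)
    [IsClosedImmersion i] (hi : i.ker = powIdeal p n X) {U : X.Opens} (hU : IsAffineOpen U)
    {s : Γ(X, U)} (hs : (i.app U).hom s = 0) : (p : Γ(X, U)) ^ n ∣ s := by
  have h := i.ker_apply ⟨U, hU⟩
  rw [hi, powIdeal_ideal] at h
  rw [← Ideal.mem_span_singleton, h]
  exact hs

/-- Local lifts of `h` differ by multiples of `p`, so their `p ^ n`-th powers agree modulo `p ^ (n +
1)`, which is zero on `X`. Hence these powers glue, although the lifts themselves need not. -/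
theorem exists_app_eq_pow {p n : ℕ} {Z X : Scheme.{u}} (i : Z ⟶ X)
    [IsClosedImmersion i] (hn : n ≠ 0) (hi : i.ker = powIdeal p n X)
    (hX : (p : Γ(X, ⊤)) ^ (n + 1) = 0) (h : Γ(Z, ⊤)) :
    ∃ H : Γ(X, ⊤), i.appTop.hom H = h ^ p ^ n := by
  have h1 (U : X.affineOpens) : ∃ a : Γ(X, U.1), (i.app U.1).hom a = res le_top h :=
    i.app_surjective U.1 U.2 _
  choose a ha using h1
  obtain ⟨H, hH⟩ := exists_section (fun U : X.affineOpens => U.1) (U := ⊤) (fun _ => le_top)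
    (zariskiCover X).iSup_eq_top.ge (fun U => a U ^ p ^ n) (by
      intro U V W hU hV hW
      have h2 : (p : Γ(X, W)) ^ n ∣ res hU (a U) - res hV (a V) := by
        refine app_surjective_of_ker i hi hW ?_
        rw [map_sub, app_res, app_res, ha, ha, res_res, res_res, sub_self]
      have h3 := dvd_sub_pow_of_dvd_sub ((dvd_pow_self _ hn).trans h2) n
      rw [natCast_pow_eq_zero_of_le le_top hX, zero_dvd_iff, sub_eq_zero] at h3
      simpa using h3)
  refine ⟨H, section_ext_of_iSup (fun U : X.affineOpens => i ⁻¹ᵁ U.1) (fun _ => le_top)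
    ((zariskiCover X).comap i).iSup_eq_top.ge fun U => ?_⟩
  refine (app_res i le_top H).symm.trans ?_
  rw [hH, map_pow, ha, map_pow]

/-- By the criterion for affineness it suffices that the global functions `H` with affine locus
`D(H)` generate the unit ideal. Enough such functions are obtained by lifting `p ^ n`-th powers from
`Z`. -/
theorem isAffine_of_isClosedImmersion_of_ker_eq_powIdeal {p n : ℕ} [hp : Fact p.Prime]
    {Z X : Scheme.{u}} (i : Z ⟶ X) [IsClosedImmersion i] [IsAffine Z] (hn : n ≠ 0)
    (hi : i.ker = powIdeal p n X) (hX : (p : Γ(X, ⊤)) ^ (n + 1) = 0) : IsAffine X := by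
  have hsurj := surjective_of_ker_eq_powIdeal i hn hi hX
  let s : Set Γ(X, ⊤) := {H | IsAffineOpen (X.basicOpen H)}
  let t : Set Γ(Z, ⊤) := {h | ∃ H ∈ s, i.appTop.hom H = h ^ p ^ n}
  have hq : p ^ n ≠ 0 := pow_ne_zero _ hp.out.ne_zero
  -- Around each point of `Z` choose `D(h)` inside the preimage of an affine `W`. For `H` lifting `h
  -- ^ p ^ n`, surjectivity of `i` on points gives `D(H) ≤ W`, so `D(H)` is a basic open set of `W`.
  have ht : Ideal.span t = ⊤ := by
    rw [← (isAffineOpen_top Z).iSup_basicOpen_eq_self_iff]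
    refine eq_top_iff.2 fun z _ => ?_
    obtain ⟨W, hW, hzW, -⟩ := exists_isAffineOpen_mem_and_subset (x := i z) (U := ⊤) trivial
    obtain ⟨h, hle, hzh⟩ := (isAffineOpen_top Z).exists_basicOpen_le (V := i ⁻¹ᵁ W) ⟨z, hzW⟩ trivial
    obtain ⟨H, hH⟩ := exists_app_eq_pow i hn hi hX h
    have hiH : i ⁻¹ᵁ X.basicOpen H = Z.basicOpen h := by
      rw [Scheme.preimage_basicOpen_top, hH, Scheme.basicOpen_pow _ _ hq.bot_lt]
    have hHW : X.basicOpen H ≤ W := by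
      intro y hy
      obtain ⟨z', rfl⟩ := hsurj y
      have : z' ∈ i ⁻¹ᵁ X.basicOpen H := hy
      rw [hiH] at this
      exact hle this
    have hHa : IsAffineOpen (X.basicOpen H) := by
      have := hW.basicOpen (res le_top H)
      rwa [Scheme.basicOpen_res, inf_eq_right.2 hHW] at this
    exact TopologicalSpace.Opens.mem_iSup.2 ⟨⟨h, H, hHa, hH⟩, hzh⟩
  -- Raising to the power `p ^ n` is additive modulo `p`, so membership in the span can be lifted up
  -- to an error divisible by `p`. For `x = 1` the lift becomes a unit on `Z`, because `p` is
  -- nilpotent, and therefore is a unit on `X`.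
  have key : ∀ x ∈ Ideal.span t, ∃ w ∈ Ideal.span s, (p : Γ(Z, ⊤)) ∣ i.appTop.hom w - x ^ p ^ n := by
    intro x hx
    induction hx using Submodule.span_induction with
    | mem x hx =>
      obtain ⟨H, hH, hx⟩ := hx
      exact ⟨H, Ideal.subset_span hH, by rw [hx, sub_self]; exact dvd_zero _⟩
    | zero => exact ⟨0, zero_mem _, by rw [map_zero, zero_pow hq, sub_self]; exact dvd_zero _⟩
    | add x y _ _ hx hy =>
      obtain ⟨w, hw, c, hc⟩ := hx
      obtain ⟨w', hw', c', hc'⟩ := hy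
      obtain ⟨r, hr⟩ := exists_add_pow_prime_pow_eq hp.out x y n
      refine ⟨w + w', add_mem hw hw', c + c' - x * y * r, ?_⟩
      rw [map_add, hr]
      linear_combination hc + hc'
    | smul a x _ hx =>
      obtain ⟨w, hw, c, hc⟩ := hx
      obtain ⟨A, hA⟩ := exists_app_eq_pow i hn hi hX a
      refine ⟨A * w, Ideal.mul_mem_left _ _ hw, a ^ p ^ n * c, ?_⟩
      rw [map_mul, hA, smul_eq_mul, mul_pow]
      linear_combination a ^ p ^ n * hc
  obtain ⟨w, hw, c, hc⟩ := key 1 (by rw [ht]; trivial)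
  have hw1 : IsUnit (i.appTop.hom w) := by
    have h1 : i.appTop.hom w = 1 + p * c := by rw [← hc]; simp
    rw [h1]
    have h2 : IsNilpotent ((p : Γ(Z, ⊤)) * c) := by
      refine ⟨n + 1, ?_⟩
      rw [mul_pow, natCast_pow_eq_zero_of_hom i hX, zero_mul]
    exact h2.isUnit_one_add
  have hw2 : IsUnit w := by
    have h1 : i ⁻¹ᵁ X.basicOpen w = ⊤ := by
      rw [Scheme.preimage_basicOpen_top]
      exact Scheme.basicOpen_of_isUnit _ hw1
    have h2 : X.basicOpen w = ⊤ := by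
      refine eq_top_iff.2 fun y _ => ?_
      obtain ⟨z, rfl⟩ := hsurj y
      exact h1.ge (show z ∈ ⊤ from trivial)
    have h3 : ∀ V : X.Opens, V = ⊤ → IsUnit (res (le_top : V ≤ ⊤) w) → IsUnit w := by
      rintro V rfl hV
      rwa [res_self] at hV
    exact h3 _ h2 (RingedSpace.isUnit_res_basicOpen X.toRingedSpace w)
  exact isAffine_of_isAffineOpen_basicOpen s (Ideal.eq_top_of_isUnit_mem _ hw hw2) fun _ h => h

theorem isAffineOpen_of_ker_eq_powIdeal {p n : ℕ} [hp : Fact p.Prime]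
    {Z X : Scheme.{u}} (i : Z ⟶ X) [IsClosedImmersion i] (hn : n ≠ 0)
    (hi : i.ker = powIdeal p n X) (hX : (p : Γ(X, ⊤)) ^ (n + 1) = 0) {U : X.Opens}
    (hU : IsAffineOpen (i ⁻¹ᵁ U)) : IsAffineOpen U := by
  have h := isPullback_morphismRestrict i U
  have : IsAffine (i ⁻¹ᵁ U).toScheme := hU
  refine isAffine_of_isClosedImmersion_of_ker_eq_powIdeal (n := n) (i ∣_ U) hn
    (ker_eq_powIdeal_of_isPullback h hi) ?_
  exact natCast_pow_eq_zero_of_hom U.ι hX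

end PrismEnv

namespace PrismEnv

namespace PadicFormalScheme

variable {p : ℕ} (Y T : PadicFormalScheme.{u} p)

/-! ### Topology of formal schemes -/

instance (n : ℕ) : IsClosedImmersion (Y.incl n) := Y.isClosedImmersion_incl n

theorem ker_incl_eq (n : ℕ) : (Y.incl n).ker = powIdeal p n (Y.level (n + 1)) :=
  (ker_eq_powIdeal_iff _).2 (Y.ker_incl n)

variable {Y T} in
-- Both horizontal closed immersions are defined by `p ^ n`, an ideal that is stable under base
-- change.
theorem isPullback_app (f : T ⟶ Y) (n : ℕ) :
    IsPullback (T.incl n) (f.app n) (f.app (n + 1)) (Y.incl n) :=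
  isPullback_of_ker_eq_powIdeal (f.comm n) (T.ker_incl_eq n) (Y.ker_incl_eq n)

/-- A family of schemes over the reductions of `Y` which is compatible with base change is a
formal scheme. -/
@[simps level incl]
def ofIsPullback {Y : PadicFormalScheme.{u} p} {Q : ℕ → Scheme.{u}} {i : ∀ n, Q n ⟶ Q (n + 1)}
    {f : ∀ n, Q n ⟶ Y.level n}
    (h : ∀ n, IsPullback (i n) (f n) (f (n + 1)) (Y.incl n)) : PadicFormalScheme p where
  level := Q
  incl := i
  isClosedImmersion_incl n := MorphismProperty.of_isPullback (h n).flip (Y.isClosedImmersion_incl n)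
  pow_eq_zero n := natCast_pow_eq_zero_of_hom (f n) (Y.pow_eq_zero n)
  ker_incl n :=
    have : IsClosedImmersion (i n) :=
      MorphismProperty.of_isPullback (h n).flip (Y.isClosedImmersion_incl n)
    (ker_eq_powIdeal_iff _).1 (ker_eq_powIdeal_of_isPullback (h n) (Y.ker_incl_eq n))

/-- The structure morphism of a family of schemes over the reductions of `Y`. -/
@[simps app]
def ofIsPullbackHom {Y : PadicFormalScheme.{u} p} {Q : ℕ → Scheme.{u}} {i : ∀ n, Q n ⟶ Q (n + 1)}
    {f : ∀ n, Q n ⟶ Y.level n}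
    (h : ∀ n, IsPullback (i n) (f n) (f (n + 1)) (Y.incl n)) : ofIsPullback h ⟶ Y where
  app := f
  comm n := (h n).w

theorem isEmpty_level_zero : IsEmpty (Y.level 0) := by
  have h : (1 : Γ(Y.level 0, ⊤)) = 0 := by simpa using Y.pow_eq_zero 0
  have h2 := Scheme.basicOpen_of_isUnit (Y.level 0) (isUnit_one (M := Γ(Y.level 0, ⊤)))
  rw [h, Scheme.basicOpen_zero] at h2
  exact ⟨fun x => h2.ge (show x ∈ ⊤ from trivial)⟩

theorem opens_level_zero_eq (U V : (Y.level 0).Opens) : U = V := by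
  have := Y.isEmpty_level_zero
  ext x
  exact this.elim x

theorem incl_surjective {n : ℕ} (hn : n ≠ 0) : Function.Surjective (Y.incl n) :=
  surjective_of_ker_eq_powIdeal _ hn (Y.ker_incl_eq n) (Y.pow_eq_zero (n + 1))

/-- The inclusion of the reduction modulo `p` in the reduction modulo `p ^ (n + 1)`. -/
def fromOne : ∀ n : ℕ, Y.level 1 ⟶ Y.level (n + 1)
  | 0 => 𝟙 _
  | n + 1 => fromOne n ≫ Y.incl (n + 1)

instance isClosedImmersion_fromOne : ∀ n : ℕ, IsClosedImmersion (Y.fromOne n)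
  | 0 => inferInstanceAs (IsClosedImmersion (𝟙 _))
  | n + 1 =>
    have := isClosedImmersion_fromOne n
    inferInstanceAs (IsClosedImmersion (Y.fromOne n ≫ Y.incl (n + 1)))

theorem fromOne_surjective : ∀ n : ℕ, Function.Surjective (Y.fromOne n)
  | 0 => fun x => ⟨x, rfl⟩
  | n + 1 => by
    have : ⇑(Y.fromOne (n + 1)) = Y.incl (n + 1) ∘ Y.fromOne n := by
      ext x; exact Scheme.Hom.comp_apply (Y.fromOne n) (Y.incl (n + 1)) x
    rw [this]
    exact (Y.incl_surjective n.succ_ne_zero).comp (fromOne_surjective n)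

variable {Y T} in
theorem fromOne_comp_app (f : T ⟶ Y) : ∀ n : ℕ, T.fromOne n ≫ f.app (n + 1) = f.app 1 ≫ Y.fromOne n
  | 0 => (Category.id_comp _).trans (Category.comp_id _).symm
  | n + 1 => by
    change (T.fromOne n ≫ T.incl (n + 1)) ≫ _ = _ ≫ Y.fromOne n ≫ Y.incl (n + 1)
    rw [Category.assoc, f.comm, ← Category.assoc, fromOne_comp_app f n, Category.assoc]

/-- The underlying homeomorphism of the inclusion of the reduction modulo `p`. -/
noncomputable def homeo (n : ℕ) : Y.level 1 ≃ₜ Y.level (n + 1) :=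
  IsHomeomorph.homeomorph (Y.fromOne n)
    (isHomeomorph_iff_isEmbedding_surjective.2
      ⟨(Y.fromOne n).isClosedEmbedding.isEmbedding, Y.fromOne_surjective n⟩)

theorem opens_le {n : ℕ} {U V : (Y.level (n + 1)).Opens}
    (h : Y.fromOne n ⁻¹ᵁ U ≤ Y.fromOne n ⁻¹ᵁ V) : U ≤ V := by
  intro x hx
  obtain ⟨y, rfl⟩ := Y.fromOne_surjective n x
  exact h hx

theorem opens_ext {n : ℕ} {U V : (Y.level (n + 1)).Opens}
    (h : Y.fromOne n ⁻¹ᵁ U = Y.fromOne n ⁻¹ᵁ V) : U = V :=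
  le_antisymm (Y.opens_le h.le) (Y.opens_le h.ge)

/-- The trace on the reduction modulo `p ^ n` of an open subset of the reduction modulo `p`. -/
noncomputable def traceOf (V : (Y.level 1).Opens) : ∀ n : ℕ, (Y.level n).Opens
  -- The reduction modulo `p ^ 0` is empty, so any value serves.
  | 0 => ⊤
  | n + 1 => ⟨(Y.homeo n).symm ⁻¹' V, V.2.preimage (Y.homeo n).symm.continuous⟩

theorem fromOne_preimage_traceOf (V : (Y.level 1).Opens) (n : ℕ) :
    Y.fromOne n ⁻¹ᵁ Y.traceOf V (n + 1) = V := by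
  ext x
  change (Y.homeo n).symm (Y.homeo n x) ∈ V ↔ x ∈ V
  rw [Homeomorph.symm_apply_apply]

theorem traceOf_one (V : (Y.level 1).Opens) : Y.traceOf V 1 = V :=
  Y.fromOne_preimage_traceOf V 0

theorem incl_preimage_traceOf (V : (Y.level 1).Opens) :
    ∀ n : ℕ, Y.incl n ⁻¹ᵁ Y.traceOf V (n + 1) = Y.traceOf V n
  | 0 => Y.opens_level_zero_eq _ _
  | n + 1 => Y.opens_ext ((Y.fromOne_preimage_traceOf V (n + 1)).trans
      (Y.fromOne_preimage_traceOf V n).symm)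

/-- The open formal subscheme whose underlying set is a given open subset. -/
@[simps]
noncomputable def ofOpen (V : (Y.level 1).Opens) : Y.FormalOpen where
  trace := Y.traceOf V
  preimage_trace := Y.incl_preimage_traceOf V

variable {Y} in
theorem FormalOpen.fromOne_preimage_trace (U : Y.FormalOpen) :
    ∀ n : ℕ, Y.fromOne n ⁻¹ᵁ U.trace (n + 1) = U.trace 1
  | 0 => rfl
  | n + 1 => by
    change Y.fromOne n ⁻¹ᵁ Y.incl (n + 1) ⁻¹ᵁ _ = _
    rw [U.preimage_trace, U.fromOne_preimage_trace n]

variable {Y T} in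
theorem FormalOpen.le_preimage (f : T ⟶ Y) (U : Y.FormalOpen) (W : T.FormalOpen)
    (h : W.trace 1 ≤ f.app 1 ⁻¹ᵁ U.trace 1) : ∀ n, W.trace n ≤ f.app n ⁻¹ᵁ U.trace n
  | 0 => (T.opens_level_zero_eq _ _).le
  | n + 1 => by
    refine T.opens_le ?_
    rw [W.fromOne_preimage_trace, ← Scheme.Hom.comp_preimage, fromOne_comp_app,
      Scheme.Hom.comp_preimage, U.fromOne_preimage_trace]
    exact h

/-- The preimage of an open formal subscheme. -/
@[simps]
def FormalOpen.comap {T Y : PadicFormalScheme.{u} p} (f : T ⟶ Y) (U : Y.FormalOpen) :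
    T.FormalOpen where
  trace n := f.app n ⁻¹ᵁ U.trace n
  preimage_trace n := by
    rw [← Scheme.Hom.comp_preimage, f.comm, Scheme.Hom.comp_preimage, U.preimage_trace]

theorem traceOf_mono {U V : (Y.level 1).Opens} (h : U ≤ V) : ∀ n, Y.traceOf U n ≤ Y.traceOf V n
  | 0 => le_rfl
  | n + 1 => Y.opens_le (by rwa [fromOne_preimage_traceOf, fromOne_preimage_traceOf])

/-- The directed open cover of a reduction of a formal scheme induced by a directed open cover. -/
noncomputable abbrev traceCover {ι : Type u} [Preorder ι] (W : DirectedCover (Y.level 1) ι) :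
    ∀ n : ℕ, DirectedCover (Y.level n) ι := fun n =>
  { opens := fun i => Y.traceOf (W.opens i) n
    mono := fun h => Y.traceOf_mono (W.mono h) n
    iSup_eq_top := by
      cases n with
      | zero => exact Y.opens_level_zero_eq _ _
      | succ n =>
        refine Y.opens_ext ?_
        rw [Scheme.Hom.preimage_iSup]
        simp only [fromOne_preimage_traceOf]
        exact W.iSup_eq_top
    directed := fun i j x hi hj => by
      cases n with
      | zero => exact Y.isEmpty_level_zero.elim x
      | succ n => exact W.directed i j ((Y.homeo n).symm x) hi hj }

variable {Y} in
theorem FormalOpen.isAffineOpen_trace [Fact p.Prime] (U : Y.FormalOpen)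
    (hU : IsAffineOpen (U.trace 1)) :
    ∀ n : ℕ, IsAffineOpen (U.trace n)
  | 0 => by
    rw [Y.opens_level_zero_eq (U.trace 0) (Y.incl 0 ⁻¹ᵁ U.trace 1)]
    exact hU.preimage _
  | 1 => hU
  | n + 2 => isAffineOpen_of_ker_eq_powIdeal (Y.incl (n + 1)) n.succ_ne_zero
      (Y.ker_incl_eq (n + 1)) (Y.pow_eq_zero (n + 2)) (by
        rw [U.preimage_trace]; exact U.isAffineOpen_trace hU (n + 1))

/-! ### Sections of formal schemes -/

variable {Y T} in
/-- The homomorphism between rings of sections induced by a morphism of formal schemes. -/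
def sectionsMap (f : T ⟶ Y) (U : Y.FormalOpen) (W : T.FormalOpen)
    (h : ∀ n, W.trace n ≤ f.app n ⁻¹ᵁ U.trace n) : Y.sections U →+* T.sections W where
  toFun s := ⟨fun n => ((f.app n).appLE _ _ (h n)).hom (s.1 n), fun n => by
    have h1 : (f.app (n + 1)).appLE _ _ (h (n + 1)) ≫
        (T.incl n).appLE _ _ (W.preimage_trace n).ge =
        (Y.incl n).appLE _ _ (U.preimage_trace n).ge ≫ (f.app n).appLE _ _ (h n) := by
      rw [Scheme.Hom.appLE_comp_appLE, Scheme.Hom.appLE_comp_appLE]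
      simp only [f.comm]
    refine (congrArg (fun g => g.hom (s.1 (n + 1))) h1).trans ?_
    exact congrArg ((f.app n).appLE _ _ (h n)).hom (s.2 n)⟩
  map_one' := Subtype.ext (funext fun n => map_one _)
  map_mul' s t := Subtype.ext (funext fun n => map_mul _ _ _)
  map_zero' := Subtype.ext (funext fun n => map_zero _)
  map_add' s t := Subtype.ext (funext fun n => map_add _ _ _)

theorem sectionsMap_coe {T Y : PadicFormalScheme.{u} p} (f : T ⟶ Y) (U : Y.FormalOpen)
    (W : T.FormalOpen) (h) (s : Y.sections U) (n : ℕ) :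
    (sectionsMap f U W h s).1 n = ((f.app n).appLE _ _ (h n)).hom (s.1 n) := rfl

theorem sectionsMap_sectionsMap {T' T Y : PadicFormalScheme.{u} p} (f : T ⟶ Y) (f' : T' ⟶ T)
    (U : Y.FormalOpen) (W : T.FormalOpen) (W' : T'.FormalOpen) (h) (h') (s : Y.sections U) :
    sectionsMap f' W W' h' (sectionsMap f U W h s) = sectionsMap (f' ≫ f) U W'
      (fun n => (h' n).trans (Scheme.Hom.preimage_mono _ (h n))) s := by
  ext n
  exact congrArg (fun g : Γ(Y.level n, U.trace n) ⟶ Γ(T'.level n, W'.trace n) => g.hom (s.1 n))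
    (Scheme.Hom.appLE_comp_appLE (f'.app n) (f.app n) _ _ _ _ _)

end PadicFormalScheme

end PrismEnv

namespace PrismEnv

/-! ### Limits of rings modulo powers of `p` -/

section LimRing

variable {p : ℕ}

theorem exists_compatible {R : ℕ → Type*} (t : ∀ n, R (n + 1) → R n)
    (ht : ∀ n, Function.Surjective (t n)) (n : ℕ) (x : R n) :
    ∃ s : ∀ m, R m, (∀ m, t m (s (m + 1)) = s m) ∧ s n = x := by
  induction n generalizing R with
  | zero =>
    choose σ hσ using ht
    exact ⟨fun m => Nat.rec x (fun m y => σ m y) m, fun m => hσ m _, rfl⟩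
  | succ n ih =>
    obtain ⟨s, hs, hx⟩ := ih (R := fun m => R (m + 1)) (fun m => t (m + 1)) (fun m => ht (m + 1)) x
    refine ⟨fun m => match m with
      | 0 => t 0 (s 0)
      | m + 1 => s m, fun m => ?_, hx⟩
    cases m with
    | zero => rfl
    | succ m => exact hs m

variable {R : ℕ → Type*} [∀ n, CommRing (R n)] (t : ∀ n, R (n + 1) →+* R n)

theorem eq_zero_of_compatible {s : ∀ m, R m} (hs : ∀ m, t m (s (m + 1)) = s m) {m : ℕ} (k : ℕ)
    (h : s (k + m) = 0) : s m = 0 := by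
  induction k with
  | zero => rwa [Nat.zero_add] at h
  | succ k ih =>
    apply ih
    rw [← hs (k + m)]
    have : s (k + m + 1) = 0 := by
      have e : k + 1 + m = k + m + 1 := by omega
      rw [← e]; exact h
    rw [this, map_zero]

theorem eq_zero_of_compatible_of_le {s : ∀ m, R m} (hs : ∀ m, t m (s (m + 1)) = s m) {m n : ℕ}
    (hmn : m ≤ n) (h : s n = 0) : s m = 0 := by
  obtain ⟨k, rfl⟩ := Nat.exists_eq_add_of_le' hmn
  exact eq_zero_of_compatible t hs k h

/-- Successive approximation: a quotient valid at level `n + k` is corrected by a multiple of `p ^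
k` to one valid at level `n + k + 1`, and the corrections converge. -/
theorem exists_pow_mul_eq (ht : ∀ n, Function.Surjective (t n))
    (hker : ∀ n (x : R (n + 1)), t n x = 0 → (p : R (n + 1)) ^ n ∣ x)
    {s : ∀ m, R m} (hs : ∀ m, t m (s (m + 1)) = s m) {n : ℕ}
    (hp : ∀ n, (p : R n) ^ n = 0) (h : s n = 0) :
    ∃ r : ∀ m, R m, (∀ m, t m (r (m + 1)) = r m) ∧ ∀ m, s m = p ^ n * r m := by
  -- The predicate says that `e` is a compatible family which is a quotient of `s` by `p ^ n` at
  -- level `n + k`.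
  let P (k : ℕ) (e : ∀ m, R m) : Prop :=
    (∀ m, t m (e (m + 1)) = e m) ∧ s (n + k) - p ^ n * e (n + k) = 0
  have step (k : ℕ) (e : ∀ m, R m) (he : P k e) :
      ∃ c : ∀ m, R m, P (k + 1) (fun m => e m + p ^ k * c m) := by
    obtain ⟨z, hz⟩ := hker (n + k) (s (n + k + 1) - p ^ n * e (n + k + 1)) (by
      rw [map_sub, map_mul, map_pow, map_natCast, hs, he.1, he.2])
    obtain ⟨c, hc, hcz⟩ := exists_compatible (fun m => t m) ht (n + k + 1) z
    refine ⟨c, fun m => ?_, ?_⟩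
    · simp only [map_add, map_mul, map_pow, map_natCast, he.1, hc]
    · change s (n + k + 1) - p ^ n * (e (n + k + 1) + p ^ k * c (n + k + 1)) = 0
      rw [hcz]
      linear_combination hz
  choose c hc using step
  let e : ∀ k, {e : ∀ m, R m // P k e} := fun k => Nat.rec
    ⟨fun _ => 0, fun _ => map_zero _, by simp [h]⟩
    (fun k e => ⟨fun m => e.1 m + p ^ k * c k e.1 e.2 m, hc k e.1 e.2⟩) k
  have he (k m : ℕ) : (e (k + 1)).1 m = (e k).1 m + p ^ k * c k (e k).1 (e k).2 m := rfl
  -- The diagonal is compatible because the `m`-th correction is a multiple of `p ^ m`, which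
  -- vanishes in `R m`.
  refine ⟨fun m => (e m).1 m, fun m => ?_, fun m => ?_⟩
  · rw [(e (m + 1)).2.1, he, hp, zero_mul, add_zero]
  · have := eq_zero_of_compatible_of_le t (s := fun m' => s m' - p ^ n * (e m).1 m')
      (fun m' => by simp [hs, (e m).2.1]) (Nat.le_add_left m n) (e m).2.2
    exact sub_eq_zero.1 this

end LimRing

namespace PadicFormalScheme

variable {p : ℕ} {Y T : PadicFormalScheme.{u} p}

/-- The transition maps of the rings of sections. -/
noncomputable abbrev trans (U : Y.FormalOpen) (n : ℕ) :
    Γ(Y.level (n + 1), U.trace (n + 1)) →+* Γ(Y.level n, U.trace n) :=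
  ((Y.incl n).appLE _ _ (U.preimage_trace n).ge).hom

theorem trans_eq_zero_iff (U : Y.FormalOpen) (n : ℕ) (x : Γ(Y.level (n + 1), U.trace (n + 1))) :
    trans U n x = 0 ↔ ((Y.incl n).app (U.trace (n + 1))).hom x = 0 := by
  rw [trans, appLE_eq_res_app]
  have h (V : (Y.level n).Opens) (e : U.trace n = V) (z : Γ(Y.level n, V)) :
      res e.le z = 0 ↔ z = 0 := by
    subst e
    rw [res_self]
  exact h _ (U.preimage_trace n).symm _

theorem pow_eq_zero_trace (U : Y.FormalOpen) (n : ℕ) : (p : Γ(Y.level n, U.trace n)) ^ n = 0 :=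
  natCast_pow_eq_zero_of_le le_top (Y.pow_eq_zero n)

theorem pow_dvd_of_trans_eq_zero (U : Y.FormalOpen) {n : ℕ} (hU : IsAffineOpen (U.trace (n + 1)))
    (x : Γ(Y.level (n + 1), U.trace (n + 1))) (h : trans U n x = 0) :
    (p : Γ(Y.level (n + 1), U.trace (n + 1))) ^ n ∣ x :=
  app_surjective_of_ker _ (Y.ker_incl_eq n) hU ((trans_eq_zero_iff U n x).1 h)

theorem trans_surjective (U : Y.FormalOpen) {n : ℕ} (hU : IsAffineOpen (U.trace (n + 1))) :
    Function.Surjective (trans U n) := by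
  have h := (Y.incl n).app_surjective _ hU
  have h2 (V : (Y.level n).Opens) (e : U.trace n = V) : Function.Surjective (res e.le) := by
    subst e
    exact fun z => ⟨z, res_self _ z⟩
  exact (h2 _ (U.preimage_trace n).symm).comp h

section Affine

variable [Fact p.Prime] {U : Y.FormalOpen}

theorem exists_section_coe_eq (hU : IsAffineOpen (U.trace 1)) (n : ℕ) (x : Γ(Y.level n, U.trace n)) :
    ∃ s : Y.sections U, s.1 n = x := by
  obtain ⟨s, hs, hx⟩ := exists_compatible (R := fun m => Γ(Y.level m, U.trace m))
    (fun m => trans U m)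
    (fun m => trans_surjective U (U.isAffineOpen_trace hU (m + 1))) n x
  exact ⟨⟨s, hs⟩, hx⟩

theorem exists_eq_pow_mul (hU : IsAffineOpen (U.trace 1)) {n : ℕ} {s : Y.sections U}
    (h : s.1 n = 0) : ∃ r : Y.sections U, s = p ^ n * r := by
  obtain ⟨r, hr, hs⟩ := exists_pow_mul_eq (p := p)
    (R := fun m => Γ(Y.level m, U.trace m)) (fun m => trans U m)
    (fun m => trans_surjective U (U.isAffineOpen_trace hU (m + 1)))
    (fun m x hx => pow_dvd_of_trans_eq_zero U (U.isAffineOpen_trace hU (m + 1)) x hx) s.2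
    (pow_eq_zero_trace U) h
  refine ⟨⟨r, hr⟩, Subtype.ext (funext fun m => (hs m).trans ?_)⟩
  simp

end Affine

theorem IsPTorsionFree.pow_mul_cancel (hY : Y.IsPTorsionFree) {U : Y.FormalOpen} (n : ℕ)
    {s t : Y.sections U} (h : (p : Y.sections U) ^ n * s = p ^ n * t) : s = t := by
  rw [← sub_eq_zero] at h ⊢
  rw [← mul_sub] at h
  induction n with
  | zero => simpa using h
  | succ n ih => exact ih (hY U _ (by rw [← mul_assoc, ← pow_succ']; exact h))

/-- Restriction of sections to a smaller open formal subscheme. -/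
noncomputable def resSec {U W : Y.FormalOpen} (h : W.trace 1 ≤ U.trace 1) :
    Y.sections U →+* Y.sections W :=
  sectionsMap (𝟙 Y) U W (FormalOpen.le_preimage (𝟙 Y) U W h)

theorem FormalOpen.trace_le {U W : Y.FormalOpen} (h : W.trace 1 ≤ U.trace 1) (n : ℕ) :
    W.trace n ≤ U.trace n :=
  FormalOpen.le_preimage (𝟙 Y) U W h n

theorem resSec_coe {U W : Y.FormalOpen} (h : W.trace 1 ≤ U.trace 1) (s : Y.sections U) (n : ℕ) :
    (resSec h s).1 n = res (FormalOpen.trace_le h n) (s.1 n) :=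
  congrArg (fun f : Γ(Y.level n, U.trace n) ⟶ Γ(Y.level n, W.trace n) => f.hom (s.1 n))
    ((Category.id_comp _ : 𝟙 _ ≫ (Y.level n).presheaf.map (homOfLE (FormalOpen.trace_le h n)).op = _))

theorem res_trans {U W : Y.FormalOpen} (h : W.trace 1 ≤ U.trace 1) (n : ℕ)
    (x : Γ(Y.level (n + 1), U.trace (n + 1))) :
    res (FormalOpen.trace_le h n) (trans U n x) =
      trans W n (res (FormalOpen.trace_le h (n + 1)) x) := by
  have : (Y.incl n).appLE _ _ (U.preimage_trace n).ge ≫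
      (Y.level n).presheaf.map (homOfLE (FormalOpen.trace_le h n)).op =
      (Y.level (n + 1)).presheaf.map (homOfLE (FormalOpen.trace_le h (n + 1))).op ≫
        (Y.incl n).appLE _ _ (W.preimage_trace n).ge := by
    rw [Scheme.Hom.appLE_map, Scheme.Hom.map_appLE]
  exact congrArg (fun f : Γ(Y.level (n + 1), U.trace (n + 1)) ⟶ Γ(Y.level n, W.trace n) => f.hom x)
    this

theorem exists_formalOpen_trace_eq {n : ℕ} {W : (Y.level (n + 1)).Opens} (hW : IsAffineOpen W) :
    ∃ G : Y.FormalOpen, IsAffineOpen (G.trace 1) ∧ G.trace (n + 1) = W := by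
  refine ⟨Y.ofOpen (Y.fromOne n ⁻¹ᵁ W), ?_, Y.opens_ext ?_⟩
  · rw [ofOpen_trace, traceOf_one]
    exact hW.preimage _
  · rw [ofOpen_trace, fromOne_preimage_traceOf]

theorem section_zero_ext {U : (Y.level 0).Opens} (s t : Γ(Y.level 0, U)) : s = t := by
  have h : (1 : Γ(Y.level 0, U)) = 0 := by
    simpa using natCast_pow_eq_zero_of_le (le_top : U ≤ ⊤) (Y.pow_eq_zero 0)
  rw [← mul_one s, ← mul_one t, h, mul_zero, mul_zero]

/-! ### Torsion freeness of formal schemes -/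

/-- On a `p`-torsion free formal scheme, the `p`-torsion of the reduction modulo `p ^ (n + 1)` is
killed by reduction modulo `p ^ n`. -/
theorem IsPTorsionFree.app_eq_zero [Fact p.Prime] (hY : Y.IsPTorsionFree) {n : ℕ}
    {U : (Y.level (n + 1)).Opens} {x : Γ(Y.level (n + 1), U)} (hx : p * x = 0) :
    ((Y.incl n).app U).hom x = 0 := by
  refine section_ext_of_iSup (ι := {V : (Y.level (n + 1)).affineOpens // V.1 ≤ U})
    (fun V => Y.incl n ⁻¹ᵁ V.1.1) (fun V => Scheme.Hom.preimage_mono _ V.2) ?_ ?_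
  · intro y hy
    obtain ⟨V, hV, hyV, hVU⟩ := exists_isAffineOpen_mem_and_subset (x := Y.incl n y) (U := U) hy
    exact TopologicalSpace.Opens.mem_iSup.2 ⟨⟨⟨V, hV⟩, hVU⟩, hyV⟩
  · rintro ⟨⟨V, hV⟩, hVU⟩
    change V ≤ U at hVU
    rw [← app_res _ hVU, map_zero]
    obtain ⟨G, hG, rfl⟩ := exists_formalOpen_trace_eq hV
    rw [← trans_eq_zero_iff]
    obtain ⟨s, hs⟩ := exists_section_coe_eq hG (n + 1) (res hVU x)
    -- Lift `x` to a section `s`. As `p * s` vanishes at level `n + 1`, it equals `p ^ (n + 1) * r`;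
    -- cancelling one `p` leaves `s = p ^ n * r`, which vanishes at level `n`.
    obtain ⟨r, hr⟩ := exists_eq_pow_mul hG (s := p * s) (n := n + 1) (by
      have := congrArg (res hVU) hx
      simpa [← hs] using this)
    have h1 : s = p ^ n * r := by
      refine hY.pow_mul_cancel 1 ?_
      rw [pow_one, hr]
      ring
    rw [← hs]
    refine (s.2 n).trans ?_
    rw [h1]
    have := pow_eq_zero_trace G n
    simp [this]

/-- Multiplying by a power of `f` turns a `p`-torsion section over `D(f)` into the restriction of a
`p`-torsion section over `V`, and `f` is invertible on `D(f)`. -/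
theorem app_basicOpen_eq_zero {X Z : Scheme.{u}} (i : Z ⟶ X) {V : X.Opens} (hV : IsAffineOpen V)
    (f : Γ(X, V)) (H : ∀ x : Γ(X, V), p * x = 0 → (i.app V).hom x = 0)
    (x : Γ(X, X.basicOpen f)) (hx : p * x = 0) : (i.app (X.basicOpen f)).hom x = 0 := by
  have := hV.isLocalization_basicOpen f
  obtain ⟨N, a, ha⟩ := IsLocalization.Away.surj f x
  have hu : IsUnit (res (X.basicOpen_le f) f) := IsLocalization.Away.algebraMap_isUnit f
  change x * (res (X.basicOpen_le f) f) ^ N = res (X.basicOpen_le f) a at ha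
  have h1 : algebraMap Γ(X, V) Γ(X, X.basicOpen f) (p * a) = 0 := by
    change res (X.basicOpen_le f) (p * a) = 0
    rw [map_mul, map_natCast, ← ha, ← mul_assoc, hx, zero_mul]
  rw [IsLocalization.map_eq_zero_iff (.powers f)] at h1
  obtain ⟨⟨_, M, rfl⟩, hM⟩ := h1
  have h2 := H (f ^ M * a) (by linear_combination hM)
  have h3 := congrArg (res (i.preimage_mono (X.basicOpen_le f))) h2
  rw [← app_res i (X.basicOpen_le f), map_zero, map_mul, ← ha, map_pow, map_mul, map_mul] at h3
  have h4 := ((hu.pow M).map (i.app (X.basicOpen f)).hom)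
  have h5 := ((hu.pow N).map (i.app (X.basicOpen f)).hom)
  rwa [h4.mul_right_eq_zero, h5.mul_left_eq_zero] at h3

/-- Being `p`-torsion free can be checked on an affine cover of the reductions. -/
theorem isPTorsionFree_of_iSup_eq_top {ι : ℕ → Type*} (V : ∀ n, ι n → (Y.level (n + 1)).Opens)
    (hV : ∀ n i, IsAffineOpen (V n i)) (hcov : ∀ n, ⨆ i, V n i = ⊤)
    (H : ∀ n i (x : Γ(Y.level (n + 1), V n i)), p * x = 0 → ((Y.incl n).app (V n i)).hom x = 0) :
    Y.IsPTorsionFree := by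
  intro U s hs
  refine Subtype.ext (funext fun n => ?_)
  -- The component at level `n` is the image of the component at level `n + 1`, which `p` kills.
  -- Only the vanishing of this image is needed.
  rw [← s.2 n]
  refine (trans_eq_zero_iff U n _).2 ?_
  have hx : (p : Γ(Y.level (n + 1), U.trace (n + 1))) * s.1 (n + 1) = 0 := by
    simpa using congrFun (congrArg Subtype.val hs) (n + 1)
  refine (Y.level n).IsSheaf.section_ext fun y hy => ?_
  obtain ⟨i, hi⟩ := TopologicalSpace.Opens.mem_iSup.1 ((hcov n).ge (show Y.incl n y ∈ ⊤ from trivial))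
  obtain ⟨f, hfU, hyf⟩ := (hV n i).exists_basicOpen_le ⟨Y.incl n y, hy⟩ hi
  refine ⟨Y.incl n ⁻¹ᵁ (Y.level (n + 1)).basicOpen f, Scheme.Hom.preimage_mono _ hfU, hyf, ?_⟩
  refine (app_res (Y.incl n) hfU (s.1 (n + 1))).symm.trans (Eq.trans ?_ (map_zero _).symm)
  refine app_basicOpen_eq_zero (Y.incl n) (hV n i) f (H n i) _ ?_
  simpa using congrArg (res hfU) hx

/-- On a `p`-torsion free formal scheme, sections which vanish modulo `p` are divisible by `p`. -/
theorem IsPTorsionFree.exists_eq_mul [Fact p.Prime] (hY : Y.IsPTorsionFree) {U : Y.FormalOpen}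
    {s : Y.sections U} (hs : s.1 1 = 0) : ∃ r : Y.sections U, s = p * r := by
  let ι := {V : (Y.level 1).affineOpens // V.1 ≤ U.trace 1}
  let F (V : ι) : Y.FormalOpen := Y.ofOpen V.1.1
  have hF1 (V : ι) : (F V).trace 1 = V.1.1 := Y.traceOf_one _
  have hFU (V : ι) : (F V).trace 1 ≤ U.trace 1 := (hF1 V).trans_le V.2
  have hex (V : ι) : ∃ r : Y.sections (F V), resSec (hFU V) s = p * r := by
    have h1 : IsAffineOpen ((F V).trace 1) := by rw [hF1]; exact V.1.2
    obtain ⟨r, hr⟩ := exists_eq_pow_mul h1 (s := resSec (hFU V) s) (n := 1) (by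
      rw [resSec_coe, hs, map_zero])
    exact ⟨r, by rw [hr, pow_one]⟩
  choose r hr using hex
  have hcov (n : ℕ) : U.trace n ≤ ⨆ V : ι, (F V).trace n := by
    cases n with
    | zero => exact (Y.opens_level_zero_eq _ _).le
    | succ n =>
      refine Y.opens_le ?_
      rw [U.fromOne_preimage_trace, Scheme.Hom.preimage_iSup]
      intro x hx
      obtain ⟨V, hV, hxV, hVU⟩ := exists_isAffineOpen_mem_and_subset hx
      refine TopologicalSpace.Opens.mem_iSup.2 ⟨⟨⟨V, hV⟩, hVU⟩, ?_⟩
      rw [FormalOpen.fromOne_preimage_trace, hF1]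
      exact hxV
  have hglue (n : ℕ) : ∃ t : Γ(Y.level n, U.trace n), ∀ V : ι,
      res (FormalOpen.trace_le (hFU V) n) t = (r V).1 n := by
    refine exists_section (fun V : ι => (F V).trace n) _ (hcov n) (fun V => (r V).1 n) ?_
    intro V V' W hV hV' hW
    cases n with
    | zero => exact section_zero_ext _ _
    | succ n =>
      obtain ⟨G, hG, rfl⟩ := exists_formalOpen_trace_eq hW
      have hle (V : ι) (h : G.trace (n + 1) ≤ (F V).trace (n + 1)) : G.trace 1 ≤ (F V).trace 1 := by
        rw [← G.fromOne_preimage_trace n, ← (F V).fromOne_preimage_trace n]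
        exact Scheme.Hom.preimage_mono _ h
      -- Both sides are quotients by `p` of the same section, and such a quotient is unique on a
      -- `p`-torsion free formal scheme.
      have h1 : resSec (hle V hV) (r V) = resSec (hle V' hV') (r V') := by
        refine hY.pow_mul_cancel 1 ?_
        have h2 := congrArg (resSec (hle V hV)) (hr V)
        have h3 := congrArg (resSec (hle V' hV')) (hr V')
        rw [map_mul, map_natCast] at h2 h3
        rw [pow_one, ← h2, ← h3]
        refine (sectionsMap_sectionsMap _ _ _ _ _ _ _ _).trans
          (sectionsMap_sectionsMap _ _ _ _ _ _ _ _).symm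
      have h2 := congrFun (congrArg Subtype.val h1) (n + 1)
      rwa [resSec_coe, resSec_coe] at h2
  choose t ht using hglue
  refine ⟨⟨t, fun n => ?_⟩, Subtype.ext (funext fun n => ?_)⟩
  · refine section_ext_of_iSup (fun V : ι => (F V).trace n)
      (fun V => FormalOpen.trace_le (hFU V) n) (hcov n) fun V => ?_
    refine (res_trans (hFU V) n _).trans ?_
    rw [ht, ht]
    exact (r V).2 n
  · refine section_ext_of_iSup (fun V : ι => (F V).trace n)
      (fun V => FormalOpen.trace_le (hFU V) n) (hcov n) fun V => ?_
    have h1 := congrFun (congrArg Subtype.val (hr V)) n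
    rw [resSec_coe] at h1
    rw [h1]
    change _ = res _ ((p : ∀ n, Γ(Y.level n, U.trace n)) n * t n)
    rw [map_mul, ht]
    simp

end PadicFormalScheme

end PrismEnv

namespace PrismEnv

/-! ### Dilatation algebras -/

section Dilatation

variable {A : Type*} [CommRing A]

/-- The dilatation algebra `A[I / p]`, modulo `p`-power torsion. -/
def dilAlgebra (p : ℕ) (I : Ideal A) : Subalgebra A (Localization.Away (p : A)) :=
  Algebra.adjoin A {x | ∃ a ∈ I, (p : Localization.Away (p : A)) * x = algebraMap _ _ a}

theorem isUnit_natCast_away (p : ℕ) : IsUnit (p : Localization.Away (p : A)) := by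
  have := IsLocalization.Away.algebraMap_isUnit (S := Localization.Away (p : A)) (p : A)
  simpa using this

theorem dilAlgebra_torsionFree {p : ℕ} {I : Ideal A} {b : dilAlgebra p I} (h : p * b = 0) :
    b = 0 := by
  have h1 : (p : Localization.Away (p : A)) * b.1 = 0 := by simpa using congrArg Subtype.val h
  exact Subtype.ext ((isUnit_natCast_away p).mul_right_eq_zero.1 h1)

theorem exists_pow_mul_mem {p : ℕ} {I : Ideal A} (b : dilAlgebra p I) :
    ∃ (k : ℕ) (a : A), p ^ k * b = algebraMap A (dilAlgebra p I) a := by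
  obtain ⟨k, a, h⟩ := IsLocalization.Away.surj (p : A) b.1
  refine ⟨k, a, Subtype.ext ?_⟩
  rw [mul_comm] at h
  simpa using h

theorem exists_mul_eq_of_mem {p : ℕ} {I : Ideal A} {a : A} (ha : a ∈ I) :
    ∃ b : dilAlgebra p I, algebraMap A (dilAlgebra p I) a = p * b := by
  obtain ⟨u, hu⟩ := isUnit_natCast_away (A := A) p
  have h : (p : Localization.Away (p : A)) * (↑u⁻¹ * algebraMap A _ a) = algebraMap A _ a := by
    rw [← hu, ← mul_assoc, Units.mul_inv, one_mul]
  exact ⟨⟨_, Algebra.subset_adjoin ⟨a, ha, h⟩⟩, Subtype.ext (by simpa using h.symm)⟩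

theorem algebraMap_away_injective {p : ℕ} (hA : ∀ a : A, p * a = 0 → a = 0) :
    Function.Injective (algebraMap A (Localization.Away (p : A))) := by
  rw [injective_iff_map_eq_zero]
  intro a ha
  rw [IsLocalization.map_eq_zero_iff (.powers (p : A))] at ha
  obtain ⟨⟨_, k, rfl⟩, hk⟩ := ha
  change (p : A) ^ k * a = 0 at hk
  induction k with
  | zero => simpa using hk
  | succ k ih => exact ih (hA _ (by rw [← mul_assoc, ← pow_succ']; exact hk))

theorem pow_mul_cancel_of_torsionFree {p : ℕ} (hA : ∀ a : A, p * a = 0 → a = 0) (k : ℕ) {a b : A}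
    (h : (p : A) ^ k * a = p ^ k * b) : a = b := by
  rw [← sub_eq_zero] at h ⊢
  rw [← mul_sub] at h
  induction k with
  | zero => simpa using h
  | succ k ih => exact ih (hA _ (by rw [← mul_assoc, ← pow_succ']; exact h))

/-- Every element of the dilatation algebra is carried into the image of `A` by a power of `p`, and
powers of `p` can be cancelled in `R`. -/
theorem dilAlgebra_hom_ext {p : ℕ} {I : Ideal A} {R : Type*} [CommRing R]
    (hR : ∀ r : R, p * r = 0 → r = 0) {g g' : dilAlgebra p I →+* R}
    (h : ∀ a, g (algebraMap A _ a) = g' (algebraMap A _ a)) : g = g' := by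
  ext b
  obtain ⟨k, a, hk⟩ := exists_pow_mul_mem b
  refine pow_mul_cancel_of_torsionFree hR k ?_
  have h1 := congrArg g hk
  have h2 := congrArg g' hk
  rw [map_mul, map_pow, map_natCast] at h1 h2
  rw [h1, h2, h]

/-- Extend `φ` to the localizations at `p`. A generator `a / p` is sent to `φ a / p`, which lies in
`R` because `p` divides `φ a`; and `R` embeds in `R[1/p]` because it has no `p`-torsion. -/
theorem exists_dilAlgebra_hom {p : ℕ} {I : Ideal A} {R : Type*} [CommRing R]
    (hR : ∀ r : R, p * r = 0 → r = 0) (φ : A →+* R) (hφ : ∀ a ∈ I, (p : R) ∣ φ a) :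
    ∃ g : dilAlgebra p I →+* R, ∀ a, g (algebraMap A _ a) = φ a := by
  let j := algebraMap R (Localization.Away (p : R))
  have hj : Function.Injective j := algebraMap_away_injective hR
  have hu : IsUnit ((j.comp φ) (p : A)) := by
    rw [map_natCast]; exact isUnit_natCast_away p
  let l : Localization.Away (p : A) →+* Localization.Away (p : R) :=
    IsLocalization.Away.lift (p : A) hu
  have hl (a : A) : l (algebraMap A _ a) = j (φ a) := IsLocalization.Away.lift_eq (p : A) hu a
  have hmem (b : dilAlgebra p I) : l b.1 ∈ j.range := by
    obtain ⟨b, hb⟩ := b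
    change l b ∈ j.range
    induction hb using Algebra.adjoin_induction with
    | mem x hx =>
      obtain ⟨a, ha, hx⟩ := hx
      obtain ⟨r, hr⟩ := hφ a ha
      refine ⟨r, ((isUnit_natCast_away (A := R) p).mul_right_inj).1 ?_⟩
      have := congrArg l hx
      rw [hl, hr, map_mul, map_mul, map_natCast, map_natCast] at this
      exact this.symm
    | algebraMap a => exact ⟨φ a, (hl a).symm⟩
    | add x y _ _ hx hy => rw [map_add]; exact add_mem hx hy
    | mul x y _ _ hx hy => rw [map_mul]; exact mul_mem hx hy
  let e : R ≃+* j.range := RingEquiv.ofBijective j.rangeRestrict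
    ⟨fun x y h => hj (congrArg Subtype.val h), j.rangeRestrict_surjective⟩
  refine ⟨(e.symm : j.range →+* R).comp
    ((l.comp (dilAlgebra p I).val.toRingHom).codRestrict j.range hmem), fun a => ?_⟩
  refine (e.symm_apply_eq).2 (Subtype.ext ?_)
  exact hl a

/-- A homomorphism of rings which induces a localization at `f` modulo all powers of `p`. -/
structure IsPLocalization (p : ℕ) {A A' : Type*} [CommRing A] [CommRing A'] (φ : A →+* A')
    (f : A) : Prop where
  exists_unit : ∀ m : ℕ, ∃ u d, φ f * u = 1 + (p : A') ^ m * d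
  exists_eq : ∀ (m : ℕ) (a' : A'), ∃ N a d, φ f ^ N * a' = φ a + (p : A') ^ m * d
  exists_dvd : ∀ (m : ℕ) (a : A), (p : A') ^ m ∣ φ a → ∃ N, (p : A) ^ m ∣ f ^ N * a

/-- The hypothesis `hI` says that `I` is the preimage of `I'` up to powers of `f`. Numerators can
then be moved from `A'` to `A`, provided the denominators `p ^ k` are controlled independently of
the precision `m`. -/
theorem IsPLocalization.dilAlgebra {p : ℕ} {A A' : Type*} [CommRing A] [CommRing A']
    {φ : A →+* A'} {f : A} (h : IsPLocalization p φ f) {I : Ideal A} {I' : Ideal A'}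
    (hA : ∀ a : A, p * a = 0 → a = 0) (hA' : ∀ a : A', p * a = 0 → a = 0)
    (hp : (p : A') ∈ I')
    (hI : ∀ a, φ a ∈ I' → ∃ N, f ^ N * a ∈ I)
    (g : dilAlgebra p I →+* dilAlgebra p I')
    (hg : ∀ a, g (algebraMap A _ a) = algebraMap A' _ (φ a)) :
    IsPLocalization p g (algebraMap A _ f) := by
  have hinj : Function.Injective (algebraMap A' (PrismEnv.dilAlgebra p I')) := fun x y hxy =>
    algebraMap_away_injective hA' (congrArg Subtype.val hxy)
  have hinjA : Function.Injective (algebraMap A (PrismEnv.dilAlgebra p I)) := fun x y hxy =>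
    algebraMap_away_injective hA (congrArg Subtype.val hxy)
  have htf := fun b => dilAlgebra_torsionFree (p := p) (I := I') (b := b)
  have htfB := fun b => dilAlgebra_torsionFree (p := p) (I := I) (b := b)
  -- Two strengthenings make the induction and its use below possible: the denominator exponent `k`
  -- of `c` is uniform in `m`, and the error `d` lies in `A'` instead of the dilatation algebra.
  have key : ∀ b' : PrismEnv.dilAlgebra p I', ∃ k : ℕ, ∀ m : ℕ,
      ∃ (N : ℕ) (c : PrismEnv.dilAlgebra p I) (a : A) (d : A'), p ^ k * c = algebraMap A _ a ∧
        algebraMap A' _ (φ f) ^ N * b' = g c + p ^ m * algebraMap A' _ d := by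
    rintro ⟨b', hb'⟩
    induction hb' using Algebra.adjoin_induction with
    | mem x hx =>
      obtain ⟨a', ha', hx⟩ := hx
      refine ⟨1, fun m => ?_⟩
      -- One power of `p` in the precision is spent because the generator is `a' / p`.
      obtain ⟨N, a, d, h1⟩ := h.exists_eq (m + 1) a'
      obtain ⟨M, hM⟩ := hI a (by
        have : φ a = φ f ^ N * a' - p * (p ^ m * d) := by rw [h1]; ring
        rw [this]
        exact sub_mem (I'.mul_mem_left _ ha') (I'.mul_mem_right _ hp))
      obtain ⟨c, hc⟩ := exists_mul_eq_of_mem (p := p) hM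
      refine ⟨N + M, c, f ^ M * a, φ f ^ M * d, by rw [pow_one, hc], ?_⟩
      refine pow_mul_cancel_of_torsionFree htf 1 ?_
      have hX : ∀ X : PrismEnv.dilAlgebra p I', X.1 = x → p * X = algebraMap A' _ a' := by
        rintro X rfl
        exact Subtype.ext (by simpa using hx)
      have hX1 := hX ⟨x, Algebra.subset_adjoin ⟨a', ha', hx⟩⟩ rfl
      have h2 := congrArg g hc
      have h3 := congrArg (algebraMap A' (PrismEnv.dilAlgebra p I')) h1
      simp only [map_mul, map_pow, map_natCast, hg] at h2
      simp only [map_mul, map_pow, map_add, map_natCast] at h3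
      simp only [map_mul, map_pow]
      linear_combination (algebraMap A' (PrismEnv.dilAlgebra p I') (φ f)) ^ (N + M) * hX1 +
        (algebraMap A' (PrismEnv.dilAlgebra p I') (φ f)) ^ M * h3 + h2
    | algebraMap a' =>
      refine ⟨0, fun m => ?_⟩
      obtain ⟨N, a, d, h1⟩ := h.exists_eq m a'
      refine ⟨N, algebraMap A _ a, a, d, by simp, ?_⟩
      have h2 := congrArg (algebraMap A' (PrismEnv.dilAlgebra p I')) h1
      simp only [map_mul, map_pow, map_add, map_natCast] at h2
      rw [hg]
      exact h2
    | add x y hx hy hx1 hy1 =>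
      obtain ⟨k, hk⟩ := hx1
      obtain ⟨l, hl⟩ := hy1
      refine ⟨k + l, fun m => ?_⟩
      obtain ⟨N, c, a, d, h1, h2⟩ := hk m
      obtain ⟨N', c', a', d', h1', h2'⟩ := hl m
      refine ⟨N + N', algebraMap A _ f ^ N' * c + algebraMap A _ f ^ N * c',
        p ^ l * (f ^ N' * a) + p ^ k * (f ^ N * a'), φ f ^ N' * d + φ f ^ N * d', ?_, ?_⟩
      · simp only [map_mul, map_pow, map_add, map_natCast]
        linear_combination p ^ l * algebraMap A _ f ^ N' * h1 + p ^ k * algebraMap A _ f ^ N * h1'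
      · have e : (⟨x + y, add_mem hx hy⟩ : PrismEnv.dilAlgebra p I') = ⟨x, hx⟩ + ⟨y, hy⟩ := rfl
        simp only [map_mul, map_pow, map_add, hg]
        refine (congrArg (_ * ·) e).trans ?_
        linear_combination algebraMap A' _ (φ f) ^ N' * h2 + algebraMap A' _ (φ f) ^ N * h2'
    | mul x y hx hy hx1 hy1 =>
      obtain ⟨k, hk⟩ := hx1
      obtain ⟨l, hl⟩ := hy1
      refine ⟨k + l, fun m => ?_⟩
      -- In the cross terms the errors are multiplied by `g c` and `g c'`, which lie in `A'` only
      -- after multiplication by `p ^ k` and `p ^ l`. The extra precision `k + l` pays for this.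
      obtain ⟨N, c, a, d, h1, h2⟩ := hk (m + k + l)
      obtain ⟨N', c', a', d', h1', h2'⟩ := hl (m + k + l)
      refine ⟨N + N', c * c', a * a', p ^ l * φ a * d' + p ^ k * φ a' * d + p ^ (m + 2 * k + 2 * l)
          * d * d',
        ?_, ?_⟩
      · simp only [map_mul]
        linear_combination p ^ l * c' * h1 + algebraMap A _ a * h1'
      · have e : (⟨x * y, mul_mem hx hy⟩ : PrismEnv.dilAlgebra p I') = ⟨x, hx⟩ * ⟨y, hy⟩ := rfl
        have h3 := congrArg g h1
        have h3' := congrArg g h1'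
        simp only [map_mul, map_pow, map_natCast, hg] at h3 h3'
        simp only [map_mul, map_pow, map_add, map_natCast]
        refine (congrArg (_ * ·) e).trans ?_
        rw [← h3, ← h3']
        calc _ = (algebraMap A' _ (φ f) ^ N * ⟨x, hx⟩) * (algebraMap A' _ (φ f) ^ N' * ⟨y, hy⟩) := by
              ring
          _ = _ := by rw [h2, h2']; ring
  refine ⟨fun m => ?_, fun m b' => ?_, fun m b hb => ?_⟩
  · obtain ⟨u, d, hu⟩ := h.exists_unit m
    refine ⟨algebraMap A' _ u, algebraMap A' _ d, ?_⟩
    rw [hg, ← map_mul, hu]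
    simp
  · obtain ⟨k, hk⟩ := key b'
    obtain ⟨N, c, a, d, -, h2⟩ := hk m
    exact ⟨N, c, algebraMap A' _ d, by rw [hg, h2]⟩
  · obtain ⟨b', hb'⟩ := hb
    obtain ⟨k, hk⟩ := key b'
    obtain ⟨N, c, a, d, h1, h2⟩ := hk 0
    obtain ⟨l, a1, hl⟩ := exists_pow_mul_mem b
    -- Clearing the denominators `p ^ l` of `b` and `p ^ k` of `c` leaves an identity in `A'`, to
    -- which the divisibility property of `φ` applies.
    have h3 : φ (p ^ k * (f ^ N * a1) - p ^ l * (p ^ m * a)) = p ^ (k + l + m) * d := by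
      apply hinj
      have h4 := congrArg g hl
      have h5 := congrArg g h1
      simp only [map_mul, map_pow, map_natCast, hg] at h4 h5
      simp only [map_mul, map_sub, map_pow, map_natCast]
      rw [pow_zero, one_mul] at h2
      linear_combination - p ^ k * algebraMap A' _ (φ f) ^ N * h4 + p ^ l * p ^ m * h5 +
        p ^ (k + l + m) * h2 + p ^ (k + l) * algebraMap A' _ (φ f) ^ N * hb'
    obtain ⟨M, e, he⟩ := h.exists_dvd (k + l + m) _ ⟨d, h3⟩
    refine ⟨N + M, algebraMap A _ f ^ M * c + algebraMap A _ e,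
      pow_mul_cancel_of_torsionFree htfB (k + l) ?_⟩
    have h6 := congrArg (algebraMap A (PrismEnv.dilAlgebra p I)) he
    simp only [map_mul, map_sub, map_pow, map_natCast] at h6
    linear_combination h6 + p ^ k * algebraMap A _ f ^ (N + M) * hl -
      p ^ l * p ^ m * algebraMap A _ f ^ M * h1

end Dilatation

end PrismEnv

/-! ### Localization modulo all powers of `p`, and sections over affine open subsets -/

namespace PrismEnv

/-- Modulo `p ^ n` the three conditions become the axioms of a localization: `f` is inverted, every
element is a fraction, and the kernel consists of `f`-power torsion. -/
theorem IsPLocalization.isLocalization {p n : ℕ} {A A' R R' : Type*} [CommRing A] [CommRing A']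
    [CommRing R] [CommRing R'] [Algebra R R'] {φ : A →+* A'} {f : A} (h : IsPLocalization p φ f)
    (ρ : A →+* R) (ρ' : A' →+* R') (hρ : Function.Surjective ρ) (hρ' : Function.Surjective ρ')
    (hk : ∀ a, (p : A) ^ n ∣ a → ρ a = 0) (hk' : ∀ a, ρ' a = 0 ↔ (p : A') ^ n ∣ a)
    (hc : ∀ a, algebraMap R R' (ρ a) = ρ' (φ a)) : IsLocalization.Away (ρ f) R' := by
  have hp : (p : R') ^ n = 0 := by
    simpa using (hk' ((p : A') ^ n)).2 dvd_rfl
  refine ⟨?_, fun z => ?_, fun {x y} hxy => ?_⟩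
  · rintro ⟨_, k, rfl⟩
    obtain ⟨u, d, hu⟩ := h.exists_unit n
    have h1 := congrArg ρ' hu
    simp only [map_mul, map_add, map_one, map_pow, map_natCast, hp, zero_mul, add_zero] at h1
    rw [map_pow, hc]
    exact (IsUnit.of_mul_eq_one _ h1).pow k
  · obtain ⟨a', rfl⟩ := hρ' z
    obtain ⟨N, a, d, hN⟩ := h.exists_eq n a'
    refine ⟨⟨ρ a, ⟨_, N, rfl⟩⟩, ?_⟩
    have h1 := congrArg ρ' hN
    simp only [map_mul, map_add, map_pow, map_natCast, hp, zero_mul, add_zero] at h1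
    change _ * algebraMap R R' (ρ f ^ N) = algebraMap R R' (ρ a)
    rw [map_pow, hc, hc, ← h1, mul_comm]
  · obtain ⟨a, rfl⟩ := hρ x
    obtain ⟨b, rfl⟩ := hρ y
    rw [hc, hc, ← sub_eq_zero, ← map_sub, hk', ← map_sub] at hxy
    obtain ⟨N, hN⟩ := h.exists_dvd n _ hxy
    refine ⟨⟨_, N, rfl⟩, ?_⟩
    have := hk _ hN
    rw [map_mul, map_sub, map_pow, mul_sub, sub_eq_zero] at this
    exact this

/-- The converse, which applies to the rings of sections of a formal scheme because each of its
reductions is a scheme. -/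
theorem isPLocalization_of_isLocalization {p : ℕ} {A A' : Type*} {R R' : ℕ → Type*} [CommRing A]
    [CommRing A'] [∀ n, CommRing (R n)] [∀ n, CommRing (R' n)] [∀ n, Algebra (R n) (R' n)]
    {φ : A →+* A'} {f : A} (ρ : ∀ n, A →+* R n) (ρ' : ∀ n, A' →+* R' n)
    (hρ : ∀ n, Function.Surjective (ρ n)) (hρ' : ∀ n, Function.Surjective (ρ' n))
    (hk : ∀ n a, ρ n a = 0 ↔ (p : A) ^ n ∣ a) (hk' : ∀ n a, ρ' n a = 0 ↔ (p : A') ^ n ∣ a)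
    (hc : ∀ n a, algebraMap (R n) (R' n) (ρ n a) = ρ' n (φ a))
    (h : ∀ n, IsLocalization.Away (ρ n f) (R' n)) : IsPLocalization p φ f := by
  have key (n : ℕ) (a b : A') (hab : ρ' n a = ρ' n b) : ∃ d, a = b + (p : A') ^ n * d := by
    rw [← sub_eq_zero, ← map_sub, hk'] at hab
    obtain ⟨d, hd⟩ := hab
    exact ⟨d, by rw [← hd]; ring⟩
  refine ⟨fun m => ?_, fun m a' => ?_, fun m a ha => ?_⟩
  · obtain ⟨u, hu⟩ := (isUnit_iff_exists_inv.1 (IsLocalization.Away.algebraMap_isUnit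
      (S := R' m) (ρ m f)))
    obtain ⟨u, rfl⟩ := hρ' m u
    obtain ⟨d, hd⟩ := key m (φ f * u) 1 (by rw [map_mul, ← hc, hu, map_one])
    exact ⟨u, d, hd⟩
  · obtain ⟨N, x, hx⟩ := IsLocalization.Away.surj (ρ m f) (ρ' m a')
    obtain ⟨a, rfl⟩ := hρ m x
    obtain ⟨d, hd⟩ := key m (φ f ^ N * a') (φ a) (by
      rw [map_mul, map_pow, ← hc, ← hc, ← hx, mul_comm])
    exact ⟨N, a, d, hd⟩
  · obtain ⟨⟨_, N, rfl⟩, hN⟩ := (IsLocalization.map_eq_zero_iff (Submonoid.powers (ρ m f)) (R' m)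
      (ρ m a)).1 (by rw [hc, (hk' m _).2 ha])
    refine ⟨N, (hk m _).1 ?_⟩
    rw [map_mul, map_pow]
    exact hN

namespace PadicFormalScheme

variable {p : ℕ} {Y T : PadicFormalScheme.{u} p}

/-- The open formal subscheme given by an affine open subset of the reduction modulo `p`. -/
noncomputable abbrev affineOpen (U : (Y.level 1).AffineZariskiSite) : Y.FormalOpen :=
  Y.ofOpen U.toOpens

theorem affineOpen_mono {U V : (Y.level 1).AffineZariskiSite} (h : U ≤ V) :
    (affineOpen U).trace 1 ≤ (affineOpen V).trace 1 :=
  Y.traceOf_mono (Scheme.AffineZariskiSite.toOpens_mono h) 1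

theorem isAffineOpen_affineOpen (U : (Y.level 1).AffineZariskiSite) :
    IsAffineOpen ((affineOpen U).trace 1) := by
  rw [affineOpen, ofOpen_trace, traceOf_one]
  exact U.2

/-- The formal open subset where a section is invertible. -/
theorem basicOpen_coe_eq {U V : Y.FormalOpen} (f : Y.sections V)
    (hf : (Y.level 1).basicOpen (f.1 1) = U.trace 1) :
    ∀ n, (Y.level n).basicOpen (f.1 n) = U.trace n
  | 0 => Y.opens_level_zero_eq _ _
  | 1 => hf
  | n + 2 => by
    have ih := basicOpen_coe_eq f hf (n + 1)
    have h1 : Y.incl (n + 1) ⁻¹ᵁ (Y.level (n + 2)).basicOpen (f.1 (n + 2)) =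
        (Y.level (n + 1)).basicOpen (f.1 (n + 1)) := by
      rw [Scheme.preimage_basicOpen, ← f.2 (n + 1)]
      refine Eq.trans ?_ (Scheme.basicOpen_res _ _ (homOfLE (V.preimage_trace (n + 1)).ge).op).symm
      refine (inf_eq_right.2 ?_).symm
      exact (Scheme.basicOpen_le _ _).trans (V.preimage_trace (n + 1)).le
    refine Y.opens_ext ?_
    have h2 (W : (Y.level (n + 2)).Opens) :
        Y.fromOne (n + 1) ⁻¹ᵁ W = Y.fromOne n ⁻¹ᵁ Y.incl (n + 1) ⁻¹ᵁ W := rfl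
    rw [h2, h2, h1, ih, U.preimage_trace]

theorem exists_section_basicOpen_eq [Fact p.Prime] {U V : (Y.level 1).AffineZariskiSite}
    (h : U ≤ V) : ∃ f : Y.sections (affineOpen V),
      (Y.level 1).basicOpen (f.1 1) = (affineOpen U).trace 1 := by
  obtain ⟨g, hg⟩ := h
  obtain ⟨f, hf⟩ := exists_section_coe_eq (isAffineOpen_affineOpen V) 1
    (res (Y.traceOf_one V.toOpens).le g)
  refine ⟨f, ?_⟩
  rw [hf]
  refine (Scheme.basicOpen_res _ _ (homOfLE (Y.traceOf_one V.toOpens).le).op).trans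
    (Eq.trans ?_ (Y.traceOf_one U.toOpens).symm)
  rw [hg]
  refine inf_eq_right.2 ?_
  refine le_trans ?_ (Y.traceOf_one _).ge
  rw [← hg]
  exact Scheme.basicOpen_le _ _

theorem coe_eq_zero_iff [Fact p.Prime] {U : Y.FormalOpen} (hU : IsAffineOpen (U.trace 1)) (n : ℕ)
    (s : Y.sections U) : s.1 n = 0 ↔ (p : Y.sections U) ^ n ∣ s := by
  refine ⟨fun h => exists_eq_pow_mul hU h, ?_⟩
  rintro ⟨r, rfl⟩
  have : ((p : Y.sections U) ^ n * r).1 n = (p : Γ(Y.level n, U.trace n)) ^ n * r.1 n := by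
    simp
  rw [this, pow_eq_zero_trace, zero_mul]

/-- Evaluation of sections in a reduction. -/
def evalSec (U : Y.FormalOpen) (n : ℕ) : Y.sections U →+* Γ(Y.level n, U.trace n) :=
  (Pi.evalRingHom _ n).comp (Y.sections U).subtype

theorem isLocalization_away_trace [Fact p.Prime] {U V : Y.FormalOpen}
    (hV : IsAffineOpen (V.trace 1)) (hle : U.trace 1 ≤ V.trace 1) (f : Y.sections V)
    (hf : (Y.level 1).basicOpen (f.1 1) = U.trace 1) (n : ℕ) :
    let := (res (FormalOpen.trace_le hle n)).toAlgebra
    IsLocalization.Away (f.1 n) Γ(Y.level n, U.trace n) :=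
  (V.isAffineOpen_trace hV n).isLocalization_of_eq_basicOpen (f.1 n)
    (homOfLE (FormalOpen.trace_le hle n)) (basicOpen_coe_eq f hf n).symm

theorem isPLocalization_resSec [Fact p.Prime] {U V : Y.FormalOpen} (hU : IsAffineOpen (U.trace 1))
    (hV : IsAffineOpen (V.trace 1)) (hle : U.trace 1 ≤ V.trace 1) (f : Y.sections V)
    (hf : (Y.level 1).basicOpen (f.1 1) = U.trace 1) : IsPLocalization p (resSec hle) f := by
  let (n : ℕ) := (res (FormalOpen.trace_le hle n)).toAlgebra
  exact isPLocalization_of_isLocalization (R := fun n => Γ(Y.level n, V.trace n))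
    (R' := fun n => Γ(Y.level n, U.trace n)) (evalSec V) (evalSec U)
    (exists_section_coe_eq hV) (exists_section_coe_eq hU) (coe_eq_zero_iff hV) (coe_eq_zero_iff hU)
    (fun n a => (resSec_coe hle a n).symm) (isLocalization_away_trace hV hle f hf)

end PadicFormalScheme

end PrismEnv

/-! ### Quasi-coherent algebras on a formal scheme and their reductions -/

namespace PrismEnv

namespace PadicFormalScheme

variable {p : ℕ} [Fact p.Prime]

/-- A family of `p`-torsion free algebras over the sections over affine open subsets of a formal
scheme which is quasi-coherent modulo the powers of `p`. -/
structure QCohAlgebra (Y : PadicFormalScheme.{u} p) where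
  ring : (Y.level 1).AffineZariskiSiteᵒᵖ ⥤ CommRingCat.{u}
  unit : ∀ U : (Y.level 1).AffineZariskiSite, Y.sections (affineOpen U) →+* ring.obj (op U)
  map_unit : ∀ {U V : (Y.level 1).AffineZariskiSite} (h : U ≤ V) (s : Y.sections (affineOpen V)),
    (ring.map (homOfLE h).op).hom (unit V s) = unit U (resSec (affineOpen_mono h) s)
  torsionFree : ∀ (U : (Y.level 1).AffineZariskiSite) (b : ring.obj (op U)), p * b = 0 → b = 0
  isPLocalization : ∀ {U V : (Y.level 1).AffineZariskiSite} (h : U ≤ V)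
    (f : Y.sections (affineOpen V)), (Y.level 1).basicOpen (f.1 1) = (affineOpen U).trace 1 →
      IsPLocalization p (ring.map (homOfLE h).op).hom (unit V f)

namespace QCohAlgebra

variable {Y : PadicFormalScheme.{u} p} (B : Y.QCohAlgebra)

/-- The reduction modulo `p ^ n` of a quasi-coherent algebra. -/
noncomputable def quot (n : ℕ) : (Y.level 1).AffineZariskiSiteᵒᵖ ⥤ CommRingCat.{u} where
  obj U := CommRingCat.of (B.ring.obj U ⧸ Ideal.span {(p : B.ring.obj U) ^ n})
  map {U V} f := CommRingCat.ofHom (Ideal.quotientMap _ (B.ring.map f).hom (by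
    rw [Ideal.span_singleton_le_iff_mem, Ideal.mem_comap, map_pow, map_natCast]
    exact Ideal.mem_span_singleton_self _))
  map_id U := by
    ext x
    simp
  map_comp f g := by
    ext x
    simp

/-- The projection to the reduction modulo `p ^ n`. -/
noncomputable def proj (n : ℕ) (U : (Y.level 1).AffineZariskiSite) :
    B.ring.obj (op U) →+* (B.quot n).obj (op U) :=
  Ideal.Quotient.mk (Ideal.span {(p : B.ring.obj (op U)) ^ n})

theorem proj_surjective (n : ℕ) (U : (Y.level 1).AffineZariskiSite) :
    Function.Surjective (B.proj n U) := Ideal.Quotient.mk_surjective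

theorem proj_eq_zero_iff {n : ℕ} {U : (Y.level 1).AffineZariskiSite} {b : B.ring.obj (op U)} :
    B.proj n U b = 0 ↔ (p : B.ring.obj (op U)) ^ n ∣ b :=
  Ideal.Quotient.eq_zero_iff_mem.trans Ideal.mem_span_singleton

theorem quot_map_proj (n : ℕ) {U V : (Y.level 1).AffineZariskiSite} (h : U ≤ V)
    (b : B.ring.obj (op V)) : ((B.quot n).map (homOfLE h).op).hom (B.proj n V b) =
      B.proj n U ((B.ring.map (homOfLE h).op).hom b) := rfl

/-- The structure map of the reduction modulo `p ^ n` of a quasi-coherent algebra. -/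
theorem exists_algebraMap (n : ℕ) (U : (Y.level 1).AffineZariskiSite) :
    ∃ α : Γ(Y.level n, (affineOpen U).trace n) ⟶ (B.quot n).obj (op U),
      ∀ s : Y.sections (affineOpen U), α.hom (s.1 n) = B.proj n U (B.unit U s) := by
  have hs := exists_section_coe_eq (isAffineOpen_affineOpen U) n
  let l : Γ(Y.level n, (affineOpen U).trace n) →+* (B.quot n).obj (op U) :=
    (evalSec (affineOpen U) n).liftOfSurjective hs ⟨(B.proj n U).comp (B.unit U), fun s hs' => by
      obtain ⟨r, rfl⟩ := (coe_eq_zero_iff (isAffineOpen_affineOpen U) n s).1 hs'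
      refine (proj_eq_zero_iff B).2 ?_
      rw [map_mul, map_pow, map_natCast]
      exact dvd_mul_right _ _⟩
  exact ⟨CommRingCat.ofHom l, fun s => RingHom.liftOfRightInverse_comp_apply _ _ _ _ s⟩

/-- The structure map of the reduction modulo `p ^ n` of a quasi-coherent algebra. -/
noncomputable def algMap (n : ℕ) (U : (Y.level 1).AffineZariskiSite) :
    Γ(Y.level n, (affineOpen U).trace n) ⟶ (B.quot n).obj (op U) :=
  (B.exists_algebraMap n U).choose

theorem algMap_coe (n : ℕ) (U : (Y.level 1).AffineZariskiSite) (s : Y.sections (affineOpen U)) :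
    (B.algMap n U).hom (s.1 n) = B.proj n U (B.unit U s) :=
  (B.exists_algebraMap n U).choose_spec s

/-- Modulo `p ^ n` both vertical maps are localizations at the same section `f`, and localization is
a base change. These squares are the gluing condition for the relative spectrum. -/
theorem isPushout_algMap (n : ℕ) {U V : (Y.level 1).AffineZariskiSite} (h : U ≤ V) :
    IsPushout ((Y.level n).presheaf.map
        (homOfLE (FormalOpen.trace_le (affineOpen_mono h) n)).op)
      (B.algMap n V) (B.algMap n U) ((B.quot n).map (homOfLE h).op) := by
  obtain ⟨f, hf⟩ := exists_section_basicOpen_eq h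
  let a1 := (res (FormalOpen.trace_le (affineOpen_mono h) n)).toAlgebra
  let a2 := ((B.quot n).map (homOfLE h).op).hom.toAlgebra
  have h3 : IsLocalization.Away (f.1 n) Γ(Y.level n, (affineOpen U).trace n) :=
    isLocalization_away_trace (isAffineOpen_affineOpen V) (affineOpen_mono h) f hf n
  have h4 : IsLocalization.Away ((B.algMap n V).hom (f.1 n)) ((B.quot n).obj (op U)) := by
    rw [algMap_coe]
    exact (B.isPLocalization h f hf).isLocalization (n := n) (B.proj n V) (B.proj n U)
      (B.proj_surjective n V) (B.proj_surjective n U) (fun a => B.proj_eq_zero_iff.2)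
      (fun a => B.proj_eq_zero_iff) (fun a => rfl)
  have h5 : IsLocalization ((Submonoid.powers (f.1 n)).map (B.algMap n V).hom)
      ((B.quot n).obj (op U)) := by
    rw [Submonoid.map_powers]
    exact h4
  refine (CommRingCat.isPushout_of_isLocalization (B.algMap n V).hom (B.algMap n U).hom ?_
    (Submonoid.powers (f.1 n))).flip
  refine RingHom.ext fun x => ?_
  obtain ⟨s, rfl⟩ := exists_section_coe_eq (isAffineOpen_affineOpen V) n x
  have h6 := B.algMap_coe n V s
  have h7 := B.algMap_coe n U (resSec (affineOpen_mono h) s)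
  rw [resSec_coe, ← B.map_unit h, ← quot_map_proj, ← h6] at h7
  exact h7

end QCohAlgebra

end PadicFormalScheme

end PrismEnv

/-! ### The formal spectrum of a quasi-coherent algebra -/

namespace PrismEnv

namespace PadicFormalScheme

namespace QCohAlgebra

variable {p : ℕ} [Fact p.Prime] {Y : PadicFormalScheme.{u} p} (B : Y.QCohAlgebra)

/-- The reduction modulo `p ^ n` of the formal spectrum of a quasi-coherent algebra. -/
theorem exists_level (n : ℕ) : ∃ (Q : Scheme.{u}) (q : Q ⟶ Y.level n)
    (ev : ∀ U : (Y.level 1).AffineZariskiSite,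
      B.ring.obj (op U) →+* Γ(Q, q ⁻¹ᵁ (affineOpen U).trace n)),
    IsAffineHom q ∧
    (∀ U s, ev U (B.unit U s) = (q.app ((affineOpen U).trace n)).hom (s.1 n)) ∧
    (∀ {U V} (h : U ≤ V) b, ev U ((B.ring.map (homOfLE h).op).hom b) =
      res (q.preimage_mono (FormalOpen.trace_le (affineOpen_mono h) n)) (ev V b)) ∧
    (∀ U, Function.Surjective (ev U)) ∧
    ∀ U b, ev U b = 0 ↔ (p : B.ring.obj (op U)) ^ n ∣ b := by
  obtain ⟨Q, q, e, hq, h1, h2⟩ := exists_relSpec (Y.traceCover (zariskiCover (Y.level 1)) n)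
    (fun U => (affineOpen U).isAffineOpen_trace (isAffineOpen_affineOpen U) n) (B.quot n)
    (B.algMap n) (fun {U V} h => B.isPushout_algMap n h)
  let ev (U : (Y.level 1).AffineZariskiSite) :
      B.ring.obj (op U) →+* Γ(Q, q ⁻¹ᵁ (affineOpen U).trace n) := (e U).inv.hom.comp (B.proj n U)
  have hinv (U) (x : Γ(Q, q ⁻¹ᵁ (affineOpen U).trace n)) : (e U).inv.hom ((e U).hom.hom x) = x :=
    (e U).hom_inv_id_apply x
  have hhom (U) (x) : (e U).hom.hom ((e U).inv.hom x) = x := (e U).inv_hom_id_apply x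
  have hhe (U) (b : B.ring.obj (op U)) : (e U).hom.hom (ev U b) = B.proj n U b := hhom U _
  have hinj (U) {x y : Γ(Q, q ⁻¹ᵁ (affineOpen U).trace n)}
      (hxy : (e U).hom.hom x = (e U).hom.hom y) : x = y := by
    have := congrArg (e U).inv.hom hxy
    rwa [hinv, hinv] at this
  refine ⟨Q, q, ev, hq, fun U s => hinj U ?_, fun {U V} h b => hinj U ?_, fun U x => ?_,
    fun U b => ?_⟩
  · refine (hhe U _).trans ((B.algMap_coe n U s).symm.trans ?_)
    exact (congrArg (fun f : Γ(Y.level n, (affineOpen U).trace n) ⟶ (B.quot n).obj (op U) =>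
      f.hom (s.1 n)) (h1 U)).symm
  · refine (hhe U _).trans ((B.quot_map_proj n h b).symm.trans ?_)
    rw [← hhe]
    exact (congrArg (fun f : Γ(Q, q ⁻¹ᵁ (affineOpen V).trace n) ⟶ (B.quot n).obj (op U) =>
      f.hom (ev V b)) (h2 h)).symm
  · obtain ⟨b, hb⟩ := B.proj_surjective n U ((e U).hom.hom x)
    exact ⟨b, hinj U ((hhe U b).trans hb)⟩
  · rw [← B.proj_eq_zero_iff, ← hhe]
    have h0 : (e U).hom.hom (0 : Γ(Q, q ⁻¹ᵁ (affineOpen U).trace n)) = 0 := map_zero (e U).hom.hom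
    exact ⟨fun h => (congrArg (e U).hom.hom h).trans h0, fun h => hinj U (h.trans h0.symm)⟩

end QCohAlgebra

/-- Affine morphisms which are surjective on sections over an affine cover are closed
immersions. -/
theorem isClosedImmersion_of_surjective {X Z : Scheme.{u}} (f : X ⟶ Z) [IsAffineHom f] {ι : Type u}
    (V : ι → Z.Opens) (hV : ∀ i, IsAffineOpen (V i)) (hcov : ⨆ i, V i = ⊤)
    (H : ∀ i, Function.Surjective (f.app (V i))) : IsClosedImmersion f := by
  refine (@HasAffineProperty.iff_of_iSup_eq_top _ _ IsClosedImmersion.hasAffineProperty _ _ f _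
    (fun i => ⟨V i, hV i⟩) hcov).2 fun i => ?_
  refine ⟨(hV i).preimage f, ?_⟩
  have h1 (W : Z.Opens) (hW : W = V i) : Function.Surjective (f.app W) := by
    subst hW
    exact H i
  change Function.Surjective (f ∣_ V i).appTop
  rw [morphismRestrict_appTop]
  have h2 := ConcreteCategory.bijective_of_isIso
    (X.presheaf.map (eqToHom (image_morphismRestrict_preimage f (V i) ⊤)).op)
  exact h2.2.comp (h1 _ (V i).ι_image_top)

end PadicFormalScheme

end PrismEnv

namespace PrismEnv

namespace PadicFormalScheme

namespace QCohAlgebra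

variable {p : ℕ} [Fact p.Prime] {Y : PadicFormalScheme.{u} p} (B : Y.QCohAlgebra)

/-- The morphism is glued from the projections of the rings modulo `p ^ (n + 1)` to those modulo `p
^ n`. -/
theorem exists_transition {n : ℕ} {Q Q' : Scheme.{u}} {q : Q ⟶ Y.level n}
    {q' : Q' ⟶ Y.level (n + 1)} [IsAffineHom q']
    {ev : ∀ U : (Y.level 1).AffineZariskiSite,
      B.ring.obj (op U) →+* Γ(Q, q ⁻¹ᵁ (affineOpen U).trace n)}
    {ev' : ∀ U : (Y.level 1).AffineZariskiSite,
      B.ring.obj (op U) →+* Γ(Q', q' ⁻¹ᵁ (affineOpen U).trace (n + 1))}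
    (h1 : ∀ U s, ev U (B.unit U s) = (q.app ((affineOpen U).trace n)).hom (s.1 n))
    (h1' : ∀ U s, ev' U (B.unit U s) = (q'.app ((affineOpen U).trace (n + 1))).hom (s.1 (n + 1)))
    (h2 : ∀ {U V} (h : U ≤ V) b, ev U ((B.ring.map (homOfLE h).op).hom b) =
      res (q.preimage_mono (FormalOpen.trace_le (affineOpen_mono h) n)) (ev V b))
    (h2' : ∀ {U V} (h : U ≤ V) b, ev' U ((B.ring.map (homOfLE h).op).hom b) =
      res (q'.preimage_mono (FormalOpen.trace_le (affineOpen_mono h) (n + 1))) (ev' V b))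
    (h3' : ∀ U, Function.Surjective (ev' U))
    (h4 : ∀ U b, ev U b = 0 ↔ (p : B.ring.obj (op U)) ^ n ∣ b)
    (h4' : ∀ U b, ev' U b = 0 ↔ (p : B.ring.obj (op U)) ^ (n + 1) ∣ b) :
    ∃ g : Q ⟶ Q', g ≫ q' = q ≫ Y.incl n ∧ ∀ U,
      ∃ e : q ⁻¹ᵁ (affineOpen U).trace n ≤ g ⁻¹ᵁ q' ⁻¹ᵁ (affineOpen U).trace (n + 1),
      ∀ b, (g.appLE _ _ e).hom (ev' U b) = ev U b := by
  have hβ (U : (Y.level 1).AffineZariskiSite) :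
      ∃ β : Γ(Q', q' ⁻¹ᵁ (affineOpen U).trace (n + 1)) ⟶ Γ(Q, q ⁻¹ᵁ (affineOpen U).trace n),
      ∀ b, β.hom (ev' U b) = ev U b := by
    let l := (ev' U).liftOfSurjective (h3' U) ⟨ev U, fun b hb => (h4 U b).2
      ((pow_dvd_pow _ n.le_succ).trans ((h4' U b).1 hb))⟩
    exact ⟨CommRingCat.ofHom l, fun s => RingHom.liftOfRightInverse_comp_apply _ _ _ _ s⟩
  choose β hβ using hβ
  obtain ⟨g, hg⟩ := exists_hom_of_appLE
    ((Y.traceCover (zariskiCover (Y.level 1)) n).comap q)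
    (fun U => q' ⁻¹ᵁ (affineOpen U).trace (n + 1))
    (fun h => q'.preimage_mono (FormalOpen.trace_le (affineOpen_mono h) (n + 1)))
    (fun U => ((affineOpen U).isAffineOpen_trace (isAffineOpen_affineOpen U) (n + 1)).preimage q')
    β (fun U V h => by
      ext x
      obtain ⟨b, rfl⟩ := h3' V x
      have h5 := congrArg (β U).hom (h2' h b)
      rw [hβ, h2] at h5
      rw [← hβ V] at h5
      exact h5.symm)
  choose e he using hg
  have hgb (U) (b) : (g.appLE _ _ (e U)).hom (ev' U b) = ev U b :=
    (congrArg (fun f : Γ(Q', q' ⁻¹ᵁ (affineOpen U).trace (n + 1)) ⟶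
      Γ(Q, q ⁻¹ᵁ (affineOpen U).trace n) => f.hom (ev' U b)) (he U)).trans (hβ U b)
  refine ⟨g, ?_, fun U => ⟨e U, hgb U⟩⟩
  have e2 (U : (Y.level 1).AffineZariskiSite) : q ⁻¹ᵁ (affineOpen U).trace n ≤
      (q ≫ Y.incl n) ⁻¹ᵁ (affineOpen U).trace (n + 1) := by
    rw [Scheme.Hom.comp_preimage, (affineOpen U).preimage_trace]
  refine hom_ext_of_appLE _ _ (fun U => q ⁻¹ᵁ (affineOpen U).trace n)
    ((Y.traceCover (zariskiCover (Y.level 1)) n).comap q).iSup_eq_top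
    (fun U => (affineOpen U).trace (n + 1))
    (fun U => (affineOpen U).isAffineOpen_trace (isAffineOpen_affineOpen U) (n + 1))
    (fun U => e U) e2 fun U => ?_
  ext x
  obtain ⟨s, rfl⟩ := exists_section_coe_eq (isAffineOpen_affineOpen U) (n + 1) x
  have h5 : (g ≫ q').appLE ((affineOpen U).trace (n + 1)) (q ⁻¹ᵁ (affineOpen U).trace n) (e U) =
    q'.app _ ≫ g.appLE _ _ (e U) := Scheme.Hom.comp_appLE _ _ _ _ _
  have h6 : (q ≫ Y.incl n).appLE ((affineOpen U).trace (n + 1)) (q ⁻¹ᵁ (affineOpen U).trace n)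
      (e2 U) = (Y.incl n).appLE _ _ ((affineOpen U).preimage_trace n).ge ≫ q.app _ := by
    rw [q.app_eq_appLE, Scheme.Hom.appLE_comp_appLE]
  rw [h5, h6]
  have h7 := hgb U (B.unit U s)
  rw [h1, h1'] at h7
  refine h7.trans (congrArg (q.app _).hom ?_)
  exact (s.2 n).symm

/-- The characterization of the formal spectrum of a quasi-coherent algebra by its rings of
sections. -/
structure IsFormalSpec {Q : PadicFormalScheme.{u} p} (q : Q ⟶ Y)
    (e : ∀ U : (Y.level 1).AffineZariskiSite,
      B.ring.obj (op U) →+* Q.sections ((affineOpen U).comap q)) : Prop where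
  isAffineMorphism : IsAffineMorphism q
  unit : ∀ U s, e U (B.unit U s) = sectionsMap q (affineOpen U) ((affineOpen U).comap q)
    (fun _ => le_rfl) s
  map : ∀ {U V} (h : U ≤ V) b, e U ((B.ring.map (homOfLE h).op).hom b) =
    resSec ((q.app 1).preimage_mono (affineOpen_mono h)) (e V b)
  exists_eq : ∀ U n x, ∃ b, (e U b).1 n = x
  eq_zero_iff : ∀ U n b, (e U b).1 n = 0 ↔ (p : B.ring.obj (op U)) ^ n ∣ b

theorem exists_formalSpec : ∃ (Q : PadicFormalScheme.{u} p) (q : Q ⟶ Y)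
    (e : ∀ U : (Y.level 1).AffineZariskiSite,
      B.ring.obj (op U) →+* Q.sections ((affineOpen U).comap q)),
    Q.IsPTorsionFree ∧ B.IsFormalSpec q e := by
  choose Q q ev hq h1 h2 h3 h4 using B.exists_level
  have ht (n : ℕ) := B.exists_transition (h1 n) (h1 (n + 1)) (h2 n) (h2 (n + 1)) (h3 (n + 1))
    (h4 n) (h4 (n + 1))
  choose i hi e he using ht
  have hpre (n : ℕ) (U : (Y.level 1).AffineZariskiSite) :
      i n ⁻¹ᵁ q (n + 1) ⁻¹ᵁ (affineOpen U).trace (n + 1) = q n ⁻¹ᵁ (affineOpen U).trace n := by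
    rw [← Scheme.Hom.comp_preimage, hi, Scheme.Hom.comp_preimage, (affineOpen U).preimage_trace]
  have hiapp (n : ℕ) (U) (b) :
      ((i n).app (q (n + 1) ⁻¹ᵁ (affineOpen U).trace (n + 1))).hom (ev (n + 1) U b) =
        res (hpre n U).le (ev n U b) := by
    rw [← he n U b, appLE_eq_res_app, res_res, res_self]
  have hresb (n : ℕ) (U) : Function.Bijective (res (hpre n U).le) := by
    have h5 (V V' : (Q n).Opens) (hV : V = V') : Function.Bijective (res hV.le) := by
      subst hV
      exact ⟨fun x y hxy => by rwa [res_self, res_self] at hxy, fun x => ⟨x, res_self _ x⟩⟩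
    exact h5 _ _ (hpre n U)
  have haff (n : ℕ) : IsAffineHom (i n) := by
    have : IsAffineHom (i n ≫ q (n + 1)) := by rw [hi]; infer_instance
    exact IsAffineHom.of_comp _ (q (n + 1))
  have hVaff (n : ℕ) (U) : IsAffineOpen (q n ⁻¹ᵁ (affineOpen U).trace n) :=
    ((affineOpen U).isAffineOpen_trace (isAffineOpen_affineOpen U) n).preimage (q n)
  have hVcov (n : ℕ) : ⨆ U, q n ⁻¹ᵁ (affineOpen U).trace n = ⊤ :=
    ((Y.traceCover (zariskiCover (Y.level 1)) n).comap (q n)).iSup_eq_top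
  have hcl (n : ℕ) : IsClosedImmersion (i n) := by
    refine isClosedImmersion_of_surjective (i n) _ (hVaff (n + 1)) (hVcov (n + 1)) fun U x => ?_
    obtain ⟨y, rfl⟩ := (hresb n U).2 x
    obtain ⟨b, rfl⟩ := h3 n U y
    exact ⟨_, hiapp n U b⟩
  have hker0 (n : ℕ) (U) (b) : ((i n).app (q (n + 1) ⁻¹ᵁ (affineOpen U).trace (n + 1))).hom
      (ev (n + 1) U b) = 0 ↔ (p : B.ring.obj (op U)) ^ n ∣ b := by
    rw [hiapp, ← h4 n U b]
    exact map_eq_zero_iff _ (hresb n U).1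
  -- Locally this is the fact that the kernel of the projection from the quotient by `p ^ (n + 1)`
  -- to the quotient by `p ^ n` is generated by `p ^ n`.
  have hker (n : ℕ) : (i n).ker = powIdeal p n (Q (n + 1)) := by
    refine Scheme.IdealSheafData.ext_of_iSup_eq_top (fun U => ⟨_, hVaff (n + 1) U⟩) (hVcov (n + 1))
      fun U => ?_
    rw [Scheme.Hom.ker_apply, powIdeal_ideal]
    ext x
    obtain ⟨b, rfl⟩ := h3 (n + 1) U x
    rw [RingHom.mem_ker, Ideal.mem_span_singleton]
    refine (hker0 n U b).trans ⟨?_, ?_⟩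
    · rintro ⟨c, rfl⟩
      rw [map_mul, map_pow, map_natCast]
      exact dvd_mul_right _ _
    · rintro ⟨y, hy⟩
      obtain ⟨c, rfl⟩ := h3 (n + 1) U y
      have h6 : ev (n + 1) U (b - p ^ n * c) = 0 := by
        rw [map_sub, hy, map_mul, map_pow, map_natCast, sub_self]
      have h7 := (pow_dvd_pow _ n.le_succ).trans ((h4 (n + 1) U _).1 h6)
      exact (dvd_sub_left (dvd_mul_right _ _)).1 h7
  let QQ : PadicFormalScheme.{u} p :=
    { level := Q
      incl := i
      isClosedImmersion_incl := hcl
      pow_eq_zero := fun n => natCast_pow_eq_zero_of_hom (q n) (Y.pow_eq_zero n)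
      ker_incl := fun n => (ker_eq_powIdeal_iff _).1 (hker n) }
  let qq : QQ ⟶ Y := { app := q, comm := hi }
  let ee (U : (Y.level 1).AffineZariskiSite) :
      B.ring.obj (op U) →+* QQ.sections ((affineOpen U).comap qq) :=
    { toFun := fun b => ⟨fun n => ev n U b, fun n => he n U b⟩
      map_one' := Subtype.ext (funext fun n => map_one (ev n U))
      map_zero' := Subtype.ext (funext fun n => map_zero (ev n U))
      map_add' := fun a b => Subtype.ext (funext fun n => map_add (ev n U) a b)
      map_mul' := fun a b => Subtype.ext (funext fun n => map_mul (ev n U) a b) }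
  refine ⟨QQ, qq, ee, ?_, ⟨hq, fun U s => Subtype.ext (funext fun n => ?_),
    fun {U V} h b => Subtype.ext (funext fun n => ?_),
    fun U n x => h3 n U x, fun U n b => h4 n U b⟩⟩
  · refine isPTorsionFree_of_iSup_eq_top (fun n U => q (n + 1) ⁻¹ᵁ (affineOpen U).trace (n + 1))
      (fun n => hVaff (n + 1)) (fun n => hVcov (n + 1)) fun n U x hx => ?_
    obtain ⟨b, rfl⟩ := h3 (n + 1) U x
    -- If `p * b` is divisible by `p ^ (n + 1)`, then `b` is divisible by `p ^ n`, since the algebra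
    -- is `p`-torsion free.
    refine (hker0 n U b).2 ?_
    rw [← map_natCast (ev (n + 1) U), ← map_mul, h4] at hx
    obtain ⟨c, hc⟩ := hx
    refine ⟨c, ?_⟩
    rw [← sub_eq_zero]
    refine B.torsionFree U _ ?_
    rw [mul_sub, hc]
    ring
  · exact (h1 n U s).trans (congrArg (fun f : Γ(Y.level n, (affineOpen U).trace n) ⟶
      Γ(Q n, q n ⁻¹ᵁ (affineOpen U).trace n) => f.hom (s.1 n)) (q n).app_eq_appLE)
  · exact (h2 n h b).trans (resSec_coe (Y := QQ) (U := (affineOpen V).comap qq)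
      (W := (affineOpen U).comap qq) ((q 1).preimage_mono (affineOpen_mono h)) (ee V b) n).symm

end QCohAlgebra

end PadicFormalScheme

end PrismEnv

/-! ### Mapping properties of formal spectra -/

namespace PrismEnv

namespace PadicFormalScheme

variable {p : ℕ} {Y Q T : PadicFormalScheme.{u} p}

theorem iSup_preimage_affineOpen (π : T ⟶ Y) (n : ℕ) :
    ⨆ U : (Y.level 1).AffineZariskiSite, π.app n ⁻¹ᵁ (affineOpen U).trace n = ⊤ :=
  ((Y.traceCover (zariskiCover (Y.level 1)) n).comap (π.app n)).iSup_eq_top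

theorem isAffineOpen_preimage_affineOpen [Fact p.Prime] {q : Q ⟶ Y} (hq : IsAffineMorphism q)
    (U : (Y.level 1).AffineZariskiSite) (n : ℕ) :
    IsAffineOpen (q.app n ⁻¹ᵁ (affineOpen U).trace n) :=
  have := hq n
  ((affineOpen U).isAffineOpen_trace (isAffineOpen_affineOpen U) n).preimage (q.app n)

theorem app_preimage_comap {q : Q ⟶ Y} {π : T ⟶ Y} {h : T ⟶ Q} (hh : h ≫ q = π)
    (U : Y.FormalOpen) (n : ℕ) :
    (U.comap π).trace n ≤ h.app n ⁻¹ᵁ (U.comap q).trace n := by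
  subst hh
  exact le_rfl

/-- Morphisms to a formal scheme `Q` affine over `Y` agree if they agree on sections over the
preimages of affine open subsets of `Y`. -/
theorem hom_ext_of_sectionsMap [Fact p.Prime] {q : Q ⟶ Y} (hq : IsAffineMorphism q)
    {π : T ⟶ Y} {h h' : T ⟶ Q}
    (hh : h ≫ q = π) (hh' : h' ≫ q = π)
    (H : ∀ (U : (Y.level 1).AffineZariskiSite) (s : Q.sections ((affineOpen U).comap q)),
      sectionsMap h _ ((affineOpen U).comap π) (app_preimage_comap hh _) s =
        sectionsMap h' _ ((affineOpen U).comap π) (app_preimage_comap hh' _) s) : h = h' := by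
  refine Hom.ext (funext fun n => ?_)
  refine hom_ext_of_appLE _ _ (fun U => ((affineOpen U).comap π).trace n)
    (iSup_preimage_affineOpen π n) (fun U => ((affineOpen U).comap q).trace n)
    (fun U => isAffineOpen_preimage_affineOpen hq U n)
    (fun U => app_preimage_comap hh _ n) (fun U => app_preimage_comap hh' _ n) fun U => ?_
  ext x
  obtain ⟨s, rfl⟩ := exists_section_coe_eq (U := (affineOpen U).comap q)
    (isAffineOpen_preimage_affineOpen hq U 1) n x
  exact congrFun (congrArg Subtype.val (H U s)) n

namespace QCohAlgebra.IsFormalSpec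

variable [Fact p.Prime] {B : Y.QCohAlgebra} {q : Q ⟶ Y} {e : ∀ U : (Y.level 1).AffineZariskiSite,
      B.ring.obj (op U) →+* Q.sections ((affineOpen U).comap q)}

/-- Morphisms to a formal spectrum are given by morphisms of algebras. -/
theorem exists_hom (hQ : B.IsFormalSpec q e) (π : T ⟶ Y)
    (g : ∀ U : (Y.level 1).AffineZariskiSite,
      B.ring.obj (op U) →+* T.sections ((affineOpen U).comap π))
    (hg : ∀ U s, g U (B.unit U s) =
      sectionsMap π (affineOpen U) ((affineOpen U).comap π) (fun _ => le_rfl) s)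
    (hgm : ∀ {U V} (h : U ≤ V) b, g U ((B.ring.map (homOfLE h).op).hom b) =
      resSec ((π.app 1).preimage_mono (affineOpen_mono h)) (g V b)) :
    ∃ h : T ⟶ Q, h ≫ q = π := by
  have hl (n : ℕ) : ∃ h : T.level n ⟶ Q.level n, ∀ U : (Y.level 1).AffineZariskiSite,
      ∃ e' : ((affineOpen U).comap π).trace n ≤ h ⁻¹ᵁ ((affineOpen U).comap q).trace n,
      ∀ b, (h.appLE _ _ e').hom ((e U b).1 n) = (g U b).1 n := by
    have hβ (U : (Y.level 1).AffineZariskiSite) :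
        ∃ β : Γ(Q.level n, ((affineOpen U).comap q).trace n) ⟶
          Γ(T.level n, ((affineOpen U).comap π).trace n),
        ∀ b, β.hom ((e U b).1 n) = (g U b).1 n := by
      let l := ((evalSec ((affineOpen U).comap q) n).comp (e U)).liftOfSurjective
        (fun x => hQ.exists_eq U n x) ⟨(evalSec ((affineOpen U).comap π) n).comp (g U), fun b hb => by
          obtain ⟨c, rfl⟩ := (hQ.eq_zero_iff U n b).1 hb
          change (g U (p ^ n * c)).1 n = 0
          have h1 : (g U (p ^ n * c)).1 n =
              (p : Γ(T.level n, ((affineOpen U).comap π).trace n)) ^ n * (g U c).1 n := by simp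
          rw [h1, pow_eq_zero_trace, zero_mul]⟩
      exact ⟨CommRingCat.ofHom l, fun s => RingHom.liftOfRightInverse_comp_apply _ _ _ _ s⟩
    choose β hβ using hβ
    obtain ⟨h, hh⟩ := exists_hom_of_appLE
      ((Y.traceCover (zariskiCover (Y.level 1)) n).comap (π.app n))
      (fun U => ((affineOpen U).comap q).trace n)
      (fun h => (q.app n).preimage_mono (FormalOpen.trace_le (affineOpen_mono h) n))
      (fun U => isAffineOpen_preimage_affineOpen hQ.isAffineMorphism U n) β (fun U V h => by
        ext x
        obtain ⟨b, rfl⟩ := hQ.exists_eq V n x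
        have h5 := congrArg (fun s => (β U).hom (s.1 n)) (hQ.map h b)
        have h6 := congrFun (congrArg Subtype.val (hgm h b)) n
        refine Eq.trans ?_ (h5.symm.trans ((hβ U _).trans (h6.trans ?_)))
        · exact congrArg (β U).hom (resSec_coe _ _ n).symm
        · refine (resSec_coe _ _ n).trans ?_
          rw [← hβ V]
          rfl)
    choose e' he' using hh
    refine ⟨h, fun U => ⟨e' U, fun b => ?_⟩⟩
    exact (congrArg (fun f : Γ(Q.level n, ((affineOpen U).comap q).trace n) ⟶
      Γ(T.level n, ((affineOpen U).comap π).trace n) => f.hom ((e U b).1 n)) (he' U)).trans (hβ U b)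
  choose h e' he' using hl
  have hcomp (n : ℕ) : h n ≫ q.app n = π.app n := by
    refine hom_ext_of_appLE _ _ (fun U => ((affineOpen U).comap π).trace n)
      (iSup_preimage_affineOpen π n) (fun U => (affineOpen U).trace n)
      (fun U => (affineOpen U).isAffineOpen_trace (isAffineOpen_affineOpen U) n)
      (fun U => e' n U) (fun U => le_rfl) fun U => ?_
    ext x
    obtain ⟨s, rfl⟩ := exists_section_coe_eq (isAffineOpen_affineOpen U) n x
    have h5 : (h n ≫ q.app n).appLE ((affineOpen U).trace n) (((affineOpen U).comap π).trace n)
      (e' n U) = (q.app n).appLE _ ((affineOpen U).comap q |>.trace n) le_rfl ≫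
        (h n).appLE _ _ (e' n U) :=
      (Scheme.Hom.appLE_comp_appLE _ _ _ _ _ _ _).symm
    rw [h5]
    have h6 := he' n U (B.unit U s)
    rw [hQ.unit, hg] at h6
    exact h6
  refine ⟨⟨h, fun n => ?_⟩, Hom.ext (funext hcomp)⟩
  have hle (U : (Y.level 1).AffineZariskiSite) : ((affineOpen U).comap π).trace n ≤
      T.incl n ⁻¹ᵁ h (n + 1) ⁻¹ᵁ ((affineOpen U).comap q).trace (n + 1) := by
    rw [← ((affineOpen U).comap π).preimage_trace n]
    exact Scheme.Hom.preimage_mono _ (e' (n + 1) U)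
  have hle' (U : (Y.level 1).AffineZariskiSite) : ((affineOpen U).comap π).trace n ≤
      h n ⁻¹ᵁ Q.incl n ⁻¹ᵁ ((affineOpen U).comap q).trace (n + 1) := by
    rw [((affineOpen U).comap q).preimage_trace n]
    exact e' n U
  refine hom_ext_of_appLE _ _ (fun U => ((affineOpen U).comap π).trace n)
    (iSup_preimage_affineOpen π n) (fun U => ((affineOpen U).comap q).trace (n + 1))
    (fun U => isAffineOpen_preimage_affineOpen hQ.isAffineMorphism U (n + 1)) hle hle' fun U => ?_
  ext x
  obtain ⟨b, rfl⟩ := hQ.exists_eq U (n + 1) x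
  have h5 : (T.incl n ≫ h (n + 1)).appLE _ _ (hle U) =
      (h (n + 1)).appLE _ _ (e' (n + 1) U) ≫
        (T.incl n).appLE _ _ (((affineOpen U).comap π).preimage_trace n).ge :=
    (Scheme.Hom.appLE_comp_appLE _ _ _ _ _ _ _).symm
  have h6 : (h n ≫ Q.incl n).appLE _ _ (hle' U) =
      (Q.incl n).appLE _ _ (((affineOpen U).comap q).preimage_trace n).ge ≫
        (h n).appLE _ _ (e' n U) :=
    (Scheme.Hom.appLE_comp_appLE _ _ _ _ _ _ _).symm
  rw [h5, h6]
  refine (congrArg (trans ((affineOpen U).comap π) n) (he' (n + 1) U b)).trans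
    (((g U b).2 n).trans ((he' n U b).symm.trans ?_))
  exact congrArg ((h n).appLE _ _ (e' n U)).hom ((e U b).2 n).symm

/-- Morphisms from `p`-torsion free formal schemes to a formal spectrum which is isogenous to
the base are determined by their projections to the base. -/
theorem hom_ext (hQ : B.IsFormalSpec q e)
    (hB : ∀ U (b : B.ring.obj (op U)), ∃ k s, (p : B.ring.obj (op U)) ^ k * b = B.unit U s)
    (hT : T.IsPTorsionFree) {h h' : T ⟶ Q} (hh : h ≫ q = h' ≫ q) : h = h' := by
  refine hom_ext_of_sectionsMap hQ.isAffineMorphism hh rfl fun U s => ?_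
  have key (b : B.ring.obj (op U)) :
      sectionsMap h _ ((affineOpen U).comap (h' ≫ q)) (app_preimage_comap hh _) (e U b) =
        sectionsMap h' _ ((affineOpen U).comap (h' ≫ q)) (app_preimage_comap rfl _) (e U b) := by
    -- A multiple `p ^ k * b` comes from the base, where both composites agree, and `p ^ k` can be
    -- cancelled on `T`.
    obtain ⟨k, s, hk⟩ := hB U b
    refine hT.pow_mul_cancel k ?_
    have h1 := congrArg (e U) hk
    rw [hQ.unit, map_mul, map_pow, map_natCast] at h1
    have h2 := (congrArg (sectionsMap h _ ((affineOpen U).comap (h' ≫ q))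
      (app_preimage_comap hh _)) h1).trans (sectionsMap_sectionsMap q h _ _ _ _ _ s)
    have h3 := (congrArg (sectionsMap h' _ ((affineOpen U).comap (h' ≫ q))
      (app_preimage_comap rfl _)) h1).trans (sectionsMap_sectionsMap q h' _ _ _ _ _ s)
    rw [map_mul, map_pow, map_natCast] at h2 h3
    rw [h2, h3]
    simp only [hh]
  -- A section need not come from the algebra `B`, but each of its reductions does.
  refine Subtype.ext (funext fun n => ?_)
  obtain ⟨b, hb⟩ := hQ.exists_eq U n (s.1 n)
  have h1 := congrFun (congrArg Subtype.val (key b)) n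
  rw [sectionsMap_coe, sectionsMap_coe, hb] at h1
  exact h1

end QCohAlgebra.IsFormalSpec

end PadicFormalScheme

end PrismEnv

/-! ### Functoriality of the dilatation algebra and existence of dilatations -/

namespace PrismEnv

namespace PadicFormalScheme

variable {p : ℕ} {Y T : PadicFormalScheme.{u} p}

theorem sectionsMap_congr {f f' : T ⟶ Y} (h : f = f') {U : Y.FormalOpen} {W : T.FormalOpen}
    (hf : ∀ n, W.trace n ≤ f.app n ⁻¹ᵁ U.trace n) (hf' : ∀ n, W.trace n ≤ f'.app n ⁻¹ᵁ U.trace n)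
    (s : Y.sections U) : sectionsMap f U W hf s = sectionsMap f' U W hf' s := by
  subst h
  rfl

theorem resSec_sectionsMap (f : T ⟶ Y) {U : Y.FormalOpen} {W W' : T.FormalOpen} (hf) (hf')
    (h : W'.trace 1 ≤ W.trace 1) (s : Y.sections U) :
    resSec h (sectionsMap f U W hf s) = sectionsMap f U W' hf' s :=
  (sectionsMap_sectionsMap _ _ _ _ _ _ _ _).trans (sectionsMap_congr (Category.id_comp f) _ _ s)

theorem sectionsMap_resSec (f : T ⟶ Y) {U U' : Y.FormalOpen} {W : T.FormalOpen} (hf) (hf')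
    (h : U'.trace 1 ≤ U.trace 1) (s : Y.sections U) :
    sectionsMap f U' W hf (resSec h s) = sectionsMap f U W hf' s :=
  (sectionsMap_sectionsMap _ _ _ _ _ _ _ _).trans (sectionsMap_congr (Category.comp_id f) _ _ s)

end PadicFormalScheme

section DilAlgebraMap

variable {A A' A'' : Type*} [CommRing A] [CommRing A'] [CommRing A'']

theorem exists_dilAlgebraMap (p : ℕ) {I : Ideal A} {I' : Ideal A'} (φ : A →+* A')
    (hφ : ∀ a ∈ I, φ a ∈ I') : ∃ g : dilAlgebra p I →+* dilAlgebra p I',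
      ∀ a, g (algebraMap A _ a) = algebraMap A' _ (φ a) := by
  have h1 (b : dilAlgebra p I') (hb : p * b = 0) : b = 0 := dilAlgebra_torsionFree hb
  have h2 (a : A) (ha : a ∈ I) :
      (p : dilAlgebra p I') ∣ (algebraMap A' (dilAlgebra p I')).comp φ a := by
    obtain ⟨b, hb⟩ := exists_mul_eq_of_mem (p := p) (hφ a ha)
    exact ⟨b, hb⟩
  exact exists_dilAlgebra_hom (R := dilAlgebra p I') h1 ((algebraMap A' (dilAlgebra p I')).comp φ) h2

/-- The functoriality of the dilatation algebra. -/
noncomputable def dilAlgebraMap (p : ℕ) {I : Ideal A} {I' : Ideal A'} (φ : A →+* A')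
    (hφ : ∀ a ∈ I, φ a ∈ I') : dilAlgebra p I →+* dilAlgebra p I' :=
  (exists_dilAlgebraMap p φ hφ).choose

theorem dilAlgebraMap_algebraMap (p : ℕ) {I : Ideal A} {I' : Ideal A'} (φ : A →+* A')
    (hφ : ∀ a ∈ I, φ a ∈ I') (a : A) : dilAlgebraMap p φ hφ (algebraMap A _ a) =
      algebraMap A' _ (φ a) :=
  (exists_dilAlgebraMap p φ hφ).choose_spec a

theorem dilAlgebraMap_id (p : ℕ) {I : Ideal A} (φ : A →+* A) (hφ : ∀ a ∈ I, φ a ∈ I)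
    (h : ∀ a, φ a = a) : dilAlgebraMap p φ hφ = RingHom.id _ := by
  have h1 (b : dilAlgebra p I) (hb : p * b = 0) : b = 0 := dilAlgebra_torsionFree hb
  refine dilAlgebra_hom_ext h1 fun a => ?_
  rw [dilAlgebraMap_algebraMap, h, RingHom.id_apply]

theorem dilAlgebraMap_comp (p : ℕ) {I : Ideal A} {I' : Ideal A'} {I'' : Ideal A''} (φ : A →+* A')
    (hφ : ∀ a ∈ I, φ a ∈ I') (φ' : A' →+* A'') (hφ' : ∀ a ∈ I', φ' a ∈ I'') (φ'' : A →+* A'')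
    (hφ'' : ∀ a ∈ I, φ'' a ∈ I'') (h : ∀ a, φ' (φ a) = φ'' a) :
    (dilAlgebraMap p φ' hφ').comp (dilAlgebraMap p φ hφ) = dilAlgebraMap p φ'' hφ'' := by
  have h1 (b : dilAlgebra p I'') (hb : p * b = 0) : b = 0 := dilAlgebra_torsionFree hb
  refine dilAlgebra_hom_ext h1 fun a => ?_
  rw [RingHom.comp_apply, dilAlgebraMap_algebraMap, dilAlgebraMap_algebraMap,
    dilAlgebraMap_algebraMap, h]

theorem IsPLocalization.dilAlgebraMap {p : ℕ} {I : Ideal A} {I' : Ideal A'} {φ : A →+* A'} {f : A}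
    (h : IsPLocalization p φ f) (hφ : ∀ a ∈ I, φ a ∈ I') (hA : ∀ a : A, p * a = 0 → a = 0)
    (hA' : ∀ a : A', p * a = 0 → a = 0) (hp : (p : A') ∈ I')
    (hI : ∀ a, φ a ∈ I' → ∃ N, f ^ N * a ∈ I) :
    IsPLocalization p
      (dilAlgebraMap p φ hφ : PrismEnv.dilAlgebra p I →+* PrismEnv.dilAlgebra p I')
      (algebraMap A (PrismEnv.dilAlgebra p I) f) :=
  h.dilAlgebra hA hA' hp hI _ (dilAlgebraMap_algebraMap p φ hφ)

theorem dilAlgebraMap_natural {p : ℕ} {I : Ideal A} {I' : Ideal A'} {φ : A →+* A'}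
    (hφ : ∀ a ∈ I, φ a ∈ I') {R R' : Type*} [CommRing R] [CommRing R']
    (hR' : ∀ r : R', p * r = 0 → r = 0) {ρ : R →+* R'} {g : dilAlgebra p I →+* R}
    {g' : dilAlgebra p I' →+* R'} {α : A →+* R} {α' : A' →+* R'}
    (hg : ∀ a, g (algebraMap A _ a) = α a) (hg' : ∀ a, g' (algebraMap A' _ a) = α' a)
    (H : ∀ a, α' (φ a) = ρ (α a)) (b : dilAlgebra p I) :
    g' (dilAlgebraMap p φ hφ b) = ρ (g b) := by
  have h1 : g'.comp (dilAlgebraMap p φ hφ) = ρ.comp g := by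
    refine dilAlgebra_hom_ext hR' fun a => ?_
    rw [RingHom.comp_apply, RingHom.comp_apply, dilAlgebraMap_algebraMap, hg, hg', H]
  exact congrArg (fun f : dilAlgebra p I →+* R' => f b) h1

end DilAlgebraMap

namespace ClosedPair

open PadicFormalScheme

variable {p : ℕ} (P : ClosedPair.{u} p)

/-- The ideal of sections over an affine open subset which vanish on the closed subscheme. -/
noncomputable def sectionIdeal (U : (P.Y.level 1).AffineZariskiSite) :
    Ideal (P.Y.sections (affineOpen U)) :=
  RingHom.ker ((P.i.app ((affineOpen U).trace 1)).hom.comp (evalSec (affineOpen U) 1))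

variable {P}

theorem mem_sectionIdeal {U : (P.Y.level 1).AffineZariskiSite}
    {s : P.Y.sections (affineOpen U)} :
    s ∈ P.sectionIdeal U ↔ (P.i.app ((affineOpen U).trace 1)).hom (s.1 1) = 0 := Iff.rfl

theorem natCast_mem_sectionIdeal {U : (P.Y.level 1).AffineZariskiSite} :
    (p : P.Y.sections (affineOpen U)) ∈ P.sectionIdeal U := by
  rw [mem_sectionIdeal]
  have h1 : ((p : P.Y.sections (affineOpen U)) : ∀ n, Γ(P.Y.level n, (affineOpen U).trace n)) 1 =
      (p : Γ(P.Y.level 1, (affineOpen U).trace 1)) := rfl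
  have h2 := pow_eq_zero_trace (affineOpen U) 1
  rw [pow_one] at h2
  rw [h1, h2, map_zero]

theorem resSec_mem_sectionIdeal {U V : (P.Y.level 1).AffineZariskiSite} (h : U ≤ V)
    {s : P.Y.sections (affineOpen V)} (hs : s ∈ P.sectionIdeal V) :
    resSec (affineOpen_mono h) s ∈ P.sectionIdeal U := by
  rw [mem_sectionIdeal] at hs ⊢
  rw [resSec_coe, app_res, hs, map_zero]

/-- The sections of `X` over the smaller open set are a localization at `f`, so vanishing there
means being killed by a power of `f`. This supplies `hI` in `IsPLocalization.dilAlgebraMap`. -/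
theorem exists_pow_mul_mem_sectionIdeal {U V : (P.Y.level 1).AffineZariskiSite} (h : U ≤ V)
    {f : P.Y.sections (affineOpen V)}
    (hf : (P.Y.level 1).basicOpen (f.1 1) = (affineOpen U).trace 1)
    {s : P.Y.sections (affineOpen V)} (hs : resSec (affineOpen_mono h) s ∈ P.sectionIdeal U) :
    ∃ N, f ^ N * s ∈ P.sectionIdeal V := by
  rw [mem_sectionIdeal, resSec_coe, app_res] at hs
  have := P.isClosedImmersion_i
  have hV : IsAffineOpen (P.i ⁻¹ᵁ (affineOpen V).trace 1) := (isAffineOpen_affineOpen V).preimage P.i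
  let := (res (P.i.preimage_mono (affineOpen_mono h))).toAlgebra
  have hloc : IsLocalization.Away ((P.i.app ((affineOpen V).trace 1)).hom (f.1 1))
      Γ(P.X, P.i ⁻¹ᵁ (affineOpen U).trace 1) :=
    hV.isLocalization_of_eq_basicOpen _ (homOfLE (P.i.preimage_mono (affineOpen_mono h)))
      (by rw [← Scheme.preimage_basicOpen, hf])
  obtain ⟨⟨_, N, rfl⟩, hN⟩ := (IsLocalization.map_eq_zero_iff (Submonoid.powers
    ((P.i.app ((affineOpen V).trace 1)).hom (f.1 1))) Γ(P.X, P.i ⁻¹ᵁ (affineOpen U).trace 1)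
      ((P.i.app ((affineOpen V).trace 1)).hom (s.1 1))).1 hs
  refine ⟨N, ?_⟩
  rw [mem_sectionIdeal]
  change (P.i.app ((affineOpen V).trace 1)).hom (f.1 1 ^ N * s.1 1) = 0
  rw [map_mul, map_pow]
  exact hN

/-- The transition maps of the algebra of the dilatation. -/
noncomputable def dilMap {U V : (P.Y.level 1).AffineZariskiSite} (h : U ≤ V) :
    dilAlgebra p (P.sectionIdeal V) →+* dilAlgebra p (P.sectionIdeal U) :=
  dilAlgebraMap p (resSec (affineOpen_mono h)) fun _ => resSec_mem_sectionIdeal h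

theorem dilMap_algebraMap {U V : (P.Y.level 1).AffineZariskiSite} (h : U ≤ V)
    (s : P.Y.sections (affineOpen V)) :
    dilMap h (algebraMap (P.Y.sections (affineOpen V)) _ s) =
      algebraMap (P.Y.sections (affineOpen U)) _ (resSec (affineOpen_mono h) s) :=
  dilAlgebraMap_algebraMap _ _ _ s

theorem dilMap_id (U : (P.Y.level 1).AffineZariskiSite) :
    dilMap (le_refl U) = RingHom.id (dilAlgebra p (P.sectionIdeal U)) :=
  dilAlgebraMap_id _ _ _ fun s =>
    Subtype.ext (funext fun n => (resSec_coe _ s n).trans (res_self _ _))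

theorem dilMap_comp {U V W : (P.Y.level 1).AffineZariskiSite} (h : U ≤ V) (h' : V ≤ W) :
    (dilMap h).comp (dilMap h') = dilMap (P := P) (h.trans h') :=
  dilAlgebraMap_comp _ _ _ _ _ _ _ fun s => sectionsMap_sectionsMap _ _ _ _ _ _ _ s

variable (P) in
/-- The quasi-coherent algebra of the `p`-adic dilatation. -/
noncomputable def dilQCohAlgebra [Fact p.Prime] : P.Y.QCohAlgebra where
  ring :=
    { obj := fun U => CommRingCat.of (dilAlgebra p (P.sectionIdeal U.unop))
      map := fun f => CommRingCat.ofHom (dilMap (leOfHom f.unop))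
      map_id := fun U => CommRingCat.hom_ext (dilMap_id U.unop)
      map_comp := fun f g => CommRingCat.hom_ext (dilMap_comp (leOfHom g.unop)
          (leOfHom f.unop)).symm }
  unit U := algebraMap (P.Y.sections (affineOpen U)) (dilAlgebra p (P.sectionIdeal U))
  map_unit h s := dilMap_algebraMap h s
  torsionFree _ _ h := dilAlgebra_torsionFree h
  isPLocalization {U V} h f hf := (isPLocalization_resSec (isAffineOpen_affineOpen U)
    (isAffineOpen_affineOpen V) (affineOpen_mono h) f hf).dilAlgebraMap
    (fun _ => resSec_mem_sectionIdeal h) (P.torsionFree _) (P.torsionFree _)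
    natCast_mem_sectionIdeal fun _ hs => exists_pow_mul_mem_sectionIdeal h hf hs

/-- Morphisms to the `p`-adic dilatation are determined by their projections to the base. -/
theorem dilatation_hom_ext [Fact p.Prime] {Q : PadicFormalScheme.{u} p} {q : Q ⟶ P.Y} {e}
    (he : P.dilQCohAlgebra.IsFormalSpec q e) {T : PadicFormalScheme.{u} p} (hT : T.IsPTorsionFree)
    {h h' : T ⟶ Q} (hh : h ≫ q = h' ≫ q) : h = h' :=
  he.hom_ext (fun _ b => exists_pow_mul_mem b) hT hh

variable (P) in
/-- The `p`-adic dilatation exists, as the formal spectrum of the dilatation algebra. -/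
theorem exists_dilatation [Fact p.Prime] : ∃ E : P.Enlargement, Nonempty (IsTerminal E) ∧
    ∃ e, P.dilQCohAlgebra.IsFormalSpec E.π e := by
  obtain ⟨Q, q, e, hQ, he⟩ := P.dilQCohAlgebra.exists_formalSpec
  have := P.isClosedImmersion_i
  have := he.isAffineMorphism 1
  -- The special fibre maps into `X` because an element of the ideal of `X` becomes `p * b` in the
  -- dilatation algebra and hence vanishes modulo `p`.
  have hker : P.i.ker ≤ (q.app 1).ker := by
    refine Scheme.IdealSheafData.le_of_iSup_eq_top
      (fun U => (⟨_, isAffineOpen_affineOpen (Y := P.Y) U⟩ : (P.Y.level 1).affineOpens))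
      (P.Y.traceCover (zariskiCover _) 1).iSup_eq_top fun U => ?_
    rw [Scheme.Hom.ker_apply, Scheme.Hom.ker_apply]
    intro x hx
    obtain ⟨s, rfl⟩ := exists_section_coe_eq (isAffineOpen_affineOpen U) 1 x
    obtain ⟨b, hb⟩ := exists_mul_eq_of_mem (p := p) (mem_sectionIdeal.2 hx)
    have h1 := congrArg (fun s => s.1 1) (he.unit U s)
    have h2 : (e U (P.dilQCohAlgebra.unit U s)).1 1 = 0 :=
      (he.eq_zero_iff U 1 _).2 ⟨b, by rw [pow_one]; exact hb⟩
    have h3 := h1.symm.trans h2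
    rw [RingHom.mem_ker, Scheme.Hom.app_eq_appLE]
    exact h3
  let E : P.Enlargement := ⟨Q, hQ, IsClosedImmersion.lift P.i (q.app 1) hker, q,
    IsClosedImmersion.lift_fac _ _ _⟩
  have hex (E' : P.Enlargement) : ∃ h : E'.T ⟶ Q, h ≫ q = E'.π := by
    -- The reduction of `E'.π` factors through `X`, so a section vanishing on `X` pulls back to one
    -- vanishing modulo `p`, which is divisible by `p` by torsion freeness.
    have hdiv (U : (P.Y.level 1).AffineZariskiSite) (s) (hs : s ∈ P.sectionIdeal U) :
        (p : E'.T.sections ((affineOpen U).comap E'.π)) ∣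
          sectionsMap E'.π (affineOpen U) ((affineOpen U).comap E'.π) (fun _ => le_rfl) s := by
      refine E'.torsionFree.exists_eq_mul ?_
      change ((E'.π.app 1).appLE _ _ _).hom (s.1 1) = 0
      have h1 : (E'.π.app 1).appLE ((affineOpen U).trace 1) (((affineOpen U).comap E'.π).trace 1)
          le_rfl = P.i.app _ ≫ E'.z.appLE _ _
            (by rw [← Scheme.Hom.comp_preimage, E'.comm]; exact le_rfl) := by
        refine Eq.trans ?_ (Scheme.Hom.comp_appLE _ _ _ _ _)
        simp only [E'.comm]
      refine (congrArg (fun f : Γ(P.Y.level 1, (affineOpen U).trace 1) ⟶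
        Γ(E'.T.level 1, ((affineOpen U).comap E'.π).trace 1) => f.hom (s.1 1)) h1).trans ?_
      have h2 := mem_sectionIdeal.1 hs
      exact (congrArg (E'.z.appLE _ _ _).hom h2).trans (map_zero _)
    choose g hg using fun U => exists_dilAlgebra_hom (R := E'.T.sections ((affineOpen U).comap E'.π))
      (E'.torsionFree _) _ (hdiv U)
    exact he.exists_hom E'.π g hg fun {U V} h b =>
      dilAlgebraMap_natural (fun _ => resSec_mem_sectionIdeal h) (E'.torsionFree _) (hg V) (hg U)
        (fun s => (sectionsMap_resSec _ _ (fun n => Scheme.Hom.preimage_mono _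
          (FormalOpen.trace_le (affineOpen_mono h) n)) _ s).trans
          (resSec_sectionsMap _ _ _ ((E'.π.app 1).preimage_mono (affineOpen_mono h)) s).symm) b
  refine ⟨E, ⟨IsTerminal.ofUniqueHom (fun E' => ⟨(hex E').choose, ?_, (hex E').choose_spec⟩) ?_⟩,
    e, he⟩
  -- Compatibility with `z` is automatic, `i` being a monomorphism.
  · rw [← cancel_mono P.i, Category.assoc]
    exact (congrArg (_ ≫ ·) (IsClosedImmersion.lift_fac _ _ _)).trans
      ((congrArg (fun f => f.app 1) (hex E').choose_spec).trans E'.comm.symm)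
  · intro E' m
    refine Enlargement.Hom.ext (dilatation_hom_ext he E'.torsionFree ?_)
    exact m.comm_π.trans (hex E').choose_spec.symm

end ClosedPair

end PrismEnv

/-! ### Lifting the endomorphism to the dilatation, and the tower -/

namespace PrismEnv

variable {p : ℕ} [Fact p.Prime]

theorem absFrob_appLE {X : Scheme.{u}} (hX : (p : Γ(X, ⊤)) = 0) {U V : X.Opens} (h : V ≤ U)
    (s : Γ(X, U)) :
    ((absFrob p X hX).appLE U V h).hom s = res h (s ^ p) := rfl

theorem absFrob_naturality {X Y : Scheme.{u}} (f : X ⟶ Y) (hX : (p : Γ(X, ⊤)) = 0)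
    (hY : (p : Γ(Y, ⊤)) = 0) : absFrob p X hX ≫ f = f ≫ absFrob p Y hY := by
  refine hom_ext_of_appLE _ _ (fun V : Y.AffineZariskiSite => f ⁻¹ᵁ V.toOpens)
    ((zariskiCover Y).comap f).iSup_eq_top
    (fun V => V.toOpens) (fun V => V.2) (fun V => ?_) (fun V => ?_) fun V => ?_
  · exact le_refl (f ⁻¹ᵁ V.toOpens)
  · exact le_refl (f ⁻¹ᵁ V.toOpens)
  · ext s
    have h1 := Scheme.Hom.appLE_comp_appLE (absFrob p X hX) f V.toOpens (f ⁻¹ᵁ V.toOpens)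
      (f ⁻¹ᵁ V.toOpens) le_rfl (le_refl (f ⁻¹ᵁ V.toOpens))
    have h2 := Scheme.Hom.appLE_comp_appLE f (absFrob p Y hY) V.toOpens V.toOpens
      (f ⁻¹ᵁ V.toOpens) (le_refl V.toOpens) le_rfl
    have h3 : ((absFrob p X hX).appLE (f ⁻¹ᵁ V.toOpens) (f ⁻¹ᵁ V.toOpens)
        (le_refl (f ⁻¹ᵁ V.toOpens))).hom ((f.appLE V.toOpens (f ⁻¹ᵁ V.toOpens) le_rfl).hom s) =
      (f.appLE V.toOpens (f ⁻¹ᵁ V.toOpens) le_rfl).hom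
        (((absFrob p Y hY).appLE V.toOpens V.toOpens (le_refl V.toOpens)).hom s) := by
      rw [absFrob_appLE, absFrob_appLE, res_self, res_self, map_pow]
    exact (congrArg (fun g : Γ(Y, V.toOpens) ⟶ Γ(X, f ⁻¹ᵁ V.toOpens) => g.hom s) h1).symm.trans
      (h3.trans (congrArg (fun g : Γ(Y, V.toOpens) ⟶ Γ(X, f ⁻¹ᵁ V.toOpens) => g.hom s) h2))

/-- The equalizer of two morphisms over a separated morphism is a closed subscheme. -/
theorem exists_isClosedImmersion_equalizer {T Y X : Scheme.{u}} (a b : T ⟶ Y) (z : Y ⟶ X)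
    [IsSeparated z] (h : a ≫ z = b ≫ z) : ∃ (E : Scheme.{u}) (i : E ⟶ T), IsClosedImmersion i ∧
      i ≫ a = i ≫ b ∧ ∀ (S : Scheme.{u}) (t : S ⟶ T), t ≫ a = t ≫ b → ∃ s, s ≫ i = t := by
  refine ⟨pullback (pullback.lift a b h) (pullback.diagonal z), pullback.fst _ _, inferInstance,
    ?_, fun S t ht => ⟨pullback.lift t (t ≫ a) ?_, pullback.lift_fst _ _ _⟩⟩
  · have h1 := congrArg (· ≫ pullback.fst z z)
      (pullback.condition (f := pullback.lift a b h) (g := pullback.diagonal z))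
    have h2 := congrArg (· ≫ pullback.snd z z)
      (pullback.condition (f := pullback.lift a b h) (g := pullback.diagonal z))
    simp only [Category.assoc, pullback.lift_fst, pullback.lift_snd, pullback.diagonal_fst,
      pullback.diagonal_snd] at h1 h2
    exact h1.trans h2.symm
  · refine pullback.hom_ext ?_ ?_
    · simp only [Category.assoc, pullback.lift_fst, pullback.diagonal_fst, Category.comp_id]
    · simp only [Category.assoc, pullback.lift_snd, pullback.diagonal_snd, Category.comp_id]
      exact ht.symm

namespace FrobeniusPair

open PadicFormalScheme

/-- The pair `P'` is obtained from `P` by dilatation, and its closed subscheme is the locus where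
the endomorphism agrees with the absolute Frobenius. -/
structure IsFrobeniusStep (P P' : FrobeniusPair.{u} p)
    (f : ClosedPair.Hom P'.toClosedPair P.toClosedPair) (z : P'.Y.level 1 ⟶ P.X) : Prop where
  comm : z ≫ P.i = f.hom.app 1
  homX : f.homX = P'.i ≫ z
  comm_ψ : P'.ψ ≫ f.hom = f.hom ≫ P.ψ
  comm_z : P'.ψ.app 1 ≫ z = z ≫ absFrob p P.X P.natCast_X
  isTerminal : Nonempty (IsTerminal (⟨P'.Y, P'.torsionFree, z, f.hom, comm⟩ :
    P.toClosedPair.Enlargement))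
  isFormalSpec : ∃ e, P.toClosedPair.dilQCohAlgebra.IsFormalSpec f.hom e
  exists_lift : ∀ (T : Scheme.{u}) (t : T ⟶ P'.Y.level 1),
    t ≫ P'.ψ.app 1 = t ≫ absFrob p _ P'.Y.natCast_level_one → ∃ s, s ≫ P'.i = t

/-- The new closed subscheme is the equalizer of the lifted endomorphism and Frobenius; by
naturality of Frobenius, the lift restricts on it to its own Frobenius. -/
theorem exists_isFrobeniusStep (P : FrobeniusPair.{u} p) :
    ∃ P' f z, P.IsFrobeniusStep P' f z := by
  obtain ⟨E, ⟨hE⟩, e, he⟩ := P.toClosedPair.exists_dilatation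
  have := P.isClosedImmersion_i
  -- Following `π` by `ψ` and `z` by Frobenius gives another enlargement, by `ψ ∘ i = i ∘ F`. Its
  -- morphism to the final enlargement is the lift of `ψ`.
  let E' : P.toClosedPair.Enlargement := ⟨E.T, E.torsionFree,
    E.z ≫ absFrob p P.X P.natCast_X, E.π ≫ P.ψ, by
      rw [Category.assoc, P.restricts, ← Category.assoc, E.comm]; rfl⟩
  let ψ : E.T ⟶ E.T := (hE.from E').hom
  have hψz : ψ.app 1 ≫ E.z = E.z ≫ absFrob p P.X P.natCast_X := (hE.from E').comm_z
  have hψπ : ψ ≫ E.π = E.π ≫ P.ψ := (hE.from E').comm_π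
  let F := absFrob p (E.T.level 1) E.T.natCast_level_one
  have hF : ψ.app 1 ≫ E.z = F ≫ E.z := hψz.trans (absFrob_naturality E.z _ _).symm
  -- Affine morphisms are separated, so the equalizer over `X` is closed.
  have haff : IsAffineHom E.z := by
    have h1 : IsAffineHom (E.z ≫ P.i) := by
      rw [E.comm]
      exact he.isAffineMorphism 1
    exact IsAffineHom.of_comp _ P.i
  obtain ⟨X', i', hi', h1, h2⟩ := exists_isClosedImmersion_equalizer (ψ.app 1) F E.z hF
  let P' : FrobeniusPair.{u} p :=
    { Y := E.T
      torsionFree := E.torsionFree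
      X := X'
      i := i'
      isClosedImmersion_i := hi'
      ψ := ψ
      restricts := (absFrob_naturality i' _ _).trans h1.symm }
  refine ⟨P', ⟨E.π, i' ≫ E.z, by rw [Category.assoc, E.comm]⟩, E.z, E.comm, rfl, hψπ, hψz, ⟨hE⟩,
    ⟨e, he⟩, h2⟩

theorem IsFrobeniusStep.hom_ext {P P' : FrobeniusPair.{u} p} {f z} (h : P.IsFrobeniusStep P' f z)
    {T : PadicFormalScheme.{u} p} (hT : T.IsPTorsionFree) {g g' : T ⟶ P'.Y}
    (hg : g ≫ f.hom = g' ≫ f.hom) : g = g' := by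
  obtain ⟨e, he⟩ := h.isFormalSpec
  exact ClosedPair.dilatation_hom_ext he hT hg

theorem IsFrobeniusStep.exists_hom {P P' : FrobeniusPair.{u} p} {f z} (h : P.IsFrobeniusStep P' f z)
    {T : PadicFormalScheme.{u} p} (hT : T.IsPTorsionFree) (π : T ⟶ P.Y)
    (hπ : ∃ s, s ≫ P.i = π.app 1) :
    ∃ g : T ⟶ P'.Y, g ≫ f.hom = π := by
  obtain ⟨s, hs⟩ := hπ
  obtain ⟨ht⟩ := h.isTerminal
  exact ⟨(ht.from ⟨T, hT, s, π, hs⟩).hom, (ht.from ⟨T, hT, s, π, hs⟩).comm_π⟩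

/-- The sequence of pairs obtained by iterating the dilatation. -/
noncomputable def iterate (P : FrobeniusPair.{u} p) : ℕ → FrobeniusPair.{u} p
  | 0 => P
  | n + 1 => (exists_isFrobeniusStep (iterate P n)).choose

/-- A tower of dilatations of pairs with endomorphisms lifting the Frobenius of the closed
subschemes. -/
structure FrobeniusTower (P : FrobeniusPair.{u} p) where
  tower : P.toClosedPair.DilatationTower
  ψ : ∀ n, (tower.pair n).Y ⟶ (tower.pair n).Y
  restricts : ∀ n, absFrob p (tower.pair n).X (tower.pair n).natCast_X ≫ (tower.pair n).i =
    (tower.pair n).i ≫ (ψ n).app 1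
  z : ∀ n, (tower.pair (n + 1)).Y.level 1 ⟶ (tower.pair n).X
  ψ_zero : ψ 0 = P.ψ
  step : ∀ n, IsFrobeniusStep ⟨tower.pair n, ψ n, restricts n⟩
    ⟨tower.pair (n + 1), ψ (n + 1), restricts (n + 1)⟩ (tower.map n) (z n)

theorem nonempty_frobeniusTower (P : FrobeniusPair.{u} p) : Nonempty P.FrobeniusTower := by
  choose f z h using fun n => (exists_isFrobeniusStep (iterate P n)).choose_spec
  let next (n : ℕ) : ClosedPair.{u} p := (iterate P (n + 1)).toClosedPair
  let D : P.toClosedPair.DilatationTower :=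
    { next := next
      -- The case distinction makes `stage`, which is defined by cases, reduce to a term of
      -- `iterate`.
      map := fun n => match n with
        | 0 => f 0
        | n + 1 => f (n + 1)
      isDilatation := fun n => match n with
        | 0 => ⟨(iterate P 1).torsionFree, z 0, (h 0).comm, (h 0).isTerminal⟩
        | n + 1 => ⟨(iterate P (n + 2)).torsionFree, z (n + 1), (h (n + 1)).comm,
            (h (n + 1)).isTerminal⟩ }
  exact ⟨
    { tower := D
      ψ := fun n => match n with
        | 0 => P.ψ
        | n + 1 => (iterate P (n + 1)).ψ
      restricts := fun n => match n with
        | 0 => P.restricts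
        | n + 1 => (iterate P (n + 1)).restricts
      z := fun n => match n with
        | 0 => z 0
        | n + 1 => z (n + 1)
      ψ_zero := rfl
      step := fun n => match n with
        | 0 => h 0
        | n + 1 => h (n + 1) }⟩

end FrobeniusPair

end PrismEnv

/-! ### Limits of sequences of formal schemes -/

namespace PrismEnv

/-- Limits of sequences of pullback squares over the zeroth square are pullbacks. -/
theorem isPullback_isLimit_map {C : Type*} [Category C] {D D' : ℕᵒᵖ ⥤ C} (τ : D ⟶ D') {c : Cone D}
    {c' : Cone D'} (hc : IsLimit c) (hc' : IsLimit c')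
    (h : ∀ n : ℕᵒᵖ, IsPullback (τ.app n) (D.map (homOfLE n.unop.zero_le).op)
      (D'.map (homOfLE n.unop.zero_le).op) (τ.app (op 0))) :
    IsPullback (hc'.map c τ) (c.π.app (op 0)) (c'.π.app (op 0)) (τ.app (op 0)) := by
  have hl (s : PullbackCone (c'.π.app (op 0)) (τ.app (op 0))) :
      ∃ l : s.pt ⟶ c.pt, ∀ n, l ≫ c.π.app n ≫ τ.app n = s.fst ≫ c'.π.app n ∧
        l ≫ c.π.app n ≫ D.map (homOfLE n.unop.zero_le).op = s.snd := by
    have hw (n : ℕᵒᵖ) : (s.fst ≫ c'.π.app n) ≫ D'.map (homOfLE n.unop.zero_le).op =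
        s.snd ≫ τ.app (op 0) := by
      rw [Category.assoc, c'.w, s.condition]
    refine ⟨hc.lift ⟨s.pt, { app := fun n => (h n).lift _ _ (hw n), naturality := ?_ }⟩,
      fun n => ⟨?_, ?_⟩⟩
    · intro n n' f
      refine (Category.id_comp _).trans ((h n').hom_ext ?_ ?_)
      · rw [IsPullback.lift_fst, Category.assoc, τ.naturality, IsPullback.lift_fst_assoc,
          Category.assoc, c'.w]
      · rw [IsPullback.lift_snd, Category.assoc, ← D.map_comp]
        exact ((h n).lift_snd _ _ (hw n)).symm
    · rw [IsLimit.fac_assoc]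
      exact (h n).lift_fst _ _ (hw n)
    · rw [IsLimit.fac_assoc]
      exact (h n).lift_snd _ _ (hw n)
  choose l hl1 using hl
  have hz (s) : l s ≫ c.π.app (op 0) = s.snd := by
    have := (hl1 s (op 0)).2
    rwa [show (homOfLE (op 0).unop.zero_le).op = 𝟙 (op 0) from rfl, D.map_id,
      Category.comp_id] at this
  refine ⟨⟨IsLimit.map_π _ _ _ _⟩, ⟨PullbackCone.IsLimit.mk _ l (fun s => hc'.hom_ext fun n => ?_) hz
    fun s m hm hm' => hc.hom_ext fun n => ?_⟩⟩
  · rw [Category.assoc, IsLimit.map_π]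
    exact (hl1 s n).1
  · refine (h n).hom_ext ?_ ?_
    · rw [Category.assoc, Category.assoc, (hl1 s n).1, ← hm, Category.assoc, IsLimit.map_π]
    · rw [Category.assoc, Category.assoc, (hl1 s n).2, ← hm', c.w]

theorem app_appLE_eq_zero {A B A' B' : Scheme.{u}} (i : A ⟶ A') (j : B ⟶ B') (f : A ⟶ B)
    (f' : A' ⟶ B') (h : i ≫ f' = f ≫ j) {V : B'.Opens} {W : A'.Opens} (e : W ≤ f' ⁻¹ᵁ V)
    {t : Γ(B', V)} (ht : (j.app V).hom t = 0) :
    (i.app W).hom ((f'.appLE V W e).hom t) = 0 := by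
  have e' : i ⁻¹ᵁ W ≤ f ⁻¹ᵁ j ⁻¹ᵁ V := by
    rw [← Scheme.Hom.comp_preimage, ← h]
    exact i.preimage_mono e
  have h4 : f'.appLE V W e ≫ i.app W = j.app V ≫ f.appLE (j ⁻¹ᵁ V) (i ⁻¹ᵁ W) e' := by
    rw [Scheme.Hom.app_eq_appLE, Scheme.Hom.app_eq_appLE, Scheme.Hom.appLE_comp_appLE,
      Scheme.Hom.appLE_comp_appLE]
    simp only [h]
  refine (congrArg (fun g : Γ(B', V) ⟶ Γ(A, i ⁻¹ᵁ W) => g.hom t) h4).trans ?_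
  exact (congrArg (f.appLE _ _ e').hom ht).trans (map_zero _)

namespace PadicFormalScheme

variable {p : ℕ}

/-- The natural transformation given by the inclusions of the reductions. -/
def inclNat (p m : ℕ) : reduction.{u} p m ⟶ reduction p (m + 1) where
  app Y := Y.incl m
  naturality _ _ f := (f.comm m).symm

variable {S : ℕᵒᵖ ⥤ PadicFormalScheme.{u} p}

/-- Sequences of `p`-torsion free formal schemes with affine transition maps have limits. -/
theorem exists_limit [Fact p.Prime]
    (hS : ∀ {m n : ℕᵒᵖ} (f : m ⟶ n), IsAffineMorphism (S.map f))
    (hTF : ∀ n, (S.obj n).IsPTorsionFree) :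
    ∃ (L : PadicFormalScheme.{u} p) (τ : (Functor.const ℕᵒᵖ).obj L ⟶ S),
      L.IsPTorsionFree ∧ IsAffineMorphism (τ.app (op 0)) ∧
      ∀ m, Nonempty (IsLimit ((reduction p m).mapCone (Cone.mk L τ))) ∧
        ∀ U : ((S.obj (op 0)).level m).Opens, IsAffineOpen U →
          Nonempty (IsColimit (seqSectionsCocone ((reduction p m).mapCone (Cone.mk L τ)) U)) := by
  choose c hc haff hcol using fun m =>
    PrismEnv.exists_isLimit (S ⋙ reduction p m) (fun {_ _} f => hS f m)
  have hc' (m : ℕ) : IsLimit (c m) := (hc m).some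
  let incl (m : ℕ) : (c m).pt ⟶ (c (m + 1)).pt :=
    (hc' (m + 1)).map (c m) (Functor.whiskerLeft S (inclNat p m))
  have hincl (m : ℕ) (n : ℕᵒᵖ) :
      incl m ≫ (c (m + 1)).π.app n = (c m).π.app n ≫ (S.obj n).incl m := IsLimit.map_π _ _ _ _
  -- At every stage the inclusion of reductions is pulled back from stage zero; hence so is the
  -- inclusion of limits, and the limits of the reductions form a formal scheme.
  have hpb (m : ℕ) : IsPullback (incl m) ((c m).π.app (op 0)) ((c (m + 1)).π.app (op 0))
      ((S.obj (op 0)).incl m) :=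
    isPullback_isLimit_map (Functor.whiskerLeft S (inclNat p m)) (hc' m) (hc' (m + 1))
      fun n => isPullback_app (S.map (homOfLE n.unop.zero_le).op) m
  let L := ofIsPullback hpb
  let τ : (Functor.const ℕᵒᵖ).obj L ⟶ S :=
    { app := fun n => { app := fun m => (c m).π.app n, comm := fun m => hincl m n }
      naturality := fun n n' f => Hom.ext (funext fun m => (c m).π.naturality f) }
  refine ⟨L, τ, ?_, haff, fun m => ⟨⟨hc' m⟩, hcol m⟩⟩
  have haff' (m : ℕ) : IsAffineHom ((c m).π.app (op 0)) := haff m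
  refine isPTorsionFree_of_iSup_eq_top
    (fun n (U : ((S.obj (op 0)).level (n + 1)).AffineZariskiSite) =>
      (c (n + 1)).π.app (op 0) ⁻¹ᵁ U.toOpens)
    (fun n U => @IsAffineOpen.preimage _ _ _ U.2 _ (haff' (n + 1)))
    (fun n => ((zariskiCover _).comap ((c (n + 1)).π.app (op 0))).iSup_eq_top) ?_
  intro n U x hx
  have hcolU := (hcol (n + 1) U.toOpens U.2).some
  obtain ⟨k, t, rfl⟩ := exists_appLE_eq_of_isColimit hcolU x
  -- A `p`-torsion section of the limit comes from a section at a finite stage whose multiple by `p`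
  -- is zero at a later stage, where torsion freeness is known.
  obtain ⟨m, hkm, hm⟩ := exists_appLE_eq_zero_of_isColimit hcolU (n := k) (p * t) (by
    refine (map_mul ((c (n + 1)).π.app (op k) |>.appLE _ _ _).hom _ _).trans (Eq.trans ?_ hx)
    rw [map_natCast]
    rfl)
  let V := (S.map (homOfLE m.zero_le).op).app (n + 1) ⁻¹ᵁ U.toOpens
  obtain ⟨t', ht'⟩ : ∃ t' : Γ((S.obj (op m)).level (n + 1), V),
    ((seqSections (S ⋙ reduction p (n + 1)) U.toOpens).map (homOfLE hkm)).hom t = t' := ⟨_, rfl⟩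
  have h1 : p * t' = 0 := by
    refine Eq.trans ?_ hm
    refine Eq.trans ?_ (map_mul ((seqSections (S ⋙ reduction p (n + 1))
        U.toOpens).map (homOfLE hkm)).hom _ _).symm
    rw [← ht']
    exact congrArg (fun x : (seqSections (S ⋙ reduction p (n + 1)) U.toOpens).obj m => x * _)
        (map_natCast
      ((seqSections (S ⋙ reduction p (n + 1)) U.toOpens).map (homOfLE hkm)).hom p).symm
  have h2 := (hTF (op m)).app_eq_zero h1
  have h3 : ((seqSectionsCocone (c (n + 1)) U.toOpens).ι.app k).hom t =
      ((c (n + 1)).π.app (op m)).appLE V _ (seqSections_le (c (n + 1)) U.toOpens m) t' := by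
    rw [← ht', ← (seqSectionsCocone (c (n + 1)) U.toOpens).w (homOfLE hkm)]
    rfl
  exact (congrArg ((incl n).app _).hom h3).trans (app_appLE_eq_zero (incl n)
    ((S.obj (op m)).incl n) ((c n).π.app (op m)) ((c (n + 1)).π.app (op m)) (hincl n (op m)) _ h2)

end PadicFormalScheme

end PrismEnv

/-! ### The prismatic envelope as the limit of the tower -/

namespace PrismEnv

namespace PadicFormalScheme

variable {p : ℕ} {S : ℕᵒᵖ ⥤ PadicFormalScheme.{u} p} {L : PadicFormalScheme.{u} p}
  {τ : (Functor.const ℕᵒᵖ).obj L ⟶ S}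

theorem IsAffineMorphism.comp {X Y Z : PadicFormalScheme.{u} p} {f : X ⟶ Y} {g : Y ⟶ Z}
    (hf : IsAffineMorphism f) (hg : IsAffineMorphism g) : IsAffineMorphism (f ≫ g) := fun n => by
  have := hf n
  have := hg n
  exact inferInstanceAs (IsAffineHom (f.app n ≫ g.app n))

theorem limit_hom_ext (hL : ∀ m, Nonempty (IsLimit ((reduction p m).mapCone (Cone.mk L τ))))
    {T : PadicFormalScheme.{u} p} {g g' : T ⟶ L} (h : ∀ n, g ≫ τ.app n = g' ≫ τ.app n) :
    g = g' :=
  Hom.ext (funext fun m => (hL m).some.hom_ext fun n => congrArg (fun f => f.app m) (h n))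

theorem exists_limit_lift (hL : ∀ m, Nonempty (IsLimit ((reduction p m).mapCone (Cone.mk L τ))))
    {T : PadicFormalScheme.{u} p} (σ : (Functor.const ℕᵒᵖ).obj T ⟶ S) :
    ∃ g : T ⟶ L, ∀ n, g ≫ τ.app n = σ.app n := by
  let l (m : ℕ) : T.level m ⟶ L.level m := (hL m).some.lift ((reduction p m).mapCone (Cone.mk T σ))
  have hl (m : ℕ) (n : ℕᵒᵖ) : l m ≫ (τ.app n).app m = (σ.app n).app m :=
    (hL m).some.fac ((reduction p m).mapCone (Cone.mk T σ)) n
  refine ⟨⟨l, fun m => (hL (m + 1)).some.hom_ext fun n => ?_⟩,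
      fun n => Hom.ext (funext fun m => hl m n)⟩
  change (T.incl m ≫ l (m + 1)) ≫ (τ.app n).app (m + 1) = (l m ≫ L.incl m) ≫ (τ.app n).app (m + 1)
  have h1 : L.incl m ≫ (τ.app n).app (m + 1) = (τ.app n).app m ≫ (S.obj n).incl m :=
    (τ.app n).comm m
  rw [Category.assoc, hl, Category.assoc, h1]
  refine ((σ.app n).comm m).trans ?_
  rw [← hl m n, Category.assoc]

end PadicFormalScheme

namespace FrobeniusPair

open PadicFormalScheme

variable {p : ℕ} [Fact p.Prime] {P : FrobeniusPair.{u} p} (W : P.FrobeniusTower)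

namespace FrobeniusTower

/-- The transition morphisms of the formal schemes of a tower. -/
def hom (n : ℕ) : (W.tower.pair (n + 1)).Y ⟶ (W.tower.pair n).Y := (W.tower.map n).hom

theorem ψ_comp_hom (n : ℕ) : W.ψ (n + 1) ≫ W.hom n = W.hom n ≫ W.ψ n := (W.step n).comm_ψ

theorem z_comp_i (n : ℕ) : W.z n ≫ (W.tower.pair n).i = (W.hom n).app 1 := (W.step n).comm

theorem hom_ext {T : PadicFormalScheme.{u} p} (hT : T.IsPTorsionFree) {n : ℕ}
    {g g' : T ⟶ (W.tower.pair (n + 1)).Y} (hg : g ≫ W.hom n = g' ≫ W.hom n) : g = g' :=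
  (W.step n).hom_ext hT hg

theorem system_map_succ (n : ℕ) :
    W.tower.system.map (homOfLE (Nat.le_add_right n 1)).op = W.hom n :=
  Functor.ofOpSequence_map_homOfLE_succ _ n

theorem isAffineMorphism_map (n : ℕ) : IsAffineMorphism (W.hom n) :=
  (W.step n).isFormalSpec.choose_spec.isAffineMorphism

theorem isAffineMorphism_system {m n : ℕᵒᵖ} (f : m ⟶ n) : IsAffineMorphism (W.tower.system.map f)
    := by
  obtain ⟨m⟩ := m
  obtain ⟨n⟩ := n
  have hmn : n ≤ m := leOfHom f.unop
  obtain rfl : f = (homOfLE hmn).op := rfl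
  induction m, hmn using Nat.le_induction with
  | base =>
    intro k
    rw [show (homOfLE (le_refl n)).op = 𝟙 (op n) from rfl, W.tower.system.map_id]
    exact inferInstanceAs (IsAffineHom (𝟙 _))
  | succ m hmn ih =>
    have h1 : (homOfLE (hmn.trans m.le_succ)).op =
      (homOfLE (Nat.le_add_right m 1)).op ≫ (homOfLE hmn).op := rfl
    rw [h1, W.tower.system.map_comp, system_map_succ]
    exact IsAffineMorphism.comp (W.isAffineMorphism_map m) ih

theorem torsionFree_system (n : ℕᵒᵖ) : (W.tower.system.obj n).IsPTorsionFree :=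
  (W.tower.pair n.unop).torsionFree

/-- Compatible morphisms to the terms of a tower. -/
def cone {T : PadicFormalScheme.{u} p} (σ : ∀ n, T ⟶ (W.tower.pair n).Y)
    (hσ : ∀ n, σ (n + 1) ≫ W.hom n = σ n) :
    (Functor.const ℕᵒᵖ).obj T ⟶ W.tower.system :=
  NatTrans.ofOpSequence (G := W.tower.system) σ fun n => by
    rw [system_map_succ]
    exact (Category.id_comp _).trans (hσ n).symm

/-- The induction carries compatibility with the endomorphisms and the factorization of the
reduction through `X⁽ⁿ⁾`. The factorization gives a lift to the dilatation, uniqueness of lifts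
makes it compatible with the endomorphisms, and compatibility modulo `p` puts its reduction into the
locus `X⁽ⁿ⁺¹⁾`. -/
theorem exists_prism_hom (E : P.Prism) : ∃ σ : ∀ n, E.T.T ⟶ (W.tower.pair n).Y, σ 0 = E.π ∧
    ∀ n, σ (n + 1) ≫ W.hom n = σ n := by
  let Q (n : ℕ) := {σ : E.T.T ⟶ (W.tower.pair n).Y // E.T.φ ≫ σ = σ ≫ W.ψ n ∧
    ∃ s, s ≫ (W.tower.pair n).i = σ.app 1}
  have hstep (n : ℕ) (σ : Q n) : ∃ σ' : Q (n + 1), σ'.1 ≫ W.hom n = σ.1 := by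
    obtain ⟨σ', hσ'⟩ : ∃ σ' : E.T.T ⟶ (W.tower.pair (n + 1)).Y, σ' ≫ W.hom n = σ.1 :=
      (W.step n).exists_hom E.T.torsionFree σ.1 σ.2.2
    have h1 : E.T.φ ≫ σ' = σ' ≫ W.ψ (n + 1) := by
      refine W.hom_ext E.T.torsionFree ?_
      rw [Category.assoc, Category.assoc, hσ', ψ_comp_hom, ← Category.assoc, hσ', σ.2.1]
    refine ⟨⟨σ', h1, (W.step n).exists_lift _ (σ'.app 1) ?_⟩, hσ'⟩
    refine (congrArg (fun f => f.app 1) h1).symm.trans ?_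
    rw [← absFrob_naturality (σ'.app 1) E.T.T.natCast_level_one, ← E.T.lifts]
    rfl
  choose next hnext using hstep
  let q0 : Q 0 := ⟨E.π, by rw [W.ψ_zero]; exact E.comm_φ, E.z, E.comm⟩
  let q (n : ℕ) : Q n := Nat.rec q0 (fun n x => next n x) n
  exact ⟨fun n => (q n).1, rfl, fun n => hnext n (q n)⟩

/-- The colimit description of sections is kept in the conclusion because the faithful flatness of
`z` is deduced from it. -/
theorem exists_envelope : ∃ (Δ : P.Prism) (τ : (Functor.const ℕᵒᵖ).obj Δ.T.T ⟶ W.tower.system),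
    Δ.IsPrismaticEnvelope ∧ IsAffineMorphism Δ.π ∧ τ.app (op 0) = Δ.π ∧
    Δ.z = (τ.app (op 1)).app 1 ≫ W.z 0 ∧
    ∀ m, Nonempty (IsLimit ((reduction p m).mapCone (Cone.mk Δ.T.T τ))) ∧
      ∀ U : (P.Y.level m).Opens, IsAffineOpen U →
        Nonempty (IsColimit (seqSectionsCocone ((reduction p m).mapCone (Cone.mk Δ.T.T τ)) U)) := by
  obtain ⟨L, τ, hL, haff, h⟩ := exists_limit W.isAffineMorphism_system W.torsionFree_system
  obtain ⟨t, ht⟩ : ∃ t : ∀ n, L ⟶ (W.tower.pair n).Y, ∀ n, τ.app (op n) = t n :=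
    ⟨_, fun _ => rfl⟩
  have hτ (n : ℕ) : t (n + 1) ≫ W.hom n = t n := by
    have h1 := τ.naturality (homOfLE (Nat.le_add_right n 1)).op
    rw [system_map_succ, ht, ht] at h1
    exact h1.symm.trans (Category.id_comp _)
  obtain ⟨φ, hφ⟩ := exists_limit_lift (fun m => (h m).1)
    (W.cone (fun n => t n ≫ W.ψ n) fun n => by
      rw [Category.assoc, ψ_comp_hom, ← hτ n, Category.assoc])
  replace hφ (n : ℕ) : φ ≫ t n = t n ≫ W.ψ n := by
    rw [← ht]
    exact (hφ (op n)).trans (congrArg (· ≫ W.ψ n) (ht n).symm)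
  have hτ1 (n : ℕ) : (t n).app 1 = ((t (n + 1)).app 1 ≫ W.z n) ≫ (W.tower.pair n).i := by
    rw [← hτ n, Category.assoc]
    exact congrArg (_ ≫ ·) (W.z_comp_i n).symm
  -- By `hτ1` the reduction of each projection factors through the closed subscheme of that stage,
  -- where the endomorphism is Frobenius.
  have hlift : φ.app 1 = absFrob p (L.level 1) L.natCast_level_one := by
    refine (h 1).1.some.hom_ext fun n => ?_
    obtain ⟨n⟩ := n
    change φ.app 1 ≫ (τ.app (op n)).app 1 = absFrob p _ _ ≫ (τ.app (op n)).app 1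
    rw [ht]
    change φ.app 1 ≫ (t n).app 1 = absFrob p (L.level 1) L.natCast_level_one ≫ (t n).app 1
    rw [absFrob_naturality _ _ (W.tower.pair n).Y.natCast_level_one]
    refine (congrArg (fun f => f.app 1) (hφ n)).trans ?_
    change (t n).app 1 ≫ (W.ψ n).app 1 = _
    rw [hτ1, Category.assoc, ← W.restricts,
      absFrob_naturality _ _ (W.tower.pair n).Y.natCast_level_one]
    exact (Category.assoc _ _ _).symm
  let Δ : P.Prism :=
    { T := ⟨L, hL, φ, hlift⟩
      z := (t 1).app 1 ≫ W.z 0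
      π := t 0
      comm := (hτ1 0).symm
      comm_φ := (hφ 0).trans (congrArg (_ ≫ ·) W.ψ_zero) }
  -- Agreement over `Y` propagates up the tower, since a morphism from a `p`-torsion free formal
  -- scheme to a dilatation is determined by its projection.
  have huniq (E : P.Prism) (g g' : E.T.T ⟶ L) (hg : g ≫ t 0 = g' ≫ t 0) :
      g = g' := by
    refine limit_hom_ext (fun m => (h m).1) fun ⟨n⟩ => ?_
    rw [ht]
    induction n with
    | zero => exact hg
    | succ n ih =>
      refine W.hom_ext E.T.torsionFree ?_
      change (g ≫ t (n + 1)) ≫ W.hom n = (g' ≫ t (n + 1)) ≫ W.hom n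
      rw [Category.assoc, Category.assoc, hτ]
      exact ih
  have hex (E : P.Prism) : ∃ g : E.T.T ⟶ L, g ≫ t 0 = E.π := by
    obtain ⟨σ, hσ0, hσ⟩ := W.exists_prism_hom E
    obtain ⟨g, hg⟩ := exists_limit_lift (fun m => (h m).1) (W.cone σ hσ)
    rw [← ht]
    exact ⟨g, (hg (op 0)).trans hσ0⟩
  have := P.isClosedImmersion_i
  have hΔ : IsAffineMorphism (t 0) := by
    rw [← ht]
    exact haff
  refine ⟨Δ, τ, ⟨IsTerminal.ofUniqueHom (fun E => ⟨⟨(hex E).choose, ?_⟩, ?_,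
    (hex E).choose_spec⟩) fun E m => ?_⟩, hΔ, ht 0,
    congrArg (fun f : L ⟶ (W.tower.pair 1).Y => f.app 1 ≫ W.z 0) (ht 1).symm, h⟩
  · refine huniq E _ _ ?_
    rw [Category.assoc, Category.assoc]
    refine (congrArg (_ ≫ ·) (hex E).choose_spec).trans (E.comm_φ.trans ?_)
    refine Eq.trans ?_ (congrArg (_ ≫ ·) Δ.comm_φ).symm
    refine Eq.trans ?_ (Category.assoc _ _ _)
    exact congrArg (· ≫ P.ψ) (hex E).choose_spec.symm
  · rw [← cancel_mono P.i]
    refine (Category.assoc _ _ _).trans ((congrArg (_ ≫ ·) Δ.comm).trans ?_)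
    exact (congrArg (fun f => f.app 1) (hex E).choose_spec).trans E.comm.symm
  · refine Prism.Hom.ext (FormalPhiScheme.Hom.ext (huniq E _ _ ?_))
    exact m.comm_π.trans (hex E).choose_spec.symm

end FrobeniusTower

end FrobeniusPair

end PrismEnv

/-! ### Fibre products and flat base change of torsion freeness -/

namespace PrismEnv

/-- The ideal of elements killed by an element of the base generates that of a flat algebra. -/
theorem exists_sum_of_flat {R S : Type*} [CommRing R] [CommRing S] (f : R →+* S) (hf : f.Flat)
    (r : R) (x : S) (hx : f r * x = 0) :
    ∃ (n : ℕ) (a : Fin n → R) (y : Fin n → S), x = ∑ j, f (a j) * y j ∧ ∀ j, r * a j = 0 := by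
  algebraize [f]
  have h := Module.Flat.isTrivialRelation_of_sum_smul_eq_zero (R := R) (M := S) (ι := Unit)
    (f := fun _ => r) (x := fun _ => x) (by
      simpa [Algebra.smul_def, RingHom.algebraMap_toAlgebra] using hx)
  obtain ⟨k, a, y, h1, h2⟩ := h
  exact ⟨k, a (), y, by simpa [Algebra.smul_def, RingHom.algebraMap_toAlgebra] using h1 (),
    fun j => by simpa using h2 j⟩

namespace PadicFormalScheme

variable {p : ℕ}

/-- Fibre products are formed level by level; pasting pullback squares shows that the inclusions
between levels are base changes of those of `D`. -/
theorem exists_pullback {D Y Y' : PadicFormalScheme.{u} p} (f : D ⟶ Y) (g : Y' ⟶ Y) :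
    ∃ (W : PadicFormalScheme.{u} p) (a : W ⟶ D) (b : W ⟶ Y'), IsPullback a b f g ∧
      ∀ n, IsPullback (a.app n) (b.app n) (f.app n) (g.app n) := by
  have hW (n : ℕ) : IsPullback (pullback.fst (f.app n) (g.app n)) (pullback.snd (f.app n) (g.app n))
    (f.app n) (g.app n) := IsPullback.of_hasPullback _ _
  let i (n : ℕ) : pullback (f.app n) (g.app n) ⟶ pullback (f.app (n + 1)) (g.app (n + 1)) :=
    pullback.map _ _ _ _ (D.incl n) (Y'.incl n) (Y.incl n) (f.comm n).symm (g.comm n).symm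
  have hi1 (n) : i n ≫ pullback.fst _ _ = pullback.fst _ _ ≫ D.incl n := pullback.lift_fst _ _ _
  have hi2 (n) : i n ≫ pullback.snd _ _ = pullback.snd _ _ ≫ Y'.incl n := pullback.lift_snd _ _ _
  have hpb (n) : IsPullback (i n) (pullback.fst (f.app n) (g.app n))
      (pullback.fst (f.app (n + 1)) (g.app (n + 1))) (D.incl n) := by
    have h1 := (hW n).flip.flip.flip.paste_horiz (isPullback_app g n)
    rw [← hi2, ← f.comm n] at h1
    exact IsPullback.of_right h1 (hi1 n) (hW (n + 1)).flip
  let W := ofIsPullback hpb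
  let a : W ⟶ D := ofIsPullbackHom hpb
  let b : W ⟶ Y' := ⟨fun n => pullback.snd _ _, hi2⟩
  have hlift (s : PullbackCone f g) (n : ℕ) : s.pt.incl n ≫ (hW (n + 1)).lift (s.fst.app (n + 1))
      (s.snd.app (n + 1)) (congrArg (fun f => f.app (n + 1)) s.condition) =
      (hW n).lift (s.fst.app n) (s.snd.app n) (congrArg (fun f => f.app n) s.condition) ≫ i n := by
    refine (hW (n + 1)).hom_ext ?_ ?_
    · rw [Category.assoc, Category.assoc, (hW (n + 1)).lift_fst, hi1, (hW n).lift_fst_assoc]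
      exact s.fst.comm n
    · rw [Category.assoc, Category.assoc, (hW (n + 1)).lift_snd, hi2, (hW n).lift_snd_assoc]
      exact s.snd.comm n
  refine ⟨W, a, b, ⟨⟨Hom.ext (funext fun n => (hW n).w)⟩, ⟨PullbackCone.IsLimit.mk _
    (fun s => ⟨fun n => (hW n).lift (s.fst.app n) (s.snd.app n)
      (congrArg (fun f => f.app n) s.condition), hlift s⟩)
      (fun s => Hom.ext (funext fun n => (hW n).lift_fst _ _ _))
      (fun s => Hom.ext (funext fun n => (hW n).lift_snd _ _ _))
      fun s m hm hm' => Hom.ext (funext fun n => (hW n).hom_ext ?_ ?_)⟩⟩, hW⟩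
  · exact (congrArg (fun f => f.app n) hm).trans ((hW n).lift_fst _ _ _).symm
  · exact (congrArg (fun f => f.app n) hm').trans ((hW n).lift_snd _ _ _).symm

/-- By flatness a section killed by `p` is a combination of sections of `D` killed by `p`, and those
vanish one level below. -/
theorem isPTorsionFree_of_flat [Fact p.Prime] {W D : PadicFormalScheme.{u} p} (f : W ⟶ D)
    (hf : ∀ n, Flat (f.app n)) (hD : D.IsPTorsionFree) : W.IsPTorsionFree := by
  refine isPTorsionFree_of_iSup_eq_top (ι := fun n => {V : (D.level (n + 1)).affineOpens ×
      (W.level (n + 1)).affineOpens // V.2.1 ≤ f.app (n + 1) ⁻¹ᵁ V.1.1})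
    (fun n V => V.1.2.1) (fun n V => V.1.2.2) (fun n => ?_) ?_
  · refine top_le_iff.1 fun x _ => TopologicalSpace.Opens.mem_iSup.2 ?_
    obtain ⟨U, hU, hxU, -⟩ := exists_isAffineOpen_mem_and_subset (x := f.app (n + 1) x) (U :=
        ⊤) trivial
    obtain ⟨V, hV, hxV, hVU⟩ := exists_isAffineOpen_mem_and_subset (x := x)
      (U := f.app (n + 1) ⁻¹ᵁ U) hxU
    exact ⟨⟨⟨⟨U, hU⟩, ⟨V, hV⟩⟩, hVU⟩, hxV⟩
  · rintro n ⟨⟨⟨U, hU⟩, ⟨V, hV⟩⟩, hVU⟩ x hx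
    have h1 : ((f.app (n + 1)).appLE U V hVU).hom.Flat :=
      HasRingHomProperty.appLE @Flat _ (hf (n + 1)) ⟨U, hU⟩ ⟨V, hV⟩ hVU
    obtain ⟨k, a, y, h2, h3⟩ := exists_sum_of_flat _ h1 (p : Γ(D.level (n + 1), U)) x (by
      rw [map_natCast]
      exact hx)
    change ((W.incl n).app V).hom x = 0
    rw [h2, map_sum]
    refine Finset.sum_eq_zero fun j _ => ?_
    rw [map_mul, app_appLE_eq_zero _ _ _ _ (f.comm n) hVU (hD.app_eq_zero (h3 j)), zero_mul]

end PadicFormalScheme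
end PrismEnv

/-! ### Functoriality of the envelope -/

namespace PrismEnv

namespace FrobeniusPair

open PadicFormalScheme

variable {p : ℕ} [Fact p.Prime] {P P' : FrobeniusPair.{u} p}

/-- A morphism of prisms over `Y` is determined by its underlying morphism, which is any
`φ`-equivariant morphism over `Y`. -/
theorem Prism.exists_hom {E F : P.Prism} (h : E.T.T ⟶ F.T.T) (hφ : E.T.φ ≫ h = h ≫ F.T.φ)
    (hπ : h ≫ F.π = E.π) : ∃ m : E ⟶ F, m.hom.hom = h := by
  have := P.isClosedImmersion_i
  refine ⟨⟨⟨h, hφ⟩, ?_, hπ⟩, rfl⟩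
  rw [← cancel_mono P.i, Category.assoc, F.comm, E.comm]
  exact congrArg (fun f => f.app 1) hπ

/-- Morphisms to a prismatic envelope are determined by their composition with `π`. -/
theorem Prism.IsPrismaticEnvelope.hom_ext {Δ : P.Prism} (hΔ : Δ.IsPrismaticEnvelope)
    {T : FormalPhiScheme.{u} p} {h h' : T ⟶ Δ.T} (e : h.hom ≫ Δ.π = h'.hom ≫ Δ.π) : h = h' := by
  let E : P.Prism := ⟨T, h.hom.app 1 ≫ Δ.z, h.hom ≫ Δ.π, by
    rw [Category.assoc, Δ.comm]
    rfl, by rw [← Category.assoc, h.comm, Category.assoc, Δ.comm_φ, Category.assoc]⟩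
  obtain ⟨m, hm⟩ := Prism.exists_hom (E := E) (F := Δ) h.hom h.comm rfl
  obtain ⟨m', hm'⟩ := Prism.exists_hom (E := E) (F := Δ) h'.hom h'.comm e.symm
  exact FormalPhiScheme.Hom.ext (hm.symm.trans
    ((congrArg (fun n => n.hom.hom) (hΔ.some.hom_ext m m')).trans hm'))

/-- The prism over `Y` obtained from a prism over `Y'`. -/
def Prism.map (g : FrobeniusPair.Hom P' P) (E : P'.Prism) : P.Prism where
  T := E.T
  z := E.z ≫ g.homX
  π := E.π ≫ g.hom
  comm := by
    rw [Category.assoc, g.comm, ← Category.assoc, E.comm]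
    rfl
  comm_φ := by rw [← Category.assoc, E.comm_φ, Category.assoc, g.comm_ψ, Category.assoc]

/-- The fibre product `W` of the envelope `Δ` with `Y'` is `p`-torsion free by flatness and carries
a prism structure over `Y'`. Finality of `Δ'` gives a morphism from `W` to it, and the uniqueness
properties of `Δ`, `Δ'` and `W` show that it is inverse to the canonical one. -/
theorem isPullback_envelope (g : Hom P' P) {Δ : P.Prism} {Δ' : P'.Prism}
    (hΔ : Δ.IsPrismaticEnvelope) (hΔ' : Δ'.IsPrismaticEnvelope) (hg : IsPCompletelyFlat g.hom)
    (hX : IsPullback g.homX P'.i P.i (g.hom.app 1)) (h : Δ'.T ⟶ Δ.T)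
    (hh : h.hom ≫ Δ.π = Δ'.π ≫ g.hom) : IsPullback h.hom Δ'.π Δ.π g.hom := by
  obtain ⟨W, a, b, hW, hWn⟩ := exists_pullback Δ.π g.hom
  have hWT : W.IsPTorsionFree := isPTorsionFree_of_flat a (fun n => by
    have := hg.2 n
    exact MorphismProperty.of_isPullback (hWn n).flip this) Δ.T.torsionFree
  obtain ⟨φ, hφ1, hφ2⟩ : ∃ φ : W ⟶ W, φ ≫ a = a ≫ Δ.T.φ ∧ φ ≫ b = b ≫ P'.ψ :=
    ⟨hW.lift (a ≫ Δ.T.φ) (b ≫ P'.ψ) (by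
      rw [Category.assoc, Δ.comm_φ, ← Category.assoc, hW.w, Category.assoc, Category.assoc,
        g.comm_ψ]), hW.lift_fst _ _ _, hW.lift_snd _ _ _⟩
  obtain ⟨s, hs1, hs2⟩ : ∃ s : W.level 1 ⟶ P'.X, s ≫ g.homX = a.app 1 ≫ Δ.z ∧ s ≫ P'.i = b.app 1 :=
    ⟨hX.lift (a.app 1 ≫ Δ.z) (b.app 1) (by
      rw [Category.assoc, Δ.comm]
      exact (hWn 1).w), hX.lift_fst _ _ _, hX.lift_snd _ _ _⟩
  -- On the factor `Y'` Frobenius is available only along `X'`. The reduction of `b` factors through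
  -- `X'` because `X'` is the preimage of `X`.
  have hlift : φ.app 1 = absFrob p (W.level 1) W.natCast_level_one := by
    refine (hWn 1).hom_ext ?_ ?_
    · rw [absFrob_naturality _ _ Δ.T.T.natCast_level_one, ← Δ.T.lifts]
      exact congrArg (fun f => f.app 1) hφ1
    · rw [absFrob_naturality _ _ P'.Y.natCast_level_one]
      refine (congrArg (fun f => f.app 1) hφ2).trans ?_
      change b.app 1 ≫ P'.ψ.app 1 = _
      rw [← hs2, Category.assoc, ← P'.restricts, absFrob_naturality _ _ P'.Y.natCast_level_one]
      exact (Category.assoc _ _ _).symm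
  let E : P'.Prism := ⟨⟨W, hWT, φ, hlift⟩, s, b, hs2, hφ2⟩
  let w : E.T ⟶ Δ'.T := (hΔ'.some.from E).hom
  have hw : w.hom ≫ Δ'.π = b := (hΔ'.some.from E).comm_π
  let l : Δ'.T.T ⟶ W := hW.lift h.hom Δ'.π hh
  have hl1 : l ≫ a = h.hom := hW.lift_fst _ _ _
  have hl2 : l ≫ b = Δ'.π := hW.lift_snd _ _ _
  have hl3 : Δ'.T.φ ≫ l = l ≫ φ := by
    refine hW.hom_ext ?_ ?_
    · rw [Category.assoc, Category.assoc, hl1, hφ1, ← Category.assoc, hl1, h.comm]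
    · rw [Category.assoc, Category.assoc, hl2, hφ2, ← Category.assoc, hl2, Δ'.comm_φ]
  let l' : Δ'.T ⟶ E.T := ⟨l, hl3⟩
  have h1 : l' ≫ w = 𝟙 _ := hΔ'.hom_ext (by
    change (l ≫ w.hom) ≫ Δ'.π = 𝟙 _ ≫ Δ'.π
    rw [Category.assoc, hw, hl2, Category.id_comp])
  let a' : E.T ⟶ Δ.T := ⟨a, hφ1⟩
  have h2 : w ≫ h = a' := hΔ.hom_ext (by
    change (w.hom ≫ h.hom) ≫ Δ.π = a ≫ Δ.π
    rw [Category.assoc, hh, ← Category.assoc, hw, hW.w])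
  have h3 : w.hom ≫ l = 𝟙 _ := hW.hom_ext
    (by
      rw [Category.assoc, hl1, Category.id_comp]
      exact congrArg FormalPhiScheme.Hom.hom h2)
    (by rw [Category.assoc, hl2, Category.id_comp, hw])
  exact hW.of_iso ⟨w.hom, l, h3, congrArg FormalPhiScheme.Hom.hom h1⟩ (Iso.refl _) (Iso.refl _)
    (Iso.refl _)
    ((Category.comp_id _).trans (congrArg FormalPhiScheme.Hom.hom h2).symm)
    ((Category.comp_id _).trans hw.symm) ((Category.comp_id _).trans (Category.id_comp _).symm)
    ((Category.comp_id _).trans (Category.id_comp _).symm)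

theorem exists_envelope_map (g : Hom P' P) {Δ : P.Prism} {Δ' : P'.Prism}
    (hΔ : Δ.IsPrismaticEnvelope) (hΔ' : Δ'.IsPrismaticEnvelope) :
    ∃ h : Δ'.T ⟶ Δ.T,
      (h.hom ≫ Δ.π = Δ'.π ≫ g.hom ∧ h.hom.app 1 ≫ Δ.z = Δ'.z ≫ g.homX) ∧
      (∀ h' : Δ'.T ⟶ Δ.T, h'.hom ≫ Δ.π = Δ'.π ≫ g.hom →
        h'.hom.app 1 ≫ Δ.z = Δ'.z ≫ g.homX → h' = h) ∧
      (IsPCompletelyFlat g.hom → IsPullback g.homX P'.i P.i (g.hom.app 1) →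
        IsPullback h.hom Δ'.π Δ.π g.hom) := by
  let m := hΔ.some.from (Δ'.map g)
  have hm : m.hom.hom ≫ Δ.π = Δ'.π ≫ g.hom := m.comm_π
  exact ⟨m.hom, ⟨hm, m.comm_z⟩, fun h' hh' _ => hΔ.hom_ext (hh'.trans hm.symm),
    fun hg hX => isPullback_envelope g hΔ hΔ' hg hX m.hom hm⟩

end FrobeniusPair
end PrismEnv

/-! ### Rigidity of morphisms from a formal `φ`-scheme with trivial `φ` -/

namespace PrismEnv

/-- In the factorization of `x ^ p - y ^ p` by `x - y`, the other factor is congruent to `p * y ^ (p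
- 1)` modulo `p`, so it contributes one more `p`. -/
theorem pow_succ_dvd_pow_sub_pow {R : Type*} [CommRing R] {p : ℕ} {x y : R} {k : ℕ} (hk : k ≠ 0)
    (h : (p : R) ^ k ∣ x - y) : (p : R) ^ (k + 1) ∣ x ^ p - y ^ p := by
  have h1 : (p : R) ∣ x - y := (dvd_pow_self _ hk).trans h
  rw [← (Commute.all x y).geom_sum₂_mul p, pow_succ']
  exact mul_dvd_mul ((dvd_geom_sum₂_iff_of_dvd_sub h1).2 (dvd_mul_right _ _)) h

namespace PadicFormalScheme

variable {p : ℕ}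

/-- The open subset of all points of a formal scheme. -/
def topOpen (Y : PadicFormalScheme.{u} p) : Y.FormalOpen where
  trace _ := ⊤
  preimage_trace _ := rfl

/-- The homomorphism between rings of global sections induced by a morphism. -/
def topMap {T Y : PadicFormalScheme.{u} p} (f : T ⟶ Y) :
    Y.sections Y.topOpen →+* T.sections T.topOpen :=
  sectionsMap f Y.topOpen T.topOpen fun _ => le_top

theorem topMap_coe {T Y : PadicFormalScheme.{u} p} (f : T ⟶ Y) (s : Y.sections Y.topOpen) (n : ℕ) :
    (topMap f s).1 n = (f.app n).appTop.hom (s.1 n) := by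
  have h : (f.app n).appLE ⊤ ⊤ le_top = (f.app n).appTop := (Scheme.Hom.app_eq_appLE _).symm
  exact congrArg (fun g : Γ(Y.level n, ⊤) ⟶ Γ(T.level n, ⊤) => g.hom (s.1 n)) h

theorem topMap_comp {T T' Y : PadicFormalScheme.{u} p} (f : T ⟶ Y) (f' : T' ⟶ T)
    (s : Y.sections Y.topOpen) : topMap (f' ≫ f) s = topMap f' (topMap f s) :=
  (sectionsMap_sectionsMap f f' _ _ _ _ _ s).symm

end PadicFormalScheme

namespace FormalPhiScheme

open PadicFormalScheme

variable {p : ℕ} [Fact p.Prime]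

theorem exists_topMap_φ_eq (D : FormalPhiScheme.{u} p) (d : D.T.sections D.T.topOpen) :
    ∃ e, topMap D.φ d = d ^ p + p * e := by
  obtain ⟨e, he⟩ := D.torsionFree.exists_eq_mul (s := topMap D.φ d - d ^ p) (by
      change (topMap D.φ d).1 1 - d.1 1 ^ p = 0
      rw [topMap_coe, D.lifts]
      exact sub_self (d.1 1 ^ p))
  exact ⟨e, by rw [← he, add_sub_cancel]⟩

/-- Morphisms from a formal `φ`-scheme with trivial `φ` to an affine one are determined by their
reductions modulo `p`. -/
theorem hom_eq_of_app_one_eq {T D : FormalPhiScheme.{u} p} (hT : T.φ = 𝟙 _)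
    (hT1 : IsAffine (T.T.level 1)) (hD : ∀ n, IsAffine (D.T.level n)) {f g : T ⟶ D}
    (h : f.hom.app 1 = g.hom.app 1) : f = g := by
  -- Since `φ` is trivial on `T`, pulling back `topMap D.φ d` is the same as pulling back `d`. The
  -- section `e` does not depend on `f`.
  have hs (f : T ⟶ D) (d e : D.T.sections D.T.topOpen) (hde : topMap D.φ d = d ^ p + p * e) :
      topMap f.hom d = topMap f.hom d ^ p + p * topMap f.hom e := by
    have h1 := congrArg (topMap f.hom) hde
    rwa [← topMap_comp, map_add, map_mul, map_pow, map_natCast, ← f.comm, hT,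
      Category.id_comp] at h1
  have hdvd (k : ℕ) (d) :
      (p : T.T.sections T.T.topOpen) ^ (k + 1) ∣ topMap f.hom d - topMap g.hom d := by
    induction k generalizing d with
    | zero =>
      rw [← coe_eq_zero_iff (isAffineOpen_top _) (0 + 1) (topMap f.hom d - topMap g.hom d)]
      change (topMap f.hom d).1 1 - (topMap g.hom d).1 1 = 0
      rw [sub_eq_zero, topMap_coe, topMap_coe, h]
    | succ k ih =>
      -- The congruence for all sections improves by one power of `p`: the `p`-th powers gain one,
      -- and the terms in `e` carry an explicit factor `p`.
      obtain ⟨e, he⟩ := D.exists_topMap_φ_eq d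
      rw [hs f d e he, hs g d e he, add_sub_add_comm, ← mul_sub]
      refine dvd_add (pow_succ_dvd_pow_sub_pow k.succ_ne_zero (ih d)) ?_
      rw [pow_succ']
      exact mul_dvd_mul_left _ (ih e)
  refine FormalPhiScheme.Hom.ext (PadicFormalScheme.Hom.ext (funext fun n => ?_))
  have := hD n
  refine ext_of_isAffine (CommRingCat.hom_ext (RingHom.ext fun x => ?_))
  obtain ⟨d, rfl⟩ := exists_section_coe_eq (U := D.T.topOpen) (@isAffineOpen_top _ (hD 1)) n x
  have h1 := (coe_eq_zero_iff (isAffineOpen_top _) n (topMap f.hom d - topMap g.hom d)).2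
    ((pow_dvd_pow _ n.le_succ).trans (hdvd n d))
  have h2 : (topMap f.hom d).1 n = (topMap g.hom d).1 n := sub_eq_zero.1 h1
  rwa [topMap_coe, topMap_coe] at h2

end FormalPhiScheme

/-! ### Formal spectra -/

/-- Reduction modulo powers of `p`. -/
noncomputable def powQuot (p n : ℕ) (A : CommRingCat.{u}) : CommRingCat.{u} :=
  .of (A ⧸ Ideal.span {(p : A) ^ n})

/-- The projection to the quotient by a power of `p`. -/
noncomputable def powMk (p n : ℕ) (A : CommRingCat.{u}) : A ⟶ powQuot p n A :=
  CommRingCat.ofHom (Ideal.Quotient.mk _)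

theorem powMk_surjective (p n : ℕ) (A : CommRingCat.{u}) :
    Function.Surjective (powMk p n A).hom := Ideal.Quotient.mk_surjective

theorem powMk_eq_zero_iff {p n : ℕ} {A : CommRingCat.{u}} {a : A} :
    (powMk p n A).hom a = 0 ↔ (p : A) ^ n ∣ a :=
  Ideal.Quotient.eq_zero_iff_mem.trans Ideal.mem_span_singleton

theorem exists_powMap (p : ℕ) {m n : ℕ} (h : m ≤ n) {A B : CommRingCat.{u}} (f : A ⟶ B) :
    ∃ g : powQuot p n A ⟶ powQuot p m B, powMk p n A ≫ g = f ≫ powMk p m B :=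
  ⟨CommRingCat.ofHom (Ideal.Quotient.lift _ (f ≫ powMk p m B).hom fun a ha => by
    obtain ⟨b, rfl⟩ := Ideal.mem_span_singleton.1 ha
    refine powMk_eq_zero_iff.2 ?_
    rw [map_mul, map_pow, map_natCast]
    exact (pow_dvd_pow _ h).trans (dvd_mul_right _ _)), rfl⟩

/-- The homomorphism between quotients by powers of `p`. -/
noncomputable def powMap (p : ℕ) {m n : ℕ} (h : m ≤ n) {A B : CommRingCat.{u}} (f : A ⟶ B) :
    powQuot p n A ⟶ powQuot p m B := (exists_powMap p h f).choose

theorem powMk_comp_powMap (p : ℕ) {m n : ℕ} (h : m ≤ n) {A B : CommRingCat.{u}} (f : A ⟶ B) :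
    powMk p n A ≫ powMap p h f = f ≫ powMk p m B := (exists_powMap p h f).choose_spec

theorem powQuot_hom_ext {p n : ℕ} {A B : CommRingCat.{u}} {f g : powQuot p n A ⟶ B}
    (h : powMk p n A ≫ f = powMk p n A ≫ g) : f = g := by
  ext x
  obtain ⟨a, rfl⟩ := powMk_surjective p n A x
  exact congrArg (fun f : A ⟶ B => f.hom a) h

theorem powMap_apply (p : ℕ) {m n : ℕ} (h : m ≤ n) {A B : CommRingCat.{u}} (f : A ⟶ B) (a : A) :
    (powMap p h f).hom ((powMk p n A).hom a) = (powMk p m B).hom (f.hom a) :=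
  congrArg (fun f : A ⟶ powQuot p m B => f.hom a) (powMk_comp_powMap p h f)

theorem powMap_surjective (p : ℕ) {m n : ℕ} (h : m ≤ n) {A B : CommRingCat.{u}} (f : A ⟶ B)
    (hf : Function.Surjective f.hom) : Function.Surjective (powMap p h f).hom := fun x => by
  obtain ⟨b, rfl⟩ := powMk_surjective p m B x
  obtain ⟨a, rfl⟩ := hf b
  exact ⟨_, powMap_apply p h f a⟩

theorem appTop_SpecMap_eq_zero_iff {A B : CommRingCat.{u}} (f : A ⟶ B) (x : Γ(Spec A, ⊤)) :
    (Spec.map f).appTop.hom x = 0 ↔ f.hom ((Scheme.ΓSpecIso A).hom.hom x) = 0 := by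
  have h := congrArg (fun g => g.hom x) (Scheme.ΓSpecIso_naturality f)
  change (Scheme.ΓSpecIso B).hom.hom ((Spec.map f).appTop.hom x) =
    f.hom ((Scheme.ΓSpecIso A).hom.hom x) at h
  rw [← h]
  exact ((Scheme.ΓSpecIso B).commRingCatIsoToRingEquiv.map_eq_zero_iff).symm

theorem appTop_SpecMap_powMap_eq_zero_iff {p n : ℕ} {A : CommRingCat.{u}}
    (x : Γ(Spec (powQuot p (n + 1) A), ⊤)) :
    (Spec.map (powMap p n.le_succ (𝟙 A))).appTop.hom x = 0 ↔ (p : Γ(Spec (powQuot p (n + 1) A),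
        ⊤)) ^ n ∣ x := by
  let e := (Scheme.ΓSpecIso (powQuot p (n + 1) A)).commRingCatIsoToRingEquiv
  rw [appTop_SpecMap_eq_zero_iff, ← map_dvd_iff e, map_pow, map_natCast]
  change _ ↔ (p : powQuot p (n + 1) A) ^ n ∣ (Scheme.ΓSpecIso (powQuot p (n + 1) A)).hom.hom x
  obtain ⟨a, ha⟩ := powMk_surjective p (n + 1) A ((Scheme.ΓSpecIso (powQuot p (n + 1) A)).hom.hom x)
  rw [← ha, powMap_apply, powMk_eq_zero_iff]
  constructor
  · rintro ⟨b, hb⟩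
    refine ⟨(powMk p (n + 1) A).hom b, ?_⟩
    rw [← map_natCast (powMk p (n + 1) A).hom, ← map_pow, ← map_mul, ← hb]
    rfl
  · rintro ⟨b, hb⟩
    obtain ⟨b, rfl⟩ := powMk_surjective p (n + 1) A b
    rw [← map_natCast (powMk p (n + 1) A).hom, ← map_pow, ← map_mul, ← sub_eq_zero, ← map_sub,
      powMk_eq_zero_iff] at hb
    exact (dvd_iff_dvd_of_dvd_sub ((pow_dvd_pow _ n.le_succ).trans hb)).2 (dvd_mul_right _ _)

theorem appTop_SpecMap_powMap_eq_zero_of_mul {p n : ℕ} {A : CommRingCat.{u}}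
    (hA : ∀ a : A, p * a = 0 → a = 0) {x : Γ(Spec (powQuot p (n + 1) A), ⊤)} (hx : p * x = 0) :
    (Spec.map (powMap p n.le_succ (𝟙 A))).appTop.hom x = 0 := by
  rw [appTop_SpecMap_eq_zero_iff]
  obtain ⟨a, ha⟩ := powMk_surjective p (n + 1) A ((Scheme.ΓSpecIso (powQuot p (n + 1) A)).hom.hom x)
  have h1 := congrArg (Scheme.ΓSpecIso (powQuot p (n + 1) A)).hom.hom hx
  rw [map_mul, map_natCast, map_zero, ← ha, ← map_natCast (powMk p (n + 1) A).hom, ← map_mul,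
    powMk_eq_zero_iff] at h1
  rw [← ha, powMap_apply, powMk_eq_zero_iff]
  obtain ⟨b, hb⟩ := h1
  refine ⟨b, sub_eq_zero.1 (hA _ ?_)⟩
  change p * (a - p ^ n * b) = 0
  linear_combination hb

namespace PadicFormalScheme

variable (p : ℕ)

/-- The formal spectrum of the `p`-adic completion of a ring. -/
noncomputable def spf (A : CommRingCat.{u}) : PadicFormalScheme.{u} p where
  level n := Spec (powQuot p n A)
  incl n := Spec.map (powMap p n.le_succ (𝟙 A))
  isClosedImmersion_incl n := IsClosedImmersion.spec_of_surjective _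
    (powMap_surjective p n.le_succ (𝟙 A) Function.surjective_id)
  pow_eq_zero n := by
    refine (Scheme.ΓSpecIso (powQuot p n A)).commRingCatIsoToRingEquiv.injective ?_
    rw [map_pow, map_natCast, map_zero]
    have := (powMk_eq_zero_iff (p := p) (n := n) (A := A)).2 (dvd_refl _)
    rwa [map_pow, map_natCast] at this
  ker_incl n := by
    rw [← ker_eq_powIdeal_iff]
    refine Scheme.IdealSheafData.ext_of_isAffine ?_
    rw [powIdeal_ideal, Scheme.Hom.ker_apply]
    ext x
    rw [RingHom.mem_ker, Ideal.mem_span_singleton]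
    exact appTop_SpecMap_powMap_eq_zero_iff x

/-- The morphism of formal spectra induced by a homomorphism of rings. -/
noncomputable def spfMap {A B : CommRingCat.{u}} (f : A ⟶ B) : spf p B ⟶ spf p A where
  app n := Spec.map (powMap p le_rfl f)
  comm n := by
    change Spec.map _ ≫ Spec.map _ = Spec.map _ ≫ Spec.map _
    rw [← Spec.map_comp, ← Spec.map_comp]
    refine congrArg Spec.map (powQuot_hom_ext ?_)
    rw [← Category.assoc, ← Category.assoc, powMk_comp_powMap, powMk_comp_powMap, Category.assoc,
      Category.assoc, powMk_comp_powMap, powMk_comp_powMap, Category.id_comp]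
    rfl

theorem spf_isPTorsionFree (A : CommRingCat.{u}) (hA : ∀ a : A, p * a = 0 → a = 0) :
    (spf p A).IsPTorsionFree := by
  refine isPTorsionFree_of_iSup_eq_top (ι := fun _ => Unit) (fun _ _ => ⊤)
    (fun n _ => @isAffineOpen_top _ (inferInstanceAs (IsAffine (Spec _)))) (fun n => iSup_const) ?_
  intro n _ x hx
  exact appTop_SpecMap_powMap_eq_zero_of_mul hA hx

end PadicFormalScheme
end PrismEnv

/-! ### An envelope which is not of finite type -/

namespace PrismEnv

/-- A section is determined by its values on finitely many generators, and these lie in a finite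
ring. -/
theorem finite_section_of_finiteType {R S : Type*} [CommRing R] [CommRing S] [Finite R] (f : R →+* S)
    (hf : f.FiniteType) : Finite {g : S →+* R // g.comp f = RingHom.id R} := by
  algebraize [f]
  obtain ⟨s, hs⟩ := Algebra.FiniteType.out (R := R) (A := S)
  refine Finite.of_injective (β := s → R) (fun g x => g.1 x) fun g g' h => ?_
  have key (g : {g : S →+* R // g.comp f = RingHom.id R}) :
      ∃ g' : S →ₐ[R] R, ∀ x, g' x = g.1 x :=
    ⟨{ g.1 with commutes' := fun r => congrArg (fun f : R →+* R => f r) g.2 }, fun _ => rfl⟩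
  obtain ⟨k, hk⟩ := key g
  obtain ⟨k', hk'⟩ := key g'
  have : k = k' := AlgHom.ext_of_adjoin_eq_top hs fun x hx => by
    rw [hk, hk']
    exact congrFun h ⟨x, hx⟩
  refine Subtype.ext (RingHom.ext fun x => ?_)
  rw [← hk, ← hk', this]

theorem finite_section_of_locallyOfFiniteType {D X : Scheme.{u}} [IsAffine D] [IsAffine X]
    (hX : Finite Γ(X, ⊤)) (z : D ⟶ X) (hz : LocallyOfFiniteType z) :
    Finite {s : X ⟶ D // s ≫ z = 𝟙 X} := by
  have h1 : z.appTop.hom.FiniteType :=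
    (HasRingHomProperty.iff_of_isAffine (P := @LocallyOfFiniteType)).1 hz
  have := finite_section_of_finiteType _ h1
  refine Finite.of_injective (β := {g : Γ(D, ⊤) →+* Γ(X, ⊤) // g.comp z.appTop.hom = RingHom.id _})
    (fun s => ⟨s.1.appTop.hom, ?_⟩) fun s s' h => ?_
  · exact (congrArg CommRingCat.Hom.hom (Scheme.Hom.comp_appTop s.1 z)).symm.trans
      (congrArg (fun f : X ⟶ X => f.appTop.hom) s.2)
  · exact Subtype.ext (ext_of_isAffine (CommRingCat.hom_ext (congrArg Subtype.val h)))

theorem eq_of_forall_pow_dvd_sub {p : ℕ} (hp : 1 < p) {a b : ULift.{u} ℤ}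
    (h : ∀ n, (p : ULift.{u} ℤ) ^ n ∣ a - b) : a = b := by
  refine ULift.ext _ _ (sub_eq_zero.1 ?_)
  -- The absolute value itself serves as exponent, because `p ^ k > k`.
  obtain ⟨c, hc⟩ := h (a.down - b.down).natAbs
  have h1 : (p : ℤ) ^ (a.down - b.down).natAbs ∣ a.down - b.down :=
    ⟨c.down, by simpa using congrArg ULift.down hc⟩
  refine Int.eq_zero_of_abs_lt_dvd h1 ?_
  rw [Int.abs_eq_natAbs]
  exact_mod_cast Nat.lt_pow_self hp

theorem eq_zero_of_natCast_mul {p : ℕ} (hp : p ≠ 0) {a : ULift.{u} ℤ} (h : p * a = 0) : a = 0 :=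
  ULift.ext _ _ ((mul_eq_zero.1 (congrArg ULift.down h)).resolve_left (Nat.cast_ne_zero.2 hp))

theorem polynomial_eq_zero_of_natCast_mul {p : ℕ} (hp : p ≠ 0) {f : Polynomial (ULift.{u} ℤ)}
    (h : p * f = 0) : f = 0 :=
  Polynomial.ext fun n => eq_zero_of_natCast_mul hp (by
    rw [← Polynomial.coeff_natCast_mul, h, Polynomial.coeff_zero])

variable (p : ℕ)

theorem exists_natCast_powMk_eq (hp : p ≠ 0) (x : powQuot p 1 (.of (ULift.{u} ℤ))) :
    ∃ k : Fin p, x = (k : ℕ) := by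
  obtain ⟨a, rfl⟩ := powMk_surjective p 1 _ x
  have hp' : (p : ℤ) ≠ 0 := by exact_mod_cast hp
  have h1 := Int.emod_nonneg a.down hp'
  have h2 := Int.emod_lt_of_pos a.down (by omega : (0 : ℤ) < p)
  refine ⟨⟨(a.down % p).toNat, by omega⟩, ?_⟩
  rw [← map_natCast (powMk p 1 (.of (ULift.{u} ℤ))).hom, ← sub_eq_zero, ← map_sub, powMk_eq_zero_iff]
  refine ⟨⟨a.down / p⟩, ULift.ext _ _ ?_⟩
  have h3 := Int.emod_add_mul_ediv a.down p
  have h4 : (((a.down % p).toNat : ℕ) : ℤ) = a.down % p := Int.toNat_of_nonneg h1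
  change a.down - (((a.down % p).toNat : ℕ) : ℤ) = (p : ℤ) ^ 1 * (a.down / p)
  rw [h4]
  linear_combination -h3

/-- Evaluation of integral polynomials. -/
noncomputable def evalInt (a : ULift.{u} ℤ) :
    CommRingCat.of (Polynomial (ULift.{u} ℤ)) ⟶ CommRingCat.of (ULift.{u} ℤ) :=
  CommRingCat.ofHom (Polynomial.evalRingHom a)

theorem powMap_evalInt_eq_iff {p n : ℕ} {a b : ULift.{u} ℤ} :
    powMap p (le_refl n) (evalInt a) = powMap p (le_refl n) (evalInt b) ↔
      (p : ULift.{u} ℤ) ^ n ∣ a - b := by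
  constructor
  · intro h
    have h1 := congrArg (fun f => (powMk p n _ ≫ f).hom Polynomial.X) h
    simp only [powMk_comp_powMap] at h1
    have h2 : (powMk p n (.of (ULift.{u} ℤ))).hom (a - b) = 0 := by
      rw [map_sub, sub_eq_zero]
      simpa [evalInt] using h1
    exact powMk_eq_zero_iff.1 h2
  · intro h
    refine powQuot_hom_ext ?_
    rw [powMk_comp_powMap, powMk_comp_powMap]
    refine CommRingCat.hom_ext (RingHom.ext fun f : Polynomial (ULift.{u} ℤ) => ?_)
    refine sub_eq_zero.1 ?_
    change (powMk p n (.of (ULift.{u} ℤ))).hom (f.eval a)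
        - (powMk p n (.of (ULift.{u} ℤ))).hom (f.eval b) = 0
    rw [← map_sub, powMk_eq_zero_iff]
    exact h.trans (Polynomial.sub_dvd_eval_sub a b f)

namespace FrobeniusPair

open PadicFormalScheme

variable [hp : Fact p.Prime]

theorem pow_eq_self_powQuot (x : powQuot p 1 (.of (ULift.{u} ℤ))) : x ^ p = x := by
  obtain ⟨k, rfl⟩ := exists_natCast_powMk_eq p hp.out.ne_zero x
  obtain ⟨c, hc⟩ := (ZMod.intCast_zmod_eq_zero_iff_dvd ((k : ℕ) ^ p - (k : ℕ) : ℤ) p).1 (by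
    push_cast
    rw [ZMod.pow_card, sub_self])
  have h1 := (powMk_eq_zero_iff (p := p) (n := 1) (A := .of (ULift.{u} ℤ))
    (a := ((k : ℕ) : ULift.{u} ℤ) ^ p - (k : ℕ))).2 ⟨⟨c⟩, ULift.ext _ _ (by
      rw [pow_one]
      exact hc)⟩
  rwa [map_sub, map_pow, map_natCast, sub_eq_zero] at h1

theorem pow_eq_self_spec (x : Γ(Spec (powQuot p 1 (.of (ULift.{u} ℤ))), ⊤)) : x ^ p = x := by
  refine (Scheme.ΓSpecIso (powQuot p 1 (.of (ULift.{u} ℤ)))).commRingCatIsoToRingEquiv.injective ?_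
  rw [map_pow, pow_eq_self_powQuot]

theorem absFrob_spf_eq_id (h) :
    absFrob p ((spf.{u} p (.of (ULift.{u} ℤ))).level 1) h = 𝟙 _ := by
  refine @ext_of_isAffine _ _ (inferInstanceAs (IsAffine (Spec _)))
      _ _ (CommRingCat.hom_ext (RingHom.ext fun x => ?_))
  exact pow_eq_self_spec p x

/-- The origin of the formal affine line over `ℤ_p`, with trivial endomorphism. -/
noncomputable def originInLine : FrobeniusPair.{u} p where
  Y := spf p (.of (Polynomial (ULift.{u} ℤ)))
  torsionFree := spf_isPTorsionFree p _ fun _ h =>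
    polynomial_eq_zero_of_natCast_mul hp.out.ne_zero h
  X := (spf p (.of (ULift.{u} ℤ))).level 1
  i := (spfMap p (evalInt 0)).app 1
  isClosedImmersion_i := IsClosedImmersion.spec_of_surjective _
    (powMap_surjective p le_rfl _ fun a => ⟨Polynomial.C a, Polynomial.eval_C⟩)
  ψ := 𝟙 _
  restricts := by
    rw [absFrob_spf_eq_id]
    exact (Category.id_comp _).trans (Category.comp_id _).symm

/-- The formal spectrum of `ℤ_p` as a formal `φ`-scheme. -/
noncomputable def spfInt : FormalPhiScheme.{u} p where
  T := spf p (.of (ULift.{u} ℤ))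
  torsionFree := spf_isPTorsionFree p _ fun _ h =>
    eq_zero_of_natCast_mul hp.out.ne_zero h
  φ := 𝟙 _
  lifts := (absFrob_spf_eq_id p _).symm

/-- The point of the formal affine line with coordinate `p * a`. -/
noncomputable def pointPrism (a : ULift.{u} ℤ) : (originInLine.{u} p).Prism where
  T := spfInt p
  z := 𝟙 _
  π := spfMap p (evalInt (p * a))
  -- All these points reduce to the origin modulo `p`, as `0 - p * a = p * (-a)`.
  comm := (Category.id_comp _).trans (congrArg Spec.map ((powMap_evalInt_eq_iff).2
    ⟨-a, by rw [pow_one, zero_sub, mul_neg]⟩))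
  comm_φ := (Category.id_comp _).trans (Category.comp_id _).symm

/-- Each point prism yields a section of `z`; infinitely many distinct sections contradict finite
type over the finite ring of functions on `X`. -/
theorem not_locallyOfFiniteType {Δ : (originInLine.{u} p).Prism} (hΔ : Δ.IsPrismaticEnvelope)
    (haff : IsAffineMorphism Δ.π) : ¬ LocallyOfFiniteType Δ.z := by
  intro hz
  have hD (n : ℕ) : IsAffine (Δ.T.T.level n) :=
    have h1 := haff n
    have h2 : IsAffine ((originInLine.{u} p).Y.level n) :=
        inferInstanceAs (IsAffine (Spec (powQuot p n _)))
    isAffine_of_isAffineHom (Δ.π.app n)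
  have := hD 1
  have hX : IsAffine (originInLine.{u} p).X := inferInstanceAs (IsAffine (Spec _))
  have hfin : Finite Γ((originInLine.{u} p).X, ⊤) := by
    refine Finite.of_surjective (fun k : Fin p => ((k : ℕ) : Γ((originInLine.{u} p).X,
        ⊤))) fun x => ?_
    obtain ⟨k, hk⟩ := exists_natCast_powMk_eq p hp.out.ne_zero ((Scheme.ΓSpecIso (powQuot p 1 (.of (ULift.{u} ℤ)))).commRingCatIsoToRingEquiv x)
    refine ⟨k, (Scheme.ΓSpecIso (powQuot p 1 (.of (ULift.{u} ℤ)))).commRingCatIsoToRingEquiv.injective ?_⟩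
    rw [hk]
    exact map_natCast _ _
  have hfin2 := finite_section_of_locallyOfFiniteType hfin Δ.z hz
  let m (a : ULift.{u} ℤ) : pointPrism p a ⟶ Δ := hΔ.some.from _
  let s (a : ULift.{u} ℤ) : {s : (originInLine.{u} p).X ⟶ Δ.T.T.level 1 // s ≫ Δ.z = 𝟙 _} :=
    ⟨(m a).hom.hom.app 1, (m a).comm_z⟩
  refine not_injective_infinite_finite s fun a b hab => ?_
  -- Equal sections are equal reductions modulo `p`, so the morphisms agree by rigidity. Projecting
  -- to the line then gives `p * a` and `p * b` equal modulo every power of `p`.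
  have h1 : (m a).hom = (m b).hom := FormalPhiScheme.hom_eq_of_app_one_eq (T := spfInt p) rfl
    (inferInstanceAs (IsAffine (Spec _))) hD (congrArg Subtype.val hab)
  have h2 : spfMap p (evalInt (p * a)) = spfMap p (evalInt (p * b)) :=
    (m a).comm_π.symm.trans ((congrArg (fun f : spfInt p ⟶ Δ.T => f.hom ≫ Δ.π) h1).trans (m b).comm_π)
  have h3 : (p : ULift.{u} ℤ) * a = p * b := eq_of_forall_pow_dvd_sub hp.out.one_lt fun n =>
    (powMap_evalInt_eq_iff).1 (Spec.map_injective (congrArg (fun f => f.app n) h2))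
  refine ULift.ext _ _ (mul_left_cancel₀ (Int.natCast_ne_zero.2 hp.out.ne_zero) ?_)
  exact congrArg ULift.down h3

theorem exists_envelope_not_isOfFiniteType :
    ∃ (P : FrobeniusPair.{u} p) (Δ : P.Prism), Δ.IsPrismaticEnvelope ∧ ¬ IsOfFiniteType Δ.π ∧
      ¬ (LocallyOfFiniteType Δ.z ∧ QuasiCompact Δ.z) := by
  obtain ⟨W⟩ := nonempty_frobeniusTower (originInLine.{u} p)
  obtain ⟨Δ, -, hΔ, haff, -⟩ := W.exists_envelope
  have h := not_locallyOfFiniteType p hΔ haff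
  refine ⟨_, Δ, hΔ, fun h1 => h ?_, fun h1 => h h1.1⟩
  have h2 := (h1 1).1
  rw [← Δ.comm] at h2
  exact locallyOfFiniteType_of_comp _ (originInLine.{u} p).i

end FrobeniusPair
end PrismEnv

/-! ### Polynomial rings modulo equations with leading forms `X i ^ p` -/

namespace PrismEnv

/-- The map `1 - T` lowers an exhaustive filtration starting at zero, so it is locally nilpotent. -/
theorem bijective_of_locallyNilpotent {R M : Type*} [CommRing R] [AddCommGroup M] [Module R M]
    (T : M →ₗ[R] M) (F : ℕ → Submodule R M) (h0 : F 0 = ⊥) (hF : ∀ m, ∃ n, m ∈ F n)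
    (h : ∀ n, ∀ m ∈ F (n + 1), m - T m ∈ F n) : Function.Bijective T := by
  have h0' {m : M} (hm : m ∈ F 0) : m = 0 := by rwa [h0, Submodule.mem_bot] at hm
  constructor
  · rw [injective_iff_map_eq_zero]
    intro m hm
    obtain ⟨n, hn⟩ := hF m
    induction n with
    | zero => exact h0' hn
    | succ n ih => exact ih (by simpa [hm] using h n m hn)
  · intro m
    obtain ⟨n, hn⟩ := hF m
    induction n generalizing m with
    | zero => exact ⟨0, by rw [h0' hn, map_zero]⟩
    | succ n ih =>
      obtain ⟨x, hx⟩ := ih _ (h n m hn)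
      exact ⟨x + m, by rw [map_add, hx, sub_add_cancel]⟩

namespace MvPoly

open MvPolynomial

variable {σ C : Type*} [CommRing C]

/-- Polynomials of degree less than `n`. -/
noncomputable def degLT (σ C : Type*) [CommRing C] (n : ℕ) : Submodule C (MvPolynomial σ C) :=
  restrictSupport C {γ : σ →₀ ℕ | γ.degree < n}

theorem mem_degLT {n : ℕ} {f : MvPolynomial σ C} :
    f ∈ degLT σ C n ↔ ∀ γ ∈ f.support, γ.degree < n := by
  rw [degLT, mem_restrictSupport_iff]
  rfl

theorem mul_mem_degLT {a b : ℕ} {f g : MvPolynomial σ C} (hf : f ∈ degLT σ C (a + 1))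
    (hg : g ∈ degLT σ C b) : f * g ∈ degLT σ C (a + b) := by
  classical
  rw [mem_degLT] at *
  intro γ hγ
  obtain ⟨α, hα, β, hβ, rfl⟩ := Finset.mem_add.1 (support_mul f g hγ)
  have h1 := hf α hα
  have h2 := hg β hβ
  rw [map_add]
  omega

theorem degLT_mono {a b : ℕ} (h : a ≤ b) : degLT σ C a ≤ degLT σ C b := fun f hf => by
  rw [mem_degLT] at *
  exact fun γ hγ => (hf γ hγ).trans_le h

/-- Polynomials of degree at most `n` with the same component of degree `n`. -/
def SameLead (n : ℕ) (f g : MvPolynomial σ C) : Prop :=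
  f ∈ degLT σ C (n + 1) ∧ f - g ∈ degLT σ C n

theorem SameLead.mul {a b : ℕ} {f f' g g' : MvPolynomial σ C} (h : SameLead a f f')
    (h' : SameLead b g g') : SameLead (a + b) (f * g) (f' * g') := by
  refine ⟨by simpa [add_assoc] using mul_mem_degLT h.1 h'.1, ?_⟩
  have h1 : f' ∈ degLT σ C (a + 1) := by
    have := sub_mem h.1 (degLT_mono a.le_succ h.2)
    rwa [sub_sub_cancel] at this
  have h2 := mul_mem_degLT h'.1 h.2
  have h3 := mul_mem_degLT h1 h'.2
  rw [add_comm] at h2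
  have := add_mem h2 h3
  convert this using 1
  ring

theorem sameLead_one : SameLead (σ := σ) (C := C) 0 1 1 := by
  refine ⟨?_, by simp⟩
  rw [mem_degLT]
  intro γ hγ
  have : γ = 0 := by
    classical
    by_contra h
    rw [mem_support_iff, coeff_one, if_neg (Ne.symm h)] at hγ
    exact hγ rfl
  simp [this]

theorem SameLead.pow {a : ℕ} {f f' : MvPolynomial σ C} (h : SameLead a f f') (n : ℕ) :
    SameLead (a * n) (f ^ n) (f' ^ n) := by
  induction n with
  | zero => simpa using sameLead_one
  | succ n ih =>
    rw [pow_succ, pow_succ, mul_add, mul_one]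
    exact ih.mul h

theorem SameLead.prod {ι : Type*} (s : Finset ι) {a : ι → ℕ} {f f' : ι → MvPolynomial σ C}
    (h : ∀ i, SameLead (a i) (f i) (f' i)) :
    SameLead (∑ i ∈ s, a i) (∏ i ∈ s, f i) (∏ i ∈ s, f' i) := by
  classical
  induction s using Finset.induction_on with
  | empty => simpa using sameLead_one
  | insert i s hi ih =>
    rw [Finset.sum_insert hi, Finset.prod_insert hi, Finset.prod_insert hi]
    exact (h i).mul ih

theorem sameLead_X (i : σ) : SameLead (C := C) 1 (X i) (X i) := by
  refine ⟨?_, by simp⟩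
  rw [mem_degLT]
  intro γ hγ
  have : γ = Finsupp.single i 1 := by
    classical
    by_contra h
    rw [mem_support_iff, coeff_X, if_neg (Ne.symm h)] at hγ
    exact hγ rfl
  simp [this]

variable [Fintype σ] (p : ℕ) (g : σ → MvPolynomial σ C)

/-- The family of products of powers of the `g i` and monomials of degree less than `p`. -/
noncomputable def prodFamily (γ : σ →₀ ℕ) : MvPolynomial σ C :=
  ∏ i, (g i ^ (γ i / p) * X i ^ (γ i % p))

variable {p g}

/-- In each variable divide the exponent by `p` with remainder and replace `X i ^ p` by `g i`, which
has the same leading form. -/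
theorem sameLead_prodFamily (hg : ∀ i, SameLead p (X i ^ p) (g i)) (γ : σ →₀ ℕ) :
    SameLead γ.degree (monomial γ 1) (prodFamily p g γ) := by
  have h (i : σ) : SameLead (γ i) (X i ^ γ i) (g i ^ (γ i / p) * X i ^ (γ i % p)) := by
    have h1 := ((hg i).pow (γ i / p)).mul ((sameLead_X (C := C) i).pow (γ i % p))
    rwa [← pow_mul, ← pow_add, one_mul, Nat.div_add_mod] at h1
  have h2 := SameLead.prod Finset.univ h
  rw [← Finsupp.degree_eq_sum] at h2
  rw [monomial_eq, C_1, one_mul, Finsupp.prod_fintype _ _ fun i => pow_zero _]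
  exact h2

/-- The map taking monomials to the members of the family is the identity up to terms of lower
degree. -/
theorem bijective_constr_prodFamily (hg : ∀ i, SameLead p (X i ^ p) (g i)) :
    Function.Bijective ((basisMonomials σ C).constr C (prodFamily p g)) := by
  refine bijective_of_locallyNilpotent _ (degLT σ C) ?_ (fun f => ⟨f.totalDegree + 1,
      ?_⟩) fun n f hf => ?_
  · refine (Submodule.eq_bot_iff _).2 fun f hf => ?_
    rw [mem_degLT] at hf
    exact support_eq_empty.1 (Finset.eq_empty_of_forall_notMem fun γ hγ => Nat.not_lt_zero _ (hf γ hγ))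
  · rw [mem_degLT]
    exact fun γ hγ => Nat.lt_succ_of_le (le_totalDegree hγ)
  · have h1 : f - (basisMonomials σ C).constr C (prodFamily p g) f =
        ∑ γ ∈ f.support, f.coeff γ • (monomial γ 1 - prodFamily p g γ) := by
      conv_lhs => rw [f.as_sum, map_sum, ← Finset.sum_sub_distrib]
      refine Finset.sum_congr rfl fun γ _ => ?_
      have h2 : monomial γ (f.coeff γ) = f.coeff γ • basisMonomials σ C γ := by
        simp [smul_monomial]
      rw [h2, map_smul, Module.Basis.constr_basis, smul_sub, coe_basisMonomials]
    rw [h1]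
    refine sum_mem fun γ hγ => Submodule.smul_mem _ _ ?_
    exact degLT_mono (Nat.lt_succ_iff.1 (mem_degLT.1 hf γ hγ)) (sameLead_prodFamily hg γ).2

theorem exists_basis_prodFamily (hg : ∀ i, SameLead p (X i ^ p) (g i)) :
    ∃ b : Module.Basis (σ →₀ ℕ) C (MvPolynomial σ C), ∀ γ, b γ = prodFamily p g γ :=
  ⟨(basisMonomials σ C).map (LinearEquiv.ofBijective _ (bijective_constr_prodFamily hg)),
    fun γ => by rw [Module.Basis.map_apply, LinearEquiv.ofBijective_apply, Module.Basis.constr_basis]⟩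

theorem mul_prodFamily (hp : 0 < p) (i : σ) (γ : σ →₀ ℕ) :
    g i * prodFamily p g γ = prodFamily p g (γ + Finsupp.single i p) := by
  classical
  have h1 : g i = ∏ j, if j = i then g j else 1 := by simp
  rw [prodFamily, prodFamily]
  nth_rw 1 [h1]
  rw [← Finset.prod_mul_distrib]
  refine Finset.prod_congr rfl fun j _ => ?_
  by_cases h : j = i
  · subst h
    simp [Nat.add_div_right _ hp, pow_succ', mul_assoc]
  · simp [h, Finsupp.single_eq_of_ne h]

section Basis

variable {b : Module.Basis (σ →₀ ℕ) C (MvPolynomial σ C)}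

theorem repr_mul (hp : 0 < p) (hb : ∀ γ, b γ = prodFamily p g γ) (i : σ) (f : MvPolynomial σ C) :
    b.repr (g i * f) = (b.repr f).mapDomain (· + Finsupp.single i p) := by
  have h : b.repr.toLinearMap ∘ₗ LinearMap.mulLeft C (g i) =
      Finsupp.lmapDomain C C (· + Finsupp.single i p) ∘ₗ b.repr.toLinearMap := by
    refine b.ext fun γ => ?_
    simp only [LinearMap.comp_apply, LinearMap.mulLeft_apply, LinearEquiv.coe_coe,
      Finsupp.lmapDomain_apply, b.repr_self, Finsupp.mapDomain_single]
    rw [hb, mul_prodFamily hp, ← hb, b.repr_self]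
  exact congrArg (fun l : MvPolynomial σ C →ₗ[C] (σ →₀ ℕ) →₀ C => l f) h

/-- Multiplication by `g i` permutes the basis `b` injectively by raising the `i`-th exponent by
`p`, so the ideal is spanned by the basis vectors which are such multiples. -/
theorem mem_span_iff (hp : 0 < p) (hb : ∀ γ, b γ = prodFamily p g γ) (S : Set σ)
    {f : MvPolynomial σ C} :
    f ∈ Ideal.span (g '' S) ↔ ∀ γ, b.repr f γ ≠ 0 → ∃ i ∈ S, p ≤ γ i := by
  classical
  constructor
  · intro hf
    induction hf using Submodule.closure_induction with
    | zero => simp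
    | add x y _ _ hx hy =>
      intro γ hγ
      by_cases h : b.repr x γ = 0
      · exact hy γ (by simpa [h] using hγ)
      · exact hx γ h
    | smul_mem r x hx =>
      obtain ⟨i, hi, rfl⟩ := hx
      intro γ hγ
      rw [smul_eq_mul, mul_comm, repr_mul hp hb, ← Finsupp.mem_support_iff] at hγ
      obtain ⟨γ', -, rfl⟩ := Finset.mem_image.1 (Finsupp.mapDomain_support hγ)
      exact ⟨i, hi, by simp⟩
  · intro h
    rw [← b.linearCombination_repr f, Finsupp.linearCombination_apply]
    refine sum_mem fun γ hγ => ?_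
    obtain ⟨i, hi, hγi⟩ := h γ (Finsupp.mem_support_iff.1 hγ)
    have h1 : γ - Finsupp.single i p + Finsupp.single i p = γ :=
      tsub_add_cancel_of_le (Finsupp.single_le_iff.2 hγi)
    have h2 : b γ = g i * prodFamily p g (γ - Finsupp.single i p) := by
      rw [mul_prodFamily hp, h1, hb]
    dsimp only
    rw [h2]
    exact Submodule.smul_of_tower_mem _ _
      (Ideal.mul_mem_right _ _ (Ideal.subset_span ⟨i, hi, rfl⟩))

/-- Multiplication by `g i` shifts only the `i`-th exponent, whereas membership in the ideal depends
only on exponents with index in `S`. -/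
theorem mem_span_of_mul_mem (hp : 0 < p) (hg : ∀ i, SameLead p (X i ^ p) (g i)) {S : Set σ} {i : σ}
    (hi : i ∉ S) {f : MvPolynomial σ C} (hf : g i * f ∈ Ideal.span (g '' S)) :
    f ∈ Ideal.span (g '' S) := by
  obtain ⟨b, hb⟩ := exists_basis_prodFamily hg
  rw [mem_span_iff hp hb] at hf ⊢
  intro γ hγ
  obtain ⟨j, hj, hγj⟩ := hf (γ + Finsupp.single i p) (by
    rwa [repr_mul hp hb, Finsupp.mapDomain_apply (add_left_injective _)])
  refine ⟨j, hj, ?_⟩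
  have : j ≠ i := fun h => hi (h ▸ hj)
  simpa [Finsupp.single_eq_of_ne this] using hγj

/-- The quotient is free over `C` on the basis vectors all of whose exponents are less than `p`; as
`p` is positive, the exponent zero is among them. -/
theorem faithfullyFlat_of_ker_eq_span (hp : 0 < p) (hg : ∀ i, SameLead p (X i ^ p) (g i))
    {S : Type*} [CommRing S] (φ : MvPolynomial σ C →+* S) (hφ : Function.Surjective φ)
    (hk : RingHom.ker φ = Ideal.span (Set.range g))
        : (φ.comp (MvPolynomial.C : C →+* MvPolynomial σ C)).FaithfullyFlat := by
  obtain ⟨b, hb⟩ := exists_basis_prodFamily hg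
  let s : Set (σ →₀ ℕ) := {γ | ∀ i, γ i < p}
  have : Nonempty s := ⟨⟨0, fun i => hp⟩⟩
  let l : MvPolynomial σ C →ₗ[C] (s →₀ C) := Finsupp.lsubtypeDomain s ∘ₗ b.repr.toLinearMap
  have hl : Function.Surjective l := by
    intro f
    obtain ⟨x, hx⟩ := b.repr.surjective (f.mapDomain Subtype.val)
    refine ⟨x, Finsupp.ext fun γ => ?_⟩
    change b.repr x γ.1 = f γ
    rw [hx]
    exact Finsupp.mapDomain_apply Subtype.val_injective f γ
  have hlk (f) : l f = 0 ↔ φ f = 0 := by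
    rw [← RingHom.mem_ker, hk, ← Set.image_univ, mem_span_iff hp hb]
    constructor
    · intro h γ hγ
      by_contra! h1
      exact hγ (DFunLike.congr_fun h ⟨γ, fun i => h1 i trivial⟩)
    · intro h
      ext ⟨γ, hγ⟩
      by_contra! h1
      obtain ⟨i, -, hi⟩ := h γ h1
      exact absurd (hγ i) (not_lt.2 hi)
  algebraize [φ.comp (MvPolynomial.C : C →+* MvPolynomial σ C)]
  let φ' : MvPolynomial σ C →ₐ[C] S := { φ with commutes' := fun _ => rfl }
  let e : S ≃ₗ[C] (s →₀ C) := (φ'.toLinearMap.quotKerEquivOfSurjective hφ).symm ≪≫ₗ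
    Submodule.quotEquivOfEq _ _ (by ext f; exact (hlk f).symm) ≪≫ₗ l.quotKerEquivOfSurjective hl
  exact Module.FaithfullyFlat.of_linearEquiv _ _ e

end Basis

/-- Since `p ≥ 2`, the affine linear terms have degree less than `p`. -/
theorem sameLead_of_linear (hp : 2 ≤ p) (a : σ → σ → C) (c : σ → C) (i : σ) :
    SameLead p (X i ^ p) (X i ^ p - ∑ j, MvPolynomial.C (a i j) * X j - MvPolynomial.C (c i)) := by
  have h1 := (sameLead_X (C := C) i).pow p
  rw [one_mul] at h1
  have hC (c : C) : MvPolynomial.C c ∈ degLT σ C 1 := by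
    rw [show (MvPolynomial.C c : MvPolynomial σ C) = c • 1 by rw [smul_eq_C_mul, mul_one]]
    exact Submodule.smul_mem _ _ sameLead_one.1
  refine ⟨h1.1, ?_⟩
  rw [sub_sub, sub_sub_cancel]
  refine add_mem (sum_mem fun j _ => ?_) (degLT_mono (by omega) (hC _))
  refine degLT_mono hp ?_
  simpa using mul_mem_degLT (a := 0) (hC (a i j)) (sameLead_X j).1

end MvPoly
end PrismEnv

namespace PrismEnv

/-! ### Regular sequences -/

theorem ofList_take_ofFn {R : Type*} [CommRing R] {r : ℕ} (f : Fin r → R) (i : ℕ) :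
    Ideal.ofList ((List.ofFn f).take i) = Ideal.span (f '' {j | j.1 < i}) := by
  refine congrArg Ideal.span (Set.ext fun x => ?_)
  simp only [Set.mem_ofPred_eq, Set.mem_image, List.mem_take_iff_getElem, List.length_ofFn,
    List.getElem_ofFn]
  constructor
  · rintro ⟨j, hj, rfl⟩
    exact ⟨⟨j, by omega⟩, by simp; omega, rfl⟩
  · rintro ⟨j, hj, rfl⟩
    exact ⟨j.1, by omega, rfl⟩

theorem isWeaklyRegular_ofFn_iff {R : Type*} [CommRing R] {r : ℕ} {f : Fin r → R} :
    RingTheory.Sequence.IsWeaklyRegular R (List.ofFn f) ↔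
      ∀ i x, f i * x ∈ Ideal.span (f '' {j | j < i}) → x ∈ Ideal.span (f '' {j | j < i}) := by
  rw [RingTheory.Sequence.isWeaklyRegular_iff]
  constructor
  · intro h i x hx
    have h1 := h i.1 (by simp)
    rw [isSMulRegular_quotient_iff_mem_of_smul_mem] at h1
    have h2 := h1 x
    rw [ofList_take_ofFn] at h2
    simpa using h2 (by simpa using hx)
  · intro h i hi
    rw [isSMulRegular_quotient_iff_mem_of_smul_mem]
    intro x hx
    rw [ofList_take_ofFn] at hx ⊢
    have := h ⟨i, by simpa using hi⟩ x
    simp only [smul_eq_mul, Ideal.mul_top, List.getElem_ofFn] at hx ⊢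
    exact this hx

/-- If a sequence is regular modulo a nonzerodivisor `p`, then `p` is a nonzerodivisor modulo the
sequence. -/
theorem mem_span_of_natCast_mul_mem {R : Type*} [CommRing R] {p : ℕ}
    (hp : ∀ a : R, p * a = 0 → a = 0) {r : ℕ} {g : Fin r → R}
    (hg : ∀ i x, g i * x ∈ Ideal.span {(p : R)} ⊔ Ideal.span (g '' {j | j < i}) →
      x ∈ Ideal.span {(p : R)} ⊔ Ideal.span (g '' {j | j < i}))
    {x : R} (hx : p * x ∈ Ideal.span (Set.range g)) : x ∈ Ideal.span (Set.range g) := by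
  have key (k : ℕ) (hk : k ≤ r) : ∀ x : R, p * x ∈ Ideal.span (g '' {j | j.1 < k}) →
      x ∈ Ideal.span (g '' {j | j.1 < k}) := by
    induction k with
    | zero =>
      intro x hx
      simp only [Nat.not_lt_zero, Set.ofPred_false, Set.image_empty, Ideal.span_empty,
        Ideal.mem_bot] at hx ⊢
      exact hp x hx
    | succ k ih =>
      intro x hx
      have h1 : {j : Fin r | j.1 < k + 1} = insert ⟨k, hk⟩ {j | j.1 < k} := by
        ext j
        simp only [Set.mem_ofPred_eq, Set.mem_insert_iff, Fin.ext_iff]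
        omega
      rw [h1, Set.image_insert_eq, Ideal.mem_span_insert] at hx ⊢
      obtain ⟨c, z, hz, hxz⟩ := hx
      -- From `p * x = c * g_k + z`, regularity modulo `p` gives `c = c' * p + w` with `w` in the
      -- span of the earlier terms. The induction hypothesis then applies to `x - c' * g_k`.
      have h2 := hg ⟨k, hk⟩ c (by
        have h3 : g ⟨k, hk⟩ * c = p * x - z := by rw [hxz]; ring
        rw [h3]
        exact sub_mem (Ideal.mem_sup_left (Ideal.mul_mem_right _ _ (Ideal.mem_span_singleton_self _)))
          (Ideal.mem_sup_right hz))
      obtain ⟨y, hy, w, hw, rfl⟩ := Submodule.mem_sup.1 h2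
      obtain ⟨c', rfl⟩ := Ideal.mem_span_singleton'.1 hy
      refine ⟨c', x - c' * g ⟨k, hk⟩, ih (by omega) _ ?_, by ring⟩
      have h4 : p * (x - c' * g ⟨k, hk⟩) = w * g ⟨k, hk⟩ + z := by
        rw [mul_sub, hxz]
        ring
      rw [h4]
      exact add_mem (Ideal.mul_mem_right _ _ hw) hz
  have h5 : (g '' {j | j.1 < r}) = Set.range g := by
    rw [← Set.image_univ]
    congr
    ext j
    simp
  rw [← h5] at hx ⊢
  exact key r le_rfl x hx

section

open MvPolynomial

variable {A : Type*} [CommRing A] {p : ℕ} {r : ℕ} {f : Fin r → A} {I : Ideal A}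
  {t : Fin r → dilAlgebra p I}

/-- Writing an element of `I` as `a0 * p + ∑ c_i f_i` and dividing by `p` gives `a0 + ∑ c_i t_i`. -/
theorem aeval_dilAlgebra_surjective (hI : I = Ideal.span {(p : A)} ⊔ Ideal.span (Set.range f))
    (ht : ∀ i, algebraMap A (dilAlgebra p I) (f i) = p * t i) :
    Function.Surjective (aeval t : MvPolynomial (Fin r) A →ₐ[A] dilAlgebra p I) := by
  rintro ⟨b, hb⟩
  have key (b : Localization.Away (p : A)) (hb : b ∈ dilAlgebra p I) :
      ∃ P : MvPolynomial (Fin r) A, (aeval t P : dilAlgebra p I).1 = b := by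
    induction hb using Algebra.adjoin_induction with
    | mem x hx =>
      obtain ⟨a, ha, hx⟩ := hx
      rw [hI] at ha
      obtain ⟨y, hy, w, hw, rfl⟩ := Submodule.mem_sup.1 ha
      obtain ⟨a0, rfl⟩ := Ideal.mem_span_singleton'.1 hy
      obtain ⟨c, rfl⟩ := Ideal.mem_span_range_iff_exists_fun.1 hw
      refine ⟨MvPolynomial.C a0 + ∑ i, MvPolynomial.C (c i) * X i,
        (isUnit_natCast_away p).mul_left_cancel ?_⟩
      rw [hx]
      have h1 : (p : dilAlgebra p I) * aeval t (MvPolynomial.C a0 + ∑ i, MvPolynomial.C (c i) * X i) =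
          algebraMap A (dilAlgebra p I) (a0 * p + ∑ i, c i * f i) := by
        simp only [map_add, map_mul, map_sum, aeval_X, aeval_C, map_natCast, ht, mul_add,
          Finset.mul_sum]
        rw [mul_comm]
        congr 1
        exact Finset.sum_congr rfl fun i _ => by ring
      exact congrArg Subtype.val h1
    | algebraMap a => exact ⟨MvPolynomial.C a, by rw [aeval_C]; rfl⟩
    | add x y _ _ hx hy =>
      obtain ⟨P, rfl⟩ := hx
      obtain ⟨Q, rfl⟩ := hy
      exact ⟨P + Q, by rw [map_add]; rfl⟩
    | mul x y _ _ hx hy =>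
      obtain ⟨P, rfl⟩ := hx
      obtain ⟨Q, rfl⟩ := hy
      exact ⟨P * Q, by rw [map_mul]; rfl⟩
  obtain ⟨P, hP⟩ := key b hb
  exact ⟨P, Subtype.ext hP⟩

/-- The kernel of evaluation at `f_i / p` is the `p`-saturation of the ideal of the `p * X i - f i`.
Regularity of `f` modulo `p` makes that ideal already saturated, and it is contained in the
extension of `I`. -/
theorem mem_map_C_of_aeval_eq_zero (hA : ∀ a : A, p * a = 0 → a = 0)
    (hI : I = Ideal.span {(p : A)} ⊔ Ideal.span (Set.range f))
    (hf : ∀ i x, f i * x ∈ Ideal.span {(p : A)} ⊔ Ideal.span (f '' {j | j < i}) →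
      x ∈ Ideal.span {(p : A)} ⊔ Ideal.span (f '' {j | j < i}))
    (ht : ∀ i, algebraMap A (dilAlgebra p I) (f i) = p * t i) {P : MvPolynomial (Fin r) A}
    (hP : aeval t P = 0) : P ∈ I.map (MvPolynomial.C : A →+* MvPolynomial (Fin r) A) := by
  let g (i : Fin r) : MvPolynomial (Fin r) A :=
      (p : MvPolynomial (Fin r) A) * X i - MvPolynomial.C (f i)
  have hgs (S : Set (Fin r)) : Ideal.span {(p : MvPolynomial (Fin r) A)} ⊔ Ideal.span (g '' S) =
      (Ideal.span {(p : A)} ⊔ Ideal.span (f '' S)).map MvPolynomial.C := by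
    rw [Ideal.map_sup, Ideal.map_span, Ideal.map_span, Set.image_singleton, map_natCast]
    refine le_antisymm (sup_le le_sup_left (Ideal.span_le.2 ?_))
        (sup_le le_sup_left (Ideal.span_le.2 ?_))
    · rintro _ ⟨i, hi, rfl⟩
      exact sub_mem (Ideal.mem_sup_left (Ideal.mul_mem_right _ _ (Ideal.mem_span_singleton_self _)))
        (Ideal.mem_sup_right (Ideal.subset_span ⟨_, ⟨i, hi, rfl⟩, rfl⟩))
    · rintro _ ⟨_, ⟨i, hi, rfl⟩, rfl⟩
      have h1 : MvPolynomial.C (f i) = (p : MvPolynomial (Fin r) A) * X i - g i := by simp [g]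
      rw [h1]
      exact sub_mem (Ideal.mem_sup_left (Ideal.mul_mem_right _ _ (Ideal.mem_span_singleton_self _)))
        (Ideal.mem_sup_right (Ideal.subset_span ⟨i, hi, rfl⟩))
  -- Modulo the `g i`, each factor `p` turns a variable `X i` into the constant `f i`, so a power of
  -- `p` makes `P` constant.
  have hred (P : MvPolynomial (Fin r) A) : ∃ (d : ℕ) (a : A),
      (p : MvPolynomial (Fin r) A) ^ d * P - MvPolynomial.C a ∈ Ideal.span (Set.range g) := by
    induction P using MvPolynomial.induction_on with
    | C a => exact ⟨0, a, by simp⟩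
    | add P Q hP hQ =>
      obtain ⟨d, a, h1⟩ := hP
      obtain ⟨d', a', h2⟩ := hQ
      refine ⟨d + d', p ^ d' * a + p ^ d * a', ?_⟩
      convert add_mem (Ideal.mul_mem_left _ ((p : MvPolynomial (Fin r) A) ^ d') h1)
        (Ideal.mul_mem_left _ ((p : MvPolynomial (Fin r) A) ^ d) h2) using 1
      simp only [map_add, map_mul, map_pow, map_natCast]
      ring
    | mul_X P i hP =>
      obtain ⟨d, a, h1⟩ := hP
      refine ⟨d + 1, a * f i, ?_⟩
      convert add_mem (Ideal.mul_mem_left _ ((p : MvPolynomial (Fin r) A) * X i) h1)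
        (Ideal.mul_mem_left _ (MvPolynomial.C a) (Ideal.subset_span (Set.mem_range_self i) :
          g i ∈ Ideal.span (Set.range g))) using 1
      simp only [map_mul, g]
      ring
  have hJ : Ideal.span (Set.range g) ≤ RingHom.ker (aeval t : MvPolynomial (Fin r) A →ₐ[A]
      dilAlgebra p I) := by
    rw [Ideal.span_le]
    rintro _ ⟨i, rfl⟩
    simp [g, ht]
  obtain ⟨d, a, hd⟩ := hred P
  have h1 : algebraMap A (dilAlgebra p I) a = 0 := by
    have := hJ hd
    rw [RingHom.mem_ker, map_sub, map_mul, hP, mul_zero, zero_sub, neg_eq_zero, aeval_C] at this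
    exact this
  have h2 : a = 0 := algebraMap_away_injective hA
    ((congrArg Subtype.val h1).trans (map_zero _).symm)
  rw [h2, map_zero, sub_zero] at hd
  have h3 : P ∈ Ideal.span (Set.range g) := by
    induction d with
    | zero => simpa using hd
    | succ d ih =>
      -- Factors `p` are removed one at a time. Modulo `p` the generator `g i` is `-f i`, so the
      -- regularity needed is that of `f`, applied to coefficients.
      refine ih (mem_span_of_natCast_mul_mem (p := p) (fun Q hQ => ?_) (fun i Q hQ => ?_) (x :=
          (p : MvPolynomial (Fin r) A) ^ d * P) ?_)
      · ext γ
        refine hA _ ?_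
        have := congrArg (coeff γ) hQ
        rwa [← map_natCast (MvPolynomial.C : A →+* MvPolynomial (Fin r) A), coeff_C_mul,
            coeff_zero] at this
      · rw [hgs, mem_map_C_iff] at hQ ⊢
        intro γ
        refine hf i _ ?_
        have h4 := hQ γ
        simp only [g, sub_mul, coeff_sub, coeff_C_mul, mul_assoc] at h4
        rw [← map_natCast (MvPolynomial.C : A →+* MvPolynomial (Fin r) A), coeff_C_mul] at h4
        have h5 : (p : A) * coeff γ (X i * Q)
            ∈ Ideal.span {(p : A)} ⊔ Ideal.span (f '' {j | j < i}) :=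
          Ideal.mem_sup_left (Ideal.mul_mem_right _ _ (Ideal.mem_span_singleton_self _))
        simpa using sub_mem h5 h4
      · rwa [← mul_assoc, ← pow_succ']
  rw [hI, ← Set.image_univ, ← hgs]
  rw [← Set.image_univ] at h3
  exact Ideal.mem_sup_right h3

/-- The reduction modulo `p` of a dilatation algebra along a regular sequence is a polynomial
ring. -/
theorem bijective_eval₂Hom_dilAlgebra (hA : ∀ a : A, p * a = 0 → a = 0)
    (hI : I = Ideal.span {(p : A)} ⊔ Ideal.span (Set.range f))
    (hf : ∀ i x, f i * x ∈ Ideal.span {(p : A)} ⊔ Ideal.span (f '' {j | j < i}) →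
      x ∈ Ideal.span {(p : A)} ⊔ Ideal.span (f '' {j | j < i}))
    (ht : ∀ i, algebraMap A (dilAlgebra p I) (f i) = p * t i)
    {R C : Type*} [CommRing R] [CommRing C] {ρ : dilAlgebra p I →+* R}
    (hρ : Function.Surjective ρ) (hρk : ∀ b, ρ b = 0 → (p : dilAlgebra p I) ∣ b)
    {q : A →+* C} (hq : Function.Surjective q) (hqk : RingHom.ker q = I) {ζ : C →+* R}
    (hζ : ∀ a, ζ (q a) = ρ (algebraMap A (dilAlgebra p I) a)) :
    Function.Bijective (eval₂Hom ζ fun i => ρ (t i)) := by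
  have h1 (P : MvPolynomial (Fin r) A) : eval₂Hom ζ (fun i => ρ (t i)) (map q P) = ρ (aeval t P) := by
    have : (eval₂Hom ζ (fun i => ρ (t i))).comp (map q) = ρ.comp (aeval t : MvPolynomial (Fin r)
        A →ₐ[A] dilAlgebra p I).toRingHom := by
      refine MvPolynomial.ringHom_ext (fun a => ?_) fun i => ?_
      · simp [hζ]
      · simp
    exact congrArg (fun φ : MvPolynomial (Fin r) A →+* R => φ P) this
  constructor
  · rw [injective_iff_map_eq_zero]
    intro G hG
    obtain ⟨P, rfl⟩ := map_surjective q hq G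
    rw [h1] at hG
    obtain ⟨b, hb⟩ := hρk _ hG
    obtain ⟨Q, rfl⟩ := aeval_dilAlgebra_surjective hI ht b
    -- The image of `P` is `p` times that of `Q`, so `P - p * Q` lies in the kernel of evaluation
    -- and has coefficients in `I`. Over `C` both it and `p` vanish.
    have h2 := mem_map_C_of_aeval_eq_zero hA hI hf ht (P := P - (p : MvPolynomial (Fin r) A) * Q) (by
      rw [map_sub, map_mul, map_natCast, hb, sub_self])
    have h3 : map q (P - (p : MvPolynomial (Fin r) A) * Q) = 0 := by
      ext γ
      rw [coeff_map, coeff_zero, ← RingHom.mem_ker, hqk]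
      exact mem_map_C_iff.1 h2 γ
    have h4 : (p : C) = 0 := by
      rw [← map_natCast q, ← RingHom.mem_ker, hqk, hI]
      exact Ideal.mem_sup_left (Ideal.mem_span_singleton_self _)
    have h5 : (p : MvPolynomial (Fin r) C) = 0 := by
      rw [← map_natCast (MvPolynomial.C : C →+* MvPolynomial (Fin r) C), h4, map_zero]
    rwa [map_sub, map_mul, map_natCast, h5, zero_mul, sub_zero] at h3
  · intro x
    obtain ⟨b, rfl⟩ := hρ x
    obtain ⟨P, rfl⟩ := aeval_dilAlgebra_surjective hI ht b
    exact ⟨_, h1 P⟩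

end

end PrismEnv

/-! ### The special fibre of the dilatation along a regular immersion -/

namespace PrismEnv

/-- It translates regularity on the reduction modulo `p` into conditions on lifts to the formal
scheme. -/
theorem mem_span_image_comp_iff {A A₁ : Type*} [CommRing A] [CommRing A₁] {p : ℕ} {e : A →+* A₁}
    (he : Function.Surjective e) (hk : ∀ a, e a = 0 ↔ (p : A) ∣ a) {ι : Type*} (F : ι → A)
    (S : Set ι) (a : A) : e a ∈ Ideal.span ((fun i => e (F i)) '' S) ↔
      a ∈ Ideal.span {(p : A)} ⊔ Ideal.span (F '' S) := by
  have h1 : RingHom.ker e = Ideal.span {(p : A)} := by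
    ext x
    rw [RingHom.mem_ker, hk, Ideal.mem_span_singleton]
  have h2 : (fun i => e (F i)) '' S = e '' (F '' S) := (Set.image_image _ _ _).symm
  rw [h2, ← Ideal.map_span, ← Ideal.mem_comap, Ideal.comap_map_of_surjective e he, ← RingHom.ker,
    h1, sup_comm]

-- The dilatation algebra need not be complete and only maps to the ring `S` of sections. Since the
-- result concerns reductions modulo `p`, this suffices.
open MvPolynomial in
theorem exists_bijective_eval₂Hom {A S R C : Type*} [CommRing A] [CommRing S] [CommRing R]
    [CommRing C] {p r : ℕ} {I : Ideal A} {F : Fin r → A} (hA : ∀ a : A, p * a = 0 → a = 0)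
    (hI : I = Ideal.span {(p : A)} ⊔ Ideal.span (Set.range F))
    (hF : ∀ i x, F i * x ∈ Ideal.span {(p : A)} ⊔ Ideal.span (F '' {j | j < i}) →
      x ∈ Ideal.span {(p : A)} ⊔ Ideal.span (F '' {j | j < i}))
    (e : dilAlgebra p I →+* S) (ev : S →+* R) (he : ∀ x, ∃ b, ev (e b) = x)
    (hek : ∀ b, ev (e b) = 0 → (p : dilAlgebra p I) ∣ b) {α : A →+* S}
    (hα : ∀ a, e (algebraMap A (dilAlgebra p I) a) = α a) {q : A →+* C}
    (hq : Function.Surjective q) (hqk : RingHom.ker q = I) {ζ : C →+* R}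
    (hζ : ∀ a, ζ (q a) = ev (α a)) :
    ∃ t : Fin r → S, (∀ i, α (F i) = p * t i) ∧
      Function.Bijective (eval₂Hom ζ fun i => ev (t i)) := by
  have ht (i : Fin r) : ∃ b : dilAlgebra p I, algebraMap A (dilAlgebra p I) (F i) = p * b := by
    refine exists_mul_eq_of_mem ?_
    rw [hI]
    exact Ideal.mem_sup_right (Ideal.subset_span (Set.mem_range_self i))
  choose t ht using ht
  refine ⟨fun i => e (t i), fun i => ?_, ?_⟩
  · rw [← hα, ht, map_mul, map_natCast]
  · exact bijective_eval₂Hom_dilAlgebra hA hI hF ht (ρ := ev.comp e) he hek hq hqk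
      fun a => (hζ a).trans (congrArg ev (hα a).symm)

namespace FrobeniusPair

open PadicFormalScheme MvPolynomial

variable {p : ℕ} [Fact p.Prime] {P P' : FrobeniusPair.{u} p}
  {f : ClosedPair.Hom P'.toClosedPair P.toClosedPair} {z : P'.Y.level 1 ⟶ P.X}

/-- The structure map of the special fibre of a dilatation over the closed subscheme. -/
noncomputable def zMap (h : P.IsFrobeniusStep P' f z) (V : (P.Y.level 1).Opens) :
    Γ(P.X, P.i ⁻¹ᵁ V) →+* Γ(P'.Y.level 1, f.hom.app 1 ⁻¹ᵁ V) :=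
  (z.appLE (P.i ⁻¹ᵁ V) (f.hom.app 1 ⁻¹ᵁ V) (by rw [← h.comm]; rfl)).hom

theorem zMap_app (h : P.IsFrobeniusStep P' f z) (V : (P.Y.level 1).Opens) (x : Γ(P.Y.level 1, V)) :
    zMap h V ((P.i.app V).hom x) = ((f.hom.app 1).app V).hom x := by
  have h1 : P.i.app V ≫ z.appLE (P.i ⁻¹ᵁ V) (f.hom.app 1 ⁻¹ᵁ V) (by rw [← h.comm]; rfl) =
      (f.hom.app 1).app V := by
    rw [Scheme.Hom.app_eq_appLE, Scheme.Hom.app_eq_appLE, Scheme.Hom.appLE_comp_appLE]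
    simp only [h.comm]
  exact congrArg (fun g : Γ(P.Y.level 1, V) ⟶ Γ(P'.Y.level 1, f.hom.app 1 ⁻¹ᵁ V) => g.hom x) h1

/-- A lift of a regular sequence generating the ideal of the closed subscheme. -/
structure IsRegularLift (P : FrobeniusPair.{u} p) {r : ℕ} (U : (P.Y.level 1).AffineZariskiSite)
    (F : Fin r → P.Y.sections (affineOpen U)) : Prop where
  ker_eq : RingHom.ker (P.i.app ((affineOpen U).trace 1)).hom =
    Ideal.span (Set.range fun i => (F i).1 1)
  isWeaklyRegular : RingTheory.Sequence.IsWeaklyRegular Γ(P.Y.level 1, (affineOpen U).trace 1)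
    (List.ofFn fun i => (F i).1 1)

theorem evalSec_surjective {Y : PadicFormalScheme.{u} p} (U : (Y.level 1).AffineZariskiSite) :
    Function.Surjective (evalSec (affineOpen U) 1) :=
  exists_section_coe_eq (isAffineOpen_affineOpen U) 1

theorem evalSec_eq_zero_iff {Y : PadicFormalScheme.{u} p} (U : (Y.level 1).AffineZariskiSite)
    (s : Y.sections (affineOpen U)) : evalSec (affineOpen U)
        1 s = 0 ↔ (p : Y.sections (affineOpen U)) ∣ s := by
  have := coe_eq_zero_iff (isAffineOpen_affineOpen U) 1 s
  rwa [pow_one] at this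

theorem IsRegularLift.sectionIdeal_eq {r : ℕ} {U : (P.Y.level 1).AffineZariskiSite}
    {F : Fin r → P.Y.sections (affineOpen U)} (hF : P.IsRegularLift U F) :
    P.sectionIdeal U = Ideal.span {(p : P.Y.sections (affineOpen U))} ⊔ Ideal.span (Set.range F) := by
  ext a
  rw [← Set.image_univ, ← mem_span_image_comp_iff (evalSec_surjective U) (evalSec_eq_zero_iff U),
    Set.image_univ]
  refine Iff.trans ?_ (Ideal.ext_iff.1 hF.ker_eq (a.1 1))
  exact Iff.rfl

/-- The special fibre of the dilatation is locally a polynomial ring over the closed subscheme. -/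
theorem IsFrobeniusStep.exists_bijective (h : P.IsFrobeniusStep P' f z) {r : ℕ}
    {U : (P.Y.level 1).AffineZariskiSite} {F : Fin r → P.Y.sections (affineOpen U)}
    (hF : P.IsRegularLift U F) :
    ∃ t : Fin r → P'.Y.sections ((affineOpen U).comap f.hom),
      (∀ i, sectionsMap f.hom (affineOpen U) ((affineOpen U).comap f.hom) (fun _ => le_rfl) (F i) =
        p * t i) ∧
      Function.Bijective (eval₂Hom (zMap h ((affineOpen U).trace 1)) fun i => (t i).1 1) := by
  obtain ⟨e, he⟩ := h.isFormalSpec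
  have := P.isClosedImmersion_i
  refine exists_bijective_eval₂Hom (I :=
      P.sectionIdeal U) (P.torsionFree (affineOpen U)) hF.sectionIdeal_eq ?_ (e U)
    (evalSec ((affineOpen U).comap f.hom) 1) (he.exists_eq U 1) ?_
    (α := sectionsMap f.hom (affineOpen U) ((affineOpen U).comap f.hom) fun _ => le_rfl) (he.unit U)
    (q := (P.i.app ((affineOpen U).trace 1)).hom.comp (evalSec (affineOpen U) 1)) ?_ rfl ?_
  · intro i x hx
    rw [← mem_span_image_comp_iff (evalSec_surjective U) (evalSec_eq_zero_iff U)] at hx ⊢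
    rw [map_mul] at hx
    exact isWeaklyRegular_ofFn_iff.1 hF.isWeaklyRegular i _ hx
  · intro b hb
    exact pow_one (p : dilAlgebra p (P.sectionIdeal U)) ▸ (he.eq_zero_iff U 1 b).1 hb
  · exact (Scheme.Hom.app_surjective P.i _ (isAffineOpen_affineOpen U)).comp (evalSec_surjective U)
  · intro a
    refine (zMap_app h _ _).trans ?_
    rw [Scheme.Hom.app_eq_appLE]
    rfl

end FrobeniusPair
end PrismEnv

/-! ### Equations of the Frobenius locus -/

namespace PrismEnv

theorem exists_hom_Spec_appLE {Y : Scheme.{u}} {W : Y.Opens} (hW : IsAffineOpen W)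
    {S : CommRingCat.{u}} (φ : Γ(Y, W) ⟶ S) :
    ∃ (t : Spec S ⟶ Y) (e : ⊤ ≤ t ⁻¹ᵁ W), t.appLE W ⊤ e = φ ≫ (Scheme.ΓSpecIso S).inv := by
  have e : ⊤ ≤ (Spec.map φ ≫ hW.fromSpec) ⁻¹ᵁ W := by
    rw [Scheme.Hom.comp_preimage, hW.fromSpec_preimage_self, Scheme.Hom.preimage_top]
  have e1 : ⊤ ≤ hW.fromSpec ⁻¹ᵁ W := hW.fromSpec_preimage_self.ge
  have e2 : ⊤ ≤ Spec.map φ ⁻¹ᵁ ⊤ := by rw [Scheme.Hom.preimage_top]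
  have h1 : (Spec.map φ).appLE ⊤ ⊤ e2 = (Spec.map φ).appTop := (Scheme.Hom.app_eq_appLE _).symm
  have h2 : hW.fromSpec.appLE W ⊤ e1 = (Scheme.ΓSpecIso Γ(Y, W)).inv := by
    rw [Scheme.Hom.appLE, hW.fromSpec_app_self, Category.assoc, ← Functor.map_comp]
    refine (congrArg ((Scheme.ΓSpecIso Γ(Y, W)).inv ≫ ·) ?_).trans (Category.comp_id _)
    exact (Spec Γ(Y, W)).presheaf.map_id _
  refine ⟨Spec.map φ ≫ hW.fromSpec, e, ?_⟩
  refine (Scheme.Hom.appLE_comp_appLE (Spec.map φ) hW.fromSpec W ⊤ ⊤ e1 e2).symm.trans ?_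
  rw [h1, h2]
  exact (Scheme.ΓSpecIso_inv_naturality φ).symm

theorem app_appLE_eq_of_comp_eq {Z X Y : Scheme.{u}} {t : Z ⟶ X} {a b : X ⟶ Y} (h : t ≫ a = t ≫ b)
    {V : Y.Opens} {W : X.Opens} (ea : W ≤ a ⁻¹ᵁ V) (eb : W ≤ b ⁻¹ᵁ V) (s : Γ(Y, V)) :
    (t.app W).hom ((a.appLE V W ea).hom s) = (t.app W).hom ((b.appLE V W eb).hom s) := by
  have h1 : a.appLE V W ea ≫ t.app W = b.appLE V W eb ≫ t.app W := by
    rw [Scheme.Hom.app_eq_appLE, Scheme.Hom.appLE_comp_appLE, Scheme.Hom.appLE_comp_appLE]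
    simp only [h]
  exact congrArg (fun g : Γ(Y, V) ⟶ Γ(Z, t ⁻¹ᵁ W) => g.hom s) h1

namespace FrobeniusPair

open PadicFormalScheme MvPolynomial

variable {p : ℕ} [Fact p.Prime] {P P' : FrobeniusPair.{u} p}
  {f : ClosedPair.Hom P'.toClosedPair P.toClosedPair} {z : P'.Y.level 1 ⟶ P.X}

/-- Local equations of the locus where the endomorphism agrees with the Frobenius. -/
theorem IsFrobeniusStep.ker_app_eq_span (h : P.IsFrobeniusStep P' f z) {r : ℕ}
    {V₀ : (P.Y.level 1).Opens} (hV : IsAffineOpen (f.hom.app 1 ⁻¹ᵁ V₀))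
    {τ : Fin r → Γ(P'.Y.level 1, f.hom.app 1 ⁻¹ᵁ V₀)}
    (hτ : Function.Surjective (eval₂Hom (zMap h V₀) τ)) {W : (P'.Y.level 1).Opens}
    (hW : IsAffineOpen W) (e : W ≤ P'.ψ.app 1 ⁻¹ᵁ f.hom.app 1 ⁻¹ᵁ V₀)
    (e' : W ≤ f.hom.app 1 ⁻¹ᵁ V₀) :
    RingHom.ker (P'.i.app W).hom = Ideal.span (Set.range fun i =>
      res e' (τ i) ^ p - ((P'.ψ.app 1).appLE _ W e).hom (τ i)) := by
  let F := absFrob p _ P'.Y.natCast_level_one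
  have hF (s : Γ(P'.Y.level 1, f.hom.app 1 ⁻¹ᵁ V₀)) : (F.appLE (f.hom.app 1 ⁻¹ᵁ V₀)
      W e').hom s = res e' s ^ p :=
    (absFrob_appLE _ e' s).trans (map_pow _ _ _)
  refine le_antisymm ?_ (Ideal.span_le.2 ?_)
  · let J := Ideal.span (Set.range fun i =>
      res e' (τ i) ^ p - ((P'.ψ.app 1).appLE _ W e).hom (τ i))
    -- On the spectrum of the quotient by `J`, the lifted endomorphism and Frobenius agree: on
    -- coefficients from `X` because they agree after `z`, and on the `τ i` by the definition of
    -- `J`. So this spectrum maps to the Frobenius locus, and functions vanishing on the locus lie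
    -- in `J`.
    obtain ⟨t, et, ht⟩ := exists_hom_Spec_appLE hW (CommRingCat.ofHom (Ideal.Quotient.mk J))
    have ht0 (x) : (t.appLE W ⊤ et).hom x = 0 ↔ x ∈ J := by
      rw [ht]
      refine Iff.trans ?_ Ideal.Quotient.eq_zero_iff_mem
      exact (Scheme.ΓSpecIso (.of (Γ(P'.Y.level 1, W)
          ⧸ J))).symm.commRingCatIsoToRingEquiv.map_eq_zero_iff
    have hFz : F ≫ z = P'.ψ.app 1 ≫ z :=
      (absFrob_naturality z P'.Y.natCast_level_one P.natCast_X).trans h.comm_z.symm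
    obtain ⟨s, hs⟩ := h.exists_lift _ t (by
      have e1 : ⊤ ≤ (t ≫ P'.ψ.app 1) ⁻¹ᵁ f.hom.app 1 ⁻¹ᵁ V₀ := et.trans (t.preimage_mono e)
      have e2 : ⊤ ≤ (t ≫ F) ⁻¹ᵁ f.hom.app 1 ⁻¹ᵁ V₀ := et.trans (t.preimage_mono e')
      refine hom_ext_of_appLE _ _ (fun _ : Unit => ⊤) iSup_const (fun _ => f.hom.app 1 ⁻¹ᵁ V₀)
        (fun _ => hV) (fun _ => e1) (fun _ => e2) fun _ => ?_
      have key : (((t ≫ P'.ψ.app 1).appLE _ ⊤ e1).hom.comp (eval₂Hom (zMap h V₀) τ)) =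
          (((t ≫ F).appLE _ ⊤ e2).hom.comp (eval₂Hom (zMap h V₀) τ)) := by
        refine MvPolynomial.ringHom_ext (fun c => ?_) fun i => ?_
        · rw [RingHom.comp_apply, RingHom.comp_apply, eval₂Hom_C]
          have h1 (a : P'.Y.level 1 ⟶ P'.Y.level 1) (ea) : ((t ≫ a).appLE (f.hom.app 1 ⁻¹ᵁ V₀)
              ⊤ ea).hom (zMap h V₀ c) =
              ((t ≫ a ≫ z).appLE (P.i ⁻¹ᵁ V₀) ⊤ (by
                rw [← Category.assoc]
                refine ea.trans ?_
                rw [Scheme.Hom.comp_preimage (t ≫ a) z]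
                refine Scheme.Hom.preimage_mono _ ?_
                rw [← h.comm]
                rfl)).hom c := by
            have h2 := Scheme.Hom.appLE_comp_appLE (t ≫ a) z (P.i ⁻¹ᵁ V₀) (f.hom.app 1 ⁻¹ᵁ V₀) ⊤
              (by rw [← h.comm]; rfl) ea
            simp only [Category.assoc] at h2
            exact congrArg (fun g : Γ(P.X, P.i ⁻¹ᵁ V₀) ⟶ Γ(_, ⊤) => g.hom c) h2
          rw [h1, h1]
          simp only [hFz]
        · rw [RingHom.comp_apply, RingHom.comp_apply, eval₂Hom_X']
          have h1 := Scheme.Hom.appLE_comp_appLE t (P'.ψ.app 1) (f.hom.app 1 ⁻¹ᵁ V₀) W ⊤ e et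
          have h2 := Scheme.Hom.appLE_comp_appLE t F (f.hom.app 1 ⁻¹ᵁ V₀) W ⊤ e' et
          rw [← h1, ← h2]
          change (t.appLE W ⊤ et).hom (((P'.ψ.app 1).appLE _ W e).hom (τ i)) =
            (t.appLE W ⊤ et).hom ((F.appLE (f.hom.app 1 ⁻¹ᵁ V₀) W e').hom (τ i))
          rw [hF, eq_comm, ← sub_eq_zero, ← map_sub, ht0]
          exact Ideal.subset_span (Set.mem_range_self i)
      refine CommRingCat.hom_ext (RingHom.ext fun x => ?_)
      obtain ⟨G, rfl⟩ := hτ x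
      exact congrArg (fun g : MvPolynomial (Fin r) _ →+* _ => g G) key)
    intro x hx
    rw [← ht0]
    have e3 : ⊤ ≤ s ⁻¹ᵁ P'.i ⁻¹ᵁ W := by
      rw [← Scheme.Hom.comp_preimage, hs]
      exact et
    have h3 : P'.i.app W ≫ s.appLE _ ⊤ e3 = t.appLE W ⊤ et := by
      rw [Scheme.Hom.app_eq_appLE, Scheme.Hom.appLE_comp_appLE]
      simp only [hs]
    rw [← h3]
    exact (congrArg (s.appLE _ ⊤ e3).hom hx).trans (map_zero _)
  · rintro _ ⟨i, rfl⟩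
    have h1 : P'.i ≫ P'.ψ.app 1 = P'.i ≫ F :=
      P'.restricts.symm.trans (absFrob_naturality _ _ _)
    have h2 := app_appLE_eq_of_comp_eq h1 e e' (τ i)
    rw [hF] at h2
    change (P'.i.app W).hom _ = 0
    rw [map_sub, h2, sub_self]

/-- The local equations have the form `t i ^ p - ∑ j, a i j * t j - c i`. -/
theorem IsFrobeniusStep.exists_appLE_eq (h : P.IsFrobeniusStep P' f z) {r : ℕ}
    {U U' : (P.Y.level 1).AffineZariskiSite} (hU : (affineOpen U').trace 1 ≤ (affineOpen U).trace 1)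
    (hψ : (affineOpen U').trace 1 ≤ P.ψ.app 1 ⁻¹ᵁ (affineOpen U).trace 1)
    {F : Fin r → P.Y.sections (affineOpen U)} (hF : P.IsRegularLift U F)
    (hF' : P.IsRegularLift U' fun i => resSec hU (F i))
    {t : Fin r → P'.Y.sections ((affineOpen U).comap f.hom)}
    (ht : ∀ i, sectionsMap f.hom (affineOpen U) ((affineOpen U).comap f.hom) (fun _ => le_rfl) (F i) =
      p * t i)
    (e : f.hom.app 1 ⁻¹ᵁ (affineOpen U').trace 1 ≤
      P'.ψ.app 1 ⁻¹ᵁ f.hom.app 1 ⁻¹ᵁ (affineOpen U).trace 1)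
    (e' : f.hom.app 1 ⁻¹ᵁ (affineOpen U').trace 1 ≤ f.hom.app 1 ⁻¹ᵁ (affineOpen U).trace 1) :
    ∃ (a : Fin r → Fin r → Γ(P.X, P.i ⁻¹ᵁ (affineOpen U').trace 1)) (c : Fin r → Γ(P.X,
        P.i ⁻¹ᵁ (affineOpen U').trace 1)),
      ∀ i, ((P'.ψ.app 1).appLE (f.hom.app 1 ⁻¹ᵁ (affineOpen U).trace 1)
          (f.hom.app 1 ⁻¹ᵁ (affineOpen U').trace 1) e).hom ((t i).1 1) =
        ∑ j, zMap h ((affineOpen U').trace 1) (a i j) * res e' ((t j).1 1) +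
          zMap h ((affineOpen U').trace 1) (c i) := by
  let ψ := sectionsMap P.ψ (affineOpen U) (affineOpen U') (FormalOpen.le_preimage _ _ _ hψ)
  let ψ' := sectionsMap P'.ψ ((affineOpen U).comap f.hom) ((affineOpen U').comap f.hom)
      (FormalOpen.le_preimage _ _ _ e)
  let π := sectionsMap f.hom (affineOpen U) ((affineOpen U).comap f.hom) (fun _ => le_rfl)
  let π' := sectionsMap f.hom (affineOpen U') ((affineOpen U').comap f.hom) (fun _ => le_rfl)
  -- The endomorphism preserves the ideal of `X` since it restricts to an endomorphism of `X`.
  have hmem (i : Fin r) : ψ (F i) ∈ P.sectionIdeal U' := by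
    refine app_appLE_eq_zero P.i P.i _ (P.ψ.app 1) P.restricts.symm hψ (t := (F i).1 1) ?_
    have h1 : (F i).1 1 ∈ RingHom.ker (P.i.app ((affineOpen U).trace 1)).hom := by
      rw [hF.ker_eq]
      exact Ideal.subset_span (Set.mem_range_self i)
    exact h1
  have hex (i : Fin r) : ∃ (c : P.Y.sections (affineOpen U'))
      (a : Fin r → P.Y.sections (affineOpen U')),
      ψ (F i) = c * p + ∑ j, a j * resSec hU (F j) := by
    have h1 := hmem i
    rw [hF'.sectionIdeal_eq] at h1
    obtain ⟨y, hy, w, hw, hyw⟩ := Submodule.mem_sup.1 h1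
    obtain ⟨c, rfl⟩ := Ideal.mem_span_singleton'.1 hy
    obtain ⟨a, rfl⟩ := Ideal.mem_span_range_iff_exists_fun.1 hw
    exact ⟨c, a, hyw.symm⟩
  choose c a hca using hex
  have e'' : ((affineOpen U').comap f.hom).trace 1 ≤ ((affineOpen U).comap f.hom).trace 1 := e'
  have hπψ (s) : ψ' (π s) = π' (ψ s) :=
    (sectionsMap_sectionsMap _ _ _ _ _ _ _ _).trans ((sectionsMap_congr h.comm_ψ _ _ s).trans
      (sectionsMap_sectionsMap _ _ _ _ _ _ _ _).symm)
  have hπres (s) : π' (resSec hU s) = resSec e'' (π s) :=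
    (sectionsMap_resSec _ _ (fun n => Scheme.Hom.preimage_mono _ (FormalOpen.trace_le hU n))
        _ s).trans
      (resSec_sectionsMap _ _ _ e'' s).symm
  -- Apply the lifted endomorphism to `F i = p * t i`, expand `ψ (F i)` in terms of `p` and the `F j
  -- = p * t j`, and cancel `p`.
  have hψt (i : Fin r) : ψ' (t i) = ∑ j, π' (a i j) * resSec e'' (t j) + π' (c i) := by
    refine P'.torsionFree.pow_mul_cancel 1 ?_
    rw [pow_one]
    have h1 : ψ' (π (F i)) = p * ψ' (t i) := by
      rw [show π (F i) = p * t i from ht i, map_mul, map_natCast]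
    rw [← h1, hπψ, hca, map_add, map_mul, map_natCast, map_sum, mul_add, Finset.mul_sum, add_comm,
      mul_comm (p : P'.Y.sections _) (π' (c i))]
    congr 1
    refine Finset.sum_congr rfl fun j _ => ?_
    rw [map_mul, hπres, show π (F j) = p * t j from ht j, map_mul, map_natCast]
    ring
  have hz (s : P.Y.sections (affineOpen U')) : (π' s).1 1 =
      zMap h ((affineOpen U').trace 1) ((P.i.app ((affineOpen U').trace 1)).hom (s.1 1)) := by
    rw [zMap_app, Scheme.Hom.app_eq_appLE]
    rfl
  refine ⟨fun i j => (P.i.app ((affineOpen U').trace 1)).hom ((a i j).1 1),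
    fun i => (P.i.app ((affineOpen U').trace 1)).hom ((c i).1 1), fun i => ?_⟩
  have h2 := congrArg (evalSec ((affineOpen U').comap f.hom) 1) (hψt i)
  rw [map_add, map_sum] at h2
  refine h2.trans ?_
  refine congrArg₂ (· + ·) (Finset.sum_congr rfl fun j _ => ?_) (hz _)
  rw [map_mul]
  exact congrArg₂ (· * ·) (hz _) (resSec_coe e'' (t j) 1)

end FrobeniusPair
end PrismEnv

namespace PrismEnv

/-! ### Regular sequences generating the ideal of a closed subscheme -/

theorem exists_regular_generators {X Y : Scheme.{u}} {i : X ⟶ Y} (h : IsRegularImmersion i) (x : X) :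
    ∃ (U : Y.AffineZariskiSite) (r : ℕ) (f : Fin r → Γ(Y, U.toOpens)), i x ∈ U.toOpens ∧
      RingHom.ker (i.app U.toOpens).hom = Ideal.span (Set.range f) ∧
      RingTheory.Sequence.IsWeaklyRegular Γ(Y, U.toOpens) (List.ofFn f) := by
  obtain ⟨hi, h⟩ := h
  obtain ⟨U, hU, rs, hrs, hk⟩ := h x
  have hl : List.ofFn rs.get = rs := List.ofFn_get rs
  refine ⟨U, rs.length, rs.get, hU, ?_, ?_⟩
  · rw [Scheme.Hom.ker_apply] at hk
    refine hk.trans ?_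
    refine congrArg Ideal.span (Set.ext fun y => ?_)
    simp [List.mem_iff_get]
  · rw [hl]
    exact hrs.toIsWeaklyRegular

theorem flat_map {Y : Scheme.{u}} {V V' : Y.Opens} (hV : IsAffineOpen V) (hV' : IsAffineOpen V')
    (e : V' ≤ V) : (Y.presheaf.map (homOfLE e).op).hom.Flat := by
  have h1 := HasRingHomProperty.appLE @Flat (𝟙 Y) inferInstance ⟨V, hV⟩ ⟨V', hV'⟩ e
  have h2 : (𝟙 Y : Y ⟶ Y).appLE V V' e = Y.presheaf.map (homOfLE e).op := by
    exact Category.id_comp _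
  rw [← h2]
  exact h1

/-- Restriction between affine open sets is flat, and flat base change preserves weakly regular
sequences. -/
theorem regular_generators_res {X Y : Scheme.{u}} {i : X ⟶ Y} [QuasiCompact i] {V V' : Y.Opens}
    (hV : IsAffineOpen V) (hV' : IsAffineOpen V') (e : V' ≤ V) {r : ℕ} {f : Fin r → Γ(Y, V)}
    (hf : RingHom.ker (i.app V).hom = Ideal.span (Set.range f))
    (hr : RingTheory.Sequence.IsWeaklyRegular Γ(Y, V) (List.ofFn f)) :
    RingHom.ker (i.app V').hom = Ideal.span (Set.range fun j => res e (f j)) ∧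
      RingTheory.Sequence.IsWeaklyRegular Γ(Y, V') (List.ofFn fun j => res e (f j)) := by
  constructor
  · have h1 := i.ker.map_ideal (U := ⟨V', hV'⟩) (V := ⟨V, hV⟩) e
    rw [Scheme.Hom.ker_apply, Scheme.Hom.ker_apply] at h1
    refine h1.symm.trans ?_
    refine (congrArg (Ideal.map _) hf).trans ?_
    rw [Ideal.map_span, ← Set.range_comp]
    rfl
  · algebraize [(Y.presheaf.map (homOfLE e).op).hom]
    have : Module.Flat Γ(Y, V) Γ(Y, V') := flat_map hV hV' e
    have h1 := RingTheory.Sequence.IsWeaklyRegular.of_flat (S := Γ(Y, V')) hr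
    rw [List.map_ofFn] at h1
    exact h1

/-! ### Algebras of the form `C[X] / (g)` -/

/-- The constant coefficient is a retraction, so the map on spectra is surjective. -/
theorem faithfullyFlat_C (C : Type*) [CommRing C] (σ : Type*) :
    (MvPolynomial.C : C →+* MvPolynomial σ C).FaithfullyFlat := by
  rw [RingHom.FaithfullyFlat.iff_flat_and_comap_surjective]
  refine ⟨?_, fun x => ⟨PrimeSpectrum.comap MvPolynomial.constantCoeff x, ?_⟩⟩
  · rw [← MvPolynomial.algebraMap_eq, RingHom.flat_algebraMap_iff]
    infer_instance
  · rw [← PrimeSpectrum.comap_comp_apply]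
    have : (MvPolynomial.constantCoeff : MvPolynomial σ C →+* C).comp MvPolynomial.C = RingHom.id C := by
      ext; simp
    rw [this]
    rfl

/-- The facts about polynomial rings are transported along `Φ`. In the application `q ∘ Φ ∘ C`
describes `X' → X` and `Φ ∘ C` describes `Y'_1 → X`. -/
theorem MvPoly.faithfullyFlat_and_isWeaklyRegular {C R S : Type u} [CommRing C] [CommRing R]
    [CommRing S] {p : ℕ} (hp : 0 < p) {r : ℕ}
    {g : Fin r → MvPolynomial (Fin r) C} (hg : ∀ i, MvPoly.SameLead p (MvPolynomial.X i ^ p) (g i))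
    {Φ : MvPolynomial (Fin r) C →+* R} (hΦ : Function.Bijective Φ) {q : R →+* S}
    (hq : Function.Surjective q) (hk : RingHom.ker q = Ideal.span (Set.range fun i => Φ (g i))) :
    (q.comp (Φ.comp MvPolynomial.C)).FaithfullyFlat ∧ (Φ.comp MvPolynomial.C).FaithfullyFlat ∧
      RingTheory.Sequence.IsWeaklyRegular R (List.ofFn fun i => Φ (g i)) := by
  have hmem (T : Set (Fin r)) (x) : Φ x ∈ Ideal.span ((fun i => Φ (g i)) '' T) ↔
      x ∈ Ideal.span (g '' T) := by
    have h1 : (fun i => Φ (g i)) '' T = Φ '' (g '' T) := (Set.image_image _ _ _).symm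
    rw [h1, ← Ideal.map_span, ← Ideal.mem_comap,
      Ideal.comap_map_of_bijective Φ hΦ]
  refine ⟨?_, ?_, ?_⟩
  · refine MvPoly.faithfullyFlat_of_ker_eq_span hp hg (q.comp Φ) (hq.comp hΦ.surjective) ?_
    ext x
    rw [← Set.image_univ, ← hmem, Set.image_univ, ← hk]
    rfl
  · exact RingHom.FaithfullyFlat.stableUnderComposition _ Φ (faithfullyFlat_C _ _) (.of_bijective hΦ)
  · rw [isWeaklyRegular_ofFn_iff]
    intro i x hx
    obtain ⟨y, rfl⟩ := hΦ.surjective x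
    rw [← map_mul, hmem] at hx
    rw [hmem]
    exact MvPoly.mem_span_of_mul_mem hp hg (lt_irrefl i) hx

namespace FrobeniusPair

open PadicFormalScheme MvPolynomial

variable {p : ℕ} [Fact p.Prime] {P P' : FrobeniusPair.{u} p}
  {f : ClosedPair.Hom P'.toClosedPair P.toClosedPair} {z : P'.Y.level 1 ⟶ P.X}

theorem exists_isRegularLift (hP : IsRegularImmersion P.i) (x : P.X) :
    ∃ (U : (P.Y.level 1).AffineZariskiSite) (r : ℕ) (F : Fin r → P.Y.sections (affineOpen U)),
      P.i x ∈ (affineOpen U).trace 1 ∧ P.IsRegularLift U F := by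
  obtain ⟨U, r, g, hx, hk, hr⟩ := exists_regular_generators hP x
  have := P.isClosedImmersion_i
  have hU : (affineOpen U).trace 1 = U.toOpens := P.Y.traceOf_one _
  obtain ⟨h1, h2⟩ := regular_generators_res (i := P.i) U.2 (isAffineOpen_affineOpen U) hU.le hk hr
  choose F hF using fun j => evalSec_surjective U (res hU.le (g j))
  have hF' : (fun j => (F j).1 1) = fun j => res hU.le (g j) := funext hF
  exact ⟨U, r, F, hU.ge hx, by rw [h1, hF'], by rw [hF']; exact h2⟩

theorem IsRegularLift.resSec {U U' : (P.Y.level 1).AffineZariskiSite} {r : ℕ}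
    {F : Fin r → P.Y.sections (affineOpen U)} (hF : P.IsRegularLift U F)
    (hU : (affineOpen U').trace 1 ≤ (affineOpen U).trace 1) :
    P.IsRegularLift U' fun j => resSec hU (F j) := by
  have := P.isClosedImmersion_i
  obtain ⟨h1, h2⟩ := regular_generators_res (i := P.i) (isAffineOpen_affineOpen U)
    (isAffineOpen_affineOpen U') hU hF.ker_eq hF.isWeaklyRegular
  have hF' : (fun j => (PadicFormalScheme.resSec hU (F j)).1 1) = fun j => res hU ((F j).1 1) :=
    funext fun j => resSec_coe hU (F j) 1
  exact ⟨by rw [h1, hF'], by rw [hF']; exact h2⟩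

/-- The endomorphism restricts on `X` to Frobenius, which is the identity on points. -/
theorem ψ_app_one_apply (x : P.X) : P.ψ.app 1 (P.i x) = P.i x := by
  have h1 := congrArg (fun g : P.X ⟶ P.Y.level 1 => g x) P.restricts
  exact h1.symm

/-- The local structure of the dilatation along a regular immersion. -/
theorem IsFrobeniusStep.exists_local (h : P.IsFrobeniusStep P' f z) (hP : IsRegularImmersion P.i)
    (x : P.X) : ∃ V : (P.Y.level 1).Opens, P.i x ∈ V ∧ IsAffineOpen V ∧
      (zMap h V).FaithfullyFlat ∧ ((P'.i.app (f.hom.app 1 ⁻¹ᵁ V)).hom.comp (zMap h V)).FaithfullyFlat ∧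
      ∃ (r : ℕ) (g : Fin r → Γ(P'.Y.level 1, f.hom.app 1 ⁻¹ᵁ V)),
        RingHom.ker (P'.i.app (f.hom.app 1 ⁻¹ᵁ V)).hom = Ideal.span (Set.range g) ∧
        RingTheory.Sequence.IsWeaklyRegular Γ(P'.Y.level 1, f.hom.app 1 ⁻¹ᵁ V) (List.ofFn g) := by
  have hp : p.Prime := Fact.out
  have := P'.isClosedImmersion_i
  obtain ⟨U, r, F, hx, hF⟩ := exists_isRegularLift hP x
  -- The endomorphism may move points outside `X`, so shrink to an affine open set which it maps
  -- into `U`; this is possible because it fixes the point `x`.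
  obtain ⟨V', hV', hxV', hle⟩ := exists_isAffineOpen_mem_and_subset
    (U := (affineOpen U).trace 1 ⊓ P.ψ.app 1 ⁻¹ᵁ (affineOpen U).trace 1) (x := P.i x)
    ⟨hx, by
      change P.ψ.app 1 (P.i x) ∈ (affineOpen U).trace 1
      rw [ψ_app_one_apply]
      exact hx⟩
  let U' : (P.Y.level 1).AffineZariskiSite := ⟨V', hV'⟩
  have hU' : (affineOpen U').trace 1 = V' := P.Y.traceOf_one _
  have hU : (affineOpen U').trace 1 ≤ (affineOpen U).trace 1 := hU'.le.trans (hle.trans inf_le_left)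
  have hψ : (affineOpen U').trace 1 ≤ P.ψ.app 1 ⁻¹ᵁ (affineOpen U).trace 1 :=
    hU'.le.trans (hle.trans inf_le_right)
  have hF' := hF.resSec hU
  have e' : f.hom.app 1 ⁻¹ᵁ (affineOpen U').trace 1 ≤ f.hom.app 1 ⁻¹ᵁ (affineOpen U).trace 1 :=
    Scheme.Hom.preimage_mono _ hU
  have e : f.hom.app 1 ⁻¹ᵁ (affineOpen U').trace 1 ≤
      P'.ψ.app 1 ⁻¹ᵁ f.hom.app 1 ⁻¹ᵁ (affineOpen U).trace 1 := by
    have h1 : P'.ψ.app 1 ≫ f.hom.app 1 = f.hom.app 1 ≫ P.ψ.app 1 :=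
      congrArg (fun g : P'.Y ⟶ P.Y => g.app 1) h.comm_ψ
    rw [← Scheme.Hom.comp_preimage, h1]
    exact Scheme.Hom.preimage_mono _ hψ
  obtain ⟨t, ht, hΦ⟩ := h.exists_bijective hF
  obtain ⟨t', ht', hΦ'⟩ := h.exists_bijective hF'
  have e'' : ((affineOpen U').comap f.hom).trace 1 ≤ ((affineOpen U).comap f.hom).trace 1 := e'
  -- Both sides are the quotient by `p` of the same restriction of `F j`.
  have htt (j : Fin r) : t' j = PadicFormalScheme.resSec e'' (t j) := by
    refine P'.torsionFree.pow_mul_cancel 1 ?_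
    rw [pow_one, ← ht' j]
    refine (sectionsMap_resSec _ _ (fun n => Scheme.Hom.preimage_mono _ (FormalOpen.trace_le hU n))
        _ _).trans ?_
    refine (resSec_sectionsMap _ (fun _ => le_rfl) _ e'' _).symm.trans ?_
    rw [ht j, map_mul, map_natCast]
  have htt' : (fun j => (t' j).1 1) = fun j => res e' ((t j).1 1) :=
    funext fun j => by rw [htt]; exact resSec_coe e'' (t j) 1
  rw [htt'] at hΦ'
  have haff : IsAffineOpen (f.hom.app 1 ⁻¹ᵁ (affineOpen U).trace 1) := by
    have := h.isFormalSpec.choose_spec.isAffineMorphism 1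
    exact (isAffineOpen_affineOpen U).preimage _
  have haff' : IsAffineOpen (f.hom.app 1 ⁻¹ᵁ (affineOpen U').trace 1) := by
    have := h.isFormalSpec.choose_spec.isAffineMorphism 1
    exact (isAffineOpen_affineOpen U').preimage _
  have hk := h.ker_app_eq_span haff hΦ.surjective haff' e e'
  obtain ⟨a, c, hac⟩ := h.exists_appLE_eq hU hψ hF hF' ht e e'
  let g (i : Fin r) : MvPolynomial (Fin r) Γ(P.X, P.i ⁻¹ᵁ (affineOpen U').trace 1) :=
    X i ^ p - ∑ j, MvPolynomial.C (a i j) * X j - MvPolynomial.C (c i)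
  have hg (i : Fin r) : eval₂Hom (zMap h ((affineOpen U').trace 1)) (fun j => res e' ((t j).1 1))
      (g i) =
      res e' ((t i).1 1) ^ p - ((P'.ψ.app 1).appLE (f.hom.app 1 ⁻¹ᵁ (affineOpen U).trace 1)
          (f.hom.app 1 ⁻¹ᵁ (affineOpen U').trace 1) e).hom ((t i).1 1) := by
    rw [hac, map_sub, map_sub, map_pow, map_sum, eval₂Hom_X', eval₂Hom_C, sub_sub]
    simp only [map_mul, eval₂Hom_X', eval₂Hom_C]
  obtain ⟨c1, c2, c3⟩ := MvPoly.faithfullyFlat_and_isWeaklyRegular hp.pos (fun i => MvPoly.sameLead_of_linear hp.two_le a c i) hΦ'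
    (q := (P'.i.app (f.hom.app 1 ⁻¹ᵁ (affineOpen U').trace 1)).hom)
    (Scheme.Hom.app_surjective P'.i _ haff')
        (hk.trans (congrArg (fun φ => Ideal.span (Set.range φ)) (funext fun i => (hg i).symm)))
  have hcomp : (eval₂Hom (zMap h ((affineOpen U').trace 1))
      fun j => res e' ((t j).1 1)).comp MvPolynomial.C =
      zMap h ((affineOpen U').trace 1) := RingHom.ext fun s => eval₂Hom_C _ _ s
  rw [hcomp] at c1 c2
  exact ⟨_, hU'.ge hxV', isAffineOpen_affineOpen U', c2, c1, r, _,
    hk.trans (congrArg (fun φ => Ideal.span (Set.range φ)) (funext fun i => (hg i).symm)), c3⟩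

end FrobeniusPair
end PrismEnv

/-! ### Faithful flatness and regularity from affine charts -/

namespace PrismEnv

theorem flat_and_surjective_morphismRestrict_iff {S X : Scheme.{u}} (g : S ⟶ X) [IsAffineHom g]
    {W : X.Opens} (hW : IsAffineOpen W) :
    Flat (g ∣_ W) ∧ Surjective (g ∣_ W) ↔ (g.app W).hom.FaithfullyFlat := by
  have h1 : IsAffine W := hW
  have h2 : IsAffine (g ⁻¹ᵁ W) := hW.preimage g
  rw [Flat.flat_and_surjective_iff_faithfullyFlat_of_isAffine]
  refine RingHom.FaithfullyFlat.respectsIso.arrow_mk_iso_iff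
    (f := CommRingCat.ofHom (g ∣_ W).appTop.hom) (g := CommRingCat.ofHom (g.app W).hom)
    (Arrow.isoMk W.topIso (g ⁻¹ᵁ W).topIso ?_)
  simp only [Scheme.Opens.topIso_hom, Arrow.mk_hom, CommRingCat.ofHom_hom, morphismRestrict_app']
  rw [Scheme.Hom.app_eq_appLE]
  exact (Scheme.Hom.map_appLE g le_rfl (eqToHom _).op).trans
    (Scheme.Hom.appLE_map g _ (eqToHom _).op).symm

theorem faithfullyFlat_app {S X : Scheme.{u}} (g : S ⟶ X) [IsAffineHom g] [Flat g] [Surjective g]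
    {W : X.Opens} (hW : IsAffineOpen W) : (g.app W).hom.FaithfullyFlat := by
  have : IsZariskiLocalAtTarget @Flat.{u} := HasRingHomProperty.instIsZariskiLocalAtTarget _
  exact (flat_and_surjective_morphismRestrict_iff g hW).1
    ⟨IsZariskiLocalAtTarget.restrict ‹_› W, IsZariskiLocalAtTarget.restrict ‹_› W⟩

theorem flat_and_surjective_of_app {S X : Scheme.{u}} (g : S ⟶ X) [IsAffineHom g]
    (H : ∀ x : X, ∃ W : X.Opens, x ∈ W ∧ IsAffineOpen W ∧ (g.app W).hom.FaithfullyFlat) :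
    Flat g ∧ Surjective g := by
  choose W hxW hW hf using H
  have hcov : iSup W = ⊤ := top_le_iff.1 fun x _ => TopologicalSpace.Opens.mem_iSup.2 ⟨x, hxW x⟩
  have key (x : X) := (flat_and_surjective_morphismRestrict_iff g (hW x)).2 (hf x)
  have : IsZariskiLocalAtTarget @Flat.{u} := HasRingHomProperty.instIsZariskiLocalAtTarget _
  exact ⟨IsZariskiLocalAtTarget.of_iSup_eq_top (P := @Flat.{u}) W hcov fun x => (key x).1,
    IsZariskiLocalAtTarget.of_iSup_eq_top (P := @Surjective.{u}) W hcov fun x => (key x).2⟩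

theorem flat_and_surjective_of_appLE {S X : Scheme.{u}} (g : S ⟶ X) [IsAffineHom g]
    (H : ∀ x : X, ∃ (W : X.Opens) (V : S.Opens) (e : V ≤ g ⁻¹ᵁ W), x ∈ W ∧ IsAffineOpen W ∧
      g ⁻¹ᵁ W = V ∧ (g.appLE W V e).hom.FaithfullyFlat) :
    Flat g ∧ Surjective g := by
  refine flat_and_surjective_of_app g fun x => ?_
  obtain ⟨W, V, e, hx, hW, rfl, h⟩ := H x
  refine ⟨W, hx, hW, ?_⟩
  rwa [Scheme.Hom.app_eq_appLE]

/-- The quotient embeds in the nonzero ring `S`, which is what separates regular from weakly regular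
sequences. -/
theorem isRegular_of_ker_eq {R S : Type*} [CommRing R] [CommRing S] [Nontrivial S] {q : R →+* S}
    {r : ℕ} {g : Fin r → R} (hk : RingHom.ker q = Ideal.span (Set.range g))
    (hg : RingTheory.Sequence.IsWeaklyRegular R (List.ofFn g)) :
    RingTheory.Sequence.IsRegular R (List.ofFn g) ∧ RingHom.ker q = Ideal.ofList (List.ofFn g) := by
  have h1 : RingHom.ker q = Ideal.ofList (List.ofFn g) := by
    rw [hk]
    refine congrArg Ideal.span (Set.ext fun x => ?_)
    simp [List.mem_ofFn]
  refine ⟨⟨hg, fun h => ?_⟩, h1⟩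
  rw [smul_eq_mul, Ideal.mul_top, ← h1] at h
  exact RingHom.ker_ne_top q h.symm

namespace FrobeniusPair

open PadicFormalScheme

variable {p : ℕ} [Fact p.Prime] {P P' : FrobeniusPair.{u} p}
  {f : ClosedPair.Hom P'.toClosedPair P.toClosedPair} {z : P'.Y.level 1 ⟶ P.X}

theorem IsFrobeniusStep.isRegularImmersion (h : P.IsFrobeniusStep P' f z)
    (hP : IsRegularImmersion P.i) : IsRegularImmersion P'.i := by
  refine ⟨P'.isClosedImmersion_i, fun x => ?_⟩
  obtain ⟨V, hxV, hV, -, -, r, g, hk, hg⟩ := h.exists_local hP (z (P'.i x))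
  have := h.isFormalSpec.choose_spec.isAffineMorphism 1
  have := P'.isClosedImmersion_i
  have hx : P'.i x ∈ f.hom.app 1 ⁻¹ᵁ V := by
    change f.hom.app 1 (P'.i x) ∈ V
    rw [← h.comm]
    exact hxV
  refine ⟨⟨f.hom.app 1 ⁻¹ᵁ V, hV.preimage _⟩, hx, List.ofFn g, ?_⟩
  -- The chart contains the point `x` of the closed subscheme, so the quotient ring is nonzero.
  have : Nonempty (P'.i ⁻¹ᵁ f.hom.app 1 ⁻¹ᵁ V) := ⟨⟨x, hx⟩⟩
  rw [Scheme.Hom.ker_apply]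
  exact isRegular_of_ker_eq hk hg

theorem IsFrobeniusStep.flat_and_surjective (h : P.IsFrobeniusStep P' f z)
    (hP : IsRegularImmersion P.i) : Flat z ∧ Surjective z := by
  have := h.isFormalSpec.choose_spec.isAffineMorphism 1
  have := P.isClosedImmersion_i
  have : IsAffineHom (z ≫ P.i) := by rwa [h.comm]
  have := IsAffineHom.of_comp z P.i
  refine flat_and_surjective_of_appLE z fun x => ?_
  obtain ⟨V, hxV, hV, h1, -, -⟩ := h.exists_local hP x
  exact ⟨P.i ⁻¹ᵁ V, f.hom.app 1 ⁻¹ᵁ V, by rw [← h.comm]; rfl, hxV, hV.preimage _,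
      by rw [← h.comm]; rfl, h1⟩

theorem IsFrobeniusStep.flat_and_surjective_homX (h : P.IsFrobeniusStep P' f z)
    (hP : IsRegularImmersion P.i) : Flat f.homX ∧ Surjective f.homX := by
  have := h.isFormalSpec.choose_spec.isAffineMorphism 1
  have := P.isClosedImmersion_i
  have := P'.isClosedImmersion_i
  have : IsAffineHom (z ≫ P.i) := by rwa [h.comm]
  have := IsAffineHom.of_comp z P.i
  rw [h.homX]
  refine flat_and_surjective_of_appLE (P'.i ≫ z) fun x => ?_
  obtain ⟨V, hxV, hV, -, h1, -⟩ := h.exists_local hP x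
  have e : f.hom.app 1 ⁻¹ᵁ V ≤ z ⁻¹ᵁ P.i ⁻¹ᵁ V := by rw [← h.comm]; rfl
  refine ⟨P.i ⁻¹ᵁ V, P'.i ⁻¹ᵁ f.hom.app 1 ⁻¹ᵁ V, P'.i.preimage_mono e, hxV, hV.preimage _,
      by rw [← h.comm]; rfl, ?_⟩
  have h2 := Scheme.Hom.appLE_comp_appLE P'.i z (P.i ⁻¹ᵁ V) (f.hom.app 1 ⁻¹ᵁ V)
      (P'.i ⁻¹ᵁ f.hom.app 1 ⁻¹ᵁ V) e le_rfl
  rw [← h2, ← Scheme.Hom.app_eq_appLE]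
  exact h1

end FrobeniusPair
end PrismEnv

namespace PrismEnv

/-! ### Faithfully flat algebras and sequential colimits -/

theorem map_mem_of_comp_eq {R A B : Type*} [CommRing R] [CommRing A] [CommRing B] {a : R →+* A}
    {b : R →+* B} {v : A →+* B} (h : ∀ r, v (a r) = b r) {I : Ideal R} {x : A}
    (hx : x ∈ I.map a) : v x ∈ I.map b := by
  have h1 := Ideal.mem_map_of_mem v hx
  have h2 : v.comp a = b := RingHom.ext h
  rwa [Ideal.map_map, h2] at h1

/-- A linear relation, or an expression of `1` in an extended ideal, already exists at a finite
stage, where faithful flatness is known. -/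
theorem faithfullyFlat_of_seqColimit {R S : Type u} [CommRing R] [CommRing S] {s : R →+* S}
    {A : ℕ → Type u} [∀ n, CommRing (A n)] {a : ∀ n, R →+* A n}
    {T : ∀ {m n : ℕ}, m ≤ n → A m →+* A n} (hT : ∀ {m n} (h : m ≤ n) x, T h (a m x) = a n x)
    {l : ∀ n, A n →+* S} (hl : ∀ {m n} (h : m ≤ n) x, l n (T h x) = l m x)
    (hla : ∀ n x, l n (a n x) = s x) (hsurj : ∀ x, ∃ n t, l n t = x)
    (hzero : ∀ {n} t, l n t = 0 → ∃ (m : ℕ) (h : n ≤ m), T h t = 0)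
    (hff : ∀ n, ∃ m, n ≤ m ∧ (a m).FaithfullyFlat) : s.FaithfullyFlat := by
  -- After an element has become zero, move on to a stage that is faithfully flat over `R`.
  have hzero' {n : ℕ} (t : A n) (ht : l n t = 0) : ∃ (m : ℕ) (x : A m →+* S) (y : A n →+* A m),
      (∀ t, x (y t) = l n t) ∧ (∀ r, y (a n r) = a m r) ∧ (∀ r, x (a m r) = s r) ∧ y t = 0 ∧
      (a m).FaithfullyFlat := by
    obtain ⟨m, h, hm⟩ := hzero t ht
    obtain ⟨m', h', hm'⟩ := hff m
    exact ⟨m', l m', (T h').comp (T h), fun t => (hl _ _).trans (hl _ _),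
      fun r => by rw [RingHom.comp_apply, hT, hT], hla m',
      by rw [RingHom.comp_apply, hm, map_zero], hm'⟩
  rw [RingHom.FaithfullyFlat]
  algebraize [s]
  -- By the equational criterion: a relation in `S` holds at some stage `A m`, is trivial there by
  -- flatness, and the trivialization maps to `S`.
  have hflat : Module.Flat R S := by
    refine Module.Flat.of_forall_isTrivialRelation fun {k f x} h => ?_
    choose n t ht using fun i => hsurj (x i)
    let N := Finset.univ.sup n
    let t' (i : Fin k) : A N := T (Finset.le_sup (Finset.mem_univ i)) (t i)
    have ht' (i : Fin k) : l N (t' i) = x i := (hl _ _).trans (ht i)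
    obtain ⟨m, b, y, hby, hya, hba, h0, hff⟩ := hzero' (∑ i, a N (f i) * t' i) (by
      rw [map_sum, ← h]
      refine Finset.sum_congr rfl fun i _ => ?_
      rw [map_mul, hla, ht', Algebra.smul_def]
      rfl)
    let _ := (a m).toAlgebra
    have : Module.Flat R (A m) := hff.flat
    have h1 : ∑ i, f i • y (t' i) = 0 := by
      rw [← h0, map_sum]
      refine Finset.sum_congr rfl fun i _ => ?_
      rw [map_mul, hya, Algebra.smul_def]
      rfl
    obtain ⟨k', c, w, hw, hc⟩ : Module.IsTrivialRelation f fun i => y (t' i) :=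
      Module.Flat.isTrivialRelation_of_sum_smul_eq_zero h1
    refine ⟨k', c, fun j => b (w j), fun i => ?_, hc⟩
    rw [← ht', ← hby]
    refine (congrArg b (hw i)).trans ?_
    rw [map_sum]
    refine Finset.sum_congr rfl fun j _ => ?_
    rw [Algebra.smul_def, Algebra.smul_def, map_mul]
    exact congrArg (· * b (w j)) (hba _)
  -- If a maximal ideal generated the unit ideal of `S`, it would do so at a finite stage.
  refine { hflat with submodule_ne_top := fun I hI h => ?_ }
  rw [Ideal.smul_top_eq_map] at h
  have hmem : ∀ x ∈ Ideal.map s I, ∃ n, ∃ y ∈ Ideal.map (a n) I, l n y = x := by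
    intro x hx
    induction hx using Submodule.span_induction with
    | mem x hx =>
      obtain ⟨r, hr, rfl⟩ := hx
      exact ⟨0, a 0 r, Ideal.mem_map_of_mem _ hr, hla 0 r⟩
    | zero => exact ⟨0, 0, zero_mem _, map_zero _⟩
    | add x y _ _ hx hy =>
      obtain ⟨n, x, hx, rfl⟩ := hx
      obtain ⟨n', y, hy, rfl⟩ := hy
      refine ⟨max n n', T (le_max_left _ _) x + T (le_max_right _ _) y, add_mem ?_ ?_, ?_⟩
      · exact map_mem_of_comp_eq (hT _) hx
      · exact map_mem_of_comp_eq (hT _) hy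
      · rw [map_add, hl, hl]
    | smul c x _ hx =>
      obtain ⟨n, x, hx, rfl⟩ := hx
      obtain ⟨n', y, rfl⟩ := hsurj c
      refine ⟨max n n', T (le_max_right _ _) y * T (le_max_left _ _) x, Ideal.mul_mem_left _ _ ?_, ?_⟩
      · exact map_mem_of_comp_eq (hT _) hx
      · rw [map_mul, hl, hl, smul_eq_mul]
  obtain ⟨n, y, hy, hy1⟩ := hmem 1 (by
    have : (1 : S) ∈ (⊤ : Submodule R S) := Submodule.mem_top
    rw [← h] at this
    exact this)
  obtain ⟨m, b, v, -, hva, -, h0, hff⟩ := hzero' (y - 1) (by rw [map_sub, hy1, map_one, sub_self])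
  rw [map_sub, map_one, sub_eq_zero] at h0
  let _ := (a m).toAlgebra
  have h2 : Module.FaithfullyFlat R (A m) := hff
  refine h2.submodule_ne_top hI ?_
  rw [Ideal.smul_top_eq_map]
  have h3 : Ideal.map (a m) I = ⊤ := by
    rw [Ideal.eq_top_iff_one, ← h0]
    exact map_mem_of_comp_eq hva hy
  refine (congrArg (Submodule.restrictScalars R) h3).trans ?_
  rfl

end PrismEnv

/-! ### Faithful flatness of the envelope and conclusion -/

namespace PrismEnv

theorem appLE_appLE_apply {X Y Z : Scheme.{u}} {f : X ⟶ Y} {g : Y ⟶ Z} {h : X ⟶ Z} (hfg : f ≫ g = h)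
    {U : Z.Opens} {V : Y.Opens} {W : X.Opens} (e : V ≤ g ⁻¹ᵁ U) (e' : W ≤ f ⁻¹ᵁ V) (e'' : W ≤ h ⁻¹ᵁ U)
    (x : Γ(Z, U)) : (f.appLE V W e').hom ((g.appLE U V e).hom x) = (h.appLE U W e'').hom x := by
  subst hfg
  exact congrArg (fun φ : Γ(Z, U) ⟶ Γ(X, W) => φ.hom x) (Scheme.Hom.appLE_comp_appLE f g U V W e e')

variable {D : ℕᵒᵖ ⥤ Scheme.{u}} {c : Cone D} {X : Scheme.{u}} {i : X ⟶ D.obj (op 0)}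
  {ζ : ∀ n : ℕ, D.obj (op (n + 1)) ⟶ X} {z : c.pt ⟶ X}

/-- Only the terms from stage one on map to `X`, so the colimit is computed along the shifted
indices `n + 1`. -/
theorem faithfullyFlat_appLE_of_isColimit [Mono i]
    (hζ : ∀ n, ζ n ≫ i = D.map (homOfLE (n + 1).zero_le).op) (hz : z ≫ i = c.π.app (op 0))
    {U : (D.obj (op 0)).Opens} (hc : IsColimit (seqSectionsCocone c U))
    (e : ∀ n, D.map (homOfLE (n + 1).zero_le).op ⁻¹ᵁ U ≤ ζ n ⁻¹ᵁ i ⁻¹ᵁ U)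
    (e' : c.π.app (op 0) ⁻¹ᵁ U ≤ z ⁻¹ᵁ i ⁻¹ᵁ U)
    (hff : ∀ n, ((ζ n).appLE _ _ (e n)).hom.FaithfullyFlat) :
    (z.appLE _ _ e').hom.FaithfullyFlat := by
  refine faithfullyFlat_of_seqColimit
    (A := fun n => Γ(D.obj (op (n + 1)), D.map (homOfLE (n + 1).zero_le).op ⁻¹ᵁ U))
    (a := fun n => ((ζ n).appLE _ _ (e n)).hom)
    (T := fun {m n} h => ((seqSections D U).map (homOfLE (Nat.succ_le_succ h))).hom)
    (l := fun n => ((c.π.app (op (n + 1))).appLE _ _ (seqSections_le c U (n + 1))).hom)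
    ?_ ?_ ?_ ?_ ?_ fun n => ⟨n, le_rfl, hff n⟩
  · intro m n h x
    refine appLE_appLE_apply ?_ _ _ _ x
    rw [← cancel_mono i, Category.assoc, hζ, hζ, ← D.map_comp]
    rfl
  · intro m n h x
    exact appLE_appLE_apply (c.w _) _ _ _ x
  · intro n x
    refine appLE_appLE_apply ?_ _ _ _ x
    rw [← cancel_mono i, Category.assoc, hζ, hz]
    exact c.w _
  · intro x
    obtain ⟨n, t, rfl⟩ := exists_appLE_eq_of_isColimit hc x
    exact ⟨n, (seqSections D U).map (homOfLE n.le_succ) t, appLE_appLE_apply (c.w _) _ _ _ t⟩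
  · intro n t ht
    obtain ⟨m, h, hm⟩ := exists_appLE_eq_zero_of_isColimit hc t ht
    obtain ⟨m, rfl⟩ := Nat.exists_eq_succ_of_ne_zero (n := m) (by omega)
    exact ⟨m, Nat.le_of_succ_le_succ h, hm⟩

theorem flat_and_surjective_of_isColimit (hi : IsClosedImmersion i)
    (hD : ∀ n, IsAffineHom (D.map (homOfLE (Nat.zero_le n)).op)) (haff : IsAffineHom z)
    (hζ : ∀ n, ζ n ≫ i = D.map (homOfLE (n + 1).zero_le).op) (hz : z ≫ i = c.π.app (op 0))
    (hc : ∀ U : (D.obj (op 0)).Opens, IsAffineOpen U → Nonempty (IsColimit (seqSectionsCocone c U)))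
    (h : ∀ n, Flat (ζ n) ∧ Surjective (ζ n)) : Flat z ∧ Surjective z := by
  refine flat_and_surjective_of_appLE z fun x => ?_
  obtain ⟨U, hU, hx, -⟩ := exists_isAffineOpen_mem_and_subset (U := ⊤) (x := i x) trivial
  have e1 (n : ℕ) : ζ n ⁻¹ᵁ i ⁻¹ᵁ U = D.map (homOfLE (n + 1).zero_le).op ⁻¹ᵁ U := by
    rw [← hζ]
    rfl
  have e2 : z ⁻¹ᵁ i ⁻¹ᵁ U = c.π.app (op 0) ⁻¹ᵁ U := by
    rw [← hz]
    rfl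
  refine ⟨i ⁻¹ᵁ U, c.π.app (op 0) ⁻¹ᵁ U, e2.ge, hx, hU.preimage _, e2,
    faithfullyFlat_appLE_of_isColimit hζ hz (hc U hU).some (fun n => (e1 n).ge) e2.ge fun n => ?_⟩
  have h1 : IsAffineHom (ζ n) := by
    have : IsAffineHom (ζ n ≫ i) := by
      rw [hζ]
      exact hD (n + 1)
    exact IsAffineHom.of_comp _ i
  have := (h n).1
  have := (h n).2
  have h2 := faithfullyFlat_app (ζ n) (hU.preimage i)
  have h3 (V : (D.obj (op (n + 1))).Opens) (e3 : ζ n ⁻¹ᵁ i ⁻¹ᵁ U = V) :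
      ((ζ n).appLE (i ⁻¹ᵁ U) V e3.ge).hom.FaithfullyFlat := by
    subst e3
    rwa [Scheme.Hom.app_eq_appLE] at h2
  exact h3 _ (e1 n)

namespace FrobeniusPair.FrobeniusTower

open PadicFormalScheme

variable {p : ℕ} [Fact p.Prime] {P : FrobeniusPair.{u} p} (W : P.FrobeniusTower)

theorem isRegularImmersion (hP : IsRegularImmersion P.i) (n : ℕ) :
    IsRegularImmersion (W.tower.pair n).i := by
  induction n with
  | zero => exact hP
  | succ n ih => exact (W.step n).isRegularImmersion ih

/-- The projections to the zeroth formal scheme of a tower. -/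
def toZero (n : ℕ) : (W.tower.pair n).Y ⟶ P.Y := W.tower.system.map (homOfLE n.zero_le).op

theorem toZero_zero : W.toZero 0 = 𝟙 P.Y := W.tower.system.map_id _

theorem toZero_succ (n : ℕ) : W.toZero (n + 1) = W.hom n ≫ W.toZero n := by
  have h1 := W.tower.system.map_comp (homOfLE (Nat.le_add_right n 1)).op (homOfLE n.zero_le).op
  rw [W.system_map_succ] at h1
  exact h1

/-- The transition morphisms of the closed subschemes of a tower. -/
def homX (n : ℕ) : (W.tower.pair (n + 1)).X ⟶ (W.tower.pair n).X := (W.tower.map n).homX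

theorem homX_comp_i (n : ℕ) :
    W.homX n ≫ (W.tower.pair n).i = (W.tower.pair (n + 1)).i ≫ (W.hom n).app 1 :=
  (W.tower.map n).comm

/-- Each `X⁽ⁿ⁺¹⁾ → X⁽ⁿ⁾` is flat and surjective because regularity persists along the tower; the
morphism to `X` is the composite. -/
theorem exists_flat_surjective_X (hP : IsRegularImmersion P.i) (n : ℕ) :
    ∃ χ : (W.tower.pair n).X ⟶ P.X, (Flat χ ∧ Surjective χ) ∧
      χ ≫ P.i = (W.tower.pair n).i ≫ (W.toZero n).app 1 := by
  induction n with
  | zero =>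
    have h0 : Flat (𝟙 P.X) ∧ Surjective (𝟙 P.X) := ⟨inferInstance, inferInstance⟩
    refine ⟨𝟙 P.X, h0, ?_⟩
    rw [toZero_zero]
    exact (Category.id_comp _).trans (Category.comp_id _).symm
  | succ n ih =>
    obtain ⟨χ, ⟨h1, h2⟩, h3⟩ := ih
    have h6 : Flat (W.homX n) ∧ Surjective (W.homX n) :=
      (W.step n).flat_and_surjective_homX (W.isRegularImmersion hP n)
    obtain ⟨h4, h5⟩ := h6
    refine ⟨W.homX n ≫ χ, ⟨inferInstance, inferInstance⟩, ?_⟩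
    rw [Category.assoc, h3, toZero_succ, ← Category.assoc, homX_comp_i, Category.assoc]
    rfl

theorem exists_flat_surjective (hP : IsRegularImmersion P.i) (n : ℕ) :
    ∃ ζ : (W.tower.pair (n + 1)).Y.level 1 ⟶ P.X, (Flat ζ ∧ Surjective ζ) ∧
      ζ ≫ P.i = (W.toZero (n + 1)).app 1 := by
  obtain ⟨χ, ⟨h1, h2⟩, h3⟩ := W.exists_flat_surjective_X hP n
  have h6 : Flat (W.z n) ∧ Surjective (W.z n) :=
    (W.step n).flat_and_surjective (W.isRegularImmersion hP n)
  obtain ⟨h4, h5⟩ := h6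
  refine ⟨W.z n ≫ χ, ⟨inferInstance, inferInstance⟩, ?_⟩
  rw [Category.assoc, h3, toZero_succ, ← Category.assoc, W.z_comp_i]
  rfl

end FrobeniusPair.FrobeniusTower

namespace FrobeniusPair

open PadicFormalScheme

variable {p : ℕ} [Fact p.Prime]

theorem exists_prismaticEnvelope (P : FrobeniusPair.{u} p) :
    ∃ Δ : P.Prism, Δ.IsPrismaticEnvelope ∧ IsAffineMorphism Δ.π ∧ IsAffineHom Δ.z ∧
      ∃ (D : P.toClosedPair.DilatationTower) (τ : (Functor.const ℕᵒᵖ).obj Δ.T.T ⟶ D.system),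
        τ.app (op 0) = Δ.π ∧
        (∀ m : ℕ, Nonempty (IsLimit ((reduction p m).mapCone (Cone.mk Δ.T.T τ)))) ∧
        (IsRegularImmersion P.i → (∀ n : ℕ, IsRegularImmersion (D.pair n).i) ∧
          (Flat Δ.z ∧ Surjective Δ.z) ∧ Δ.IsSmall) := by
  obtain ⟨W⟩ := nonempty_frobeniusTower P
  obtain ⟨Δ, τ, hΔ, haff, hτ, -, h⟩ := W.exists_envelope
  have hi := P.isClosedImmersion_i
  have hz : IsAffineHom Δ.z := by
    have : IsAffineHom (Δ.z ≫ P.i) := by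
      rw [Δ.comm]
      exact haff 1
    exact IsAffineHom.of_comp _ P.i
  refine ⟨Δ, hΔ, haff, hz, W.tower, τ, hτ, fun m => (h m).1, fun hP => ?_⟩
  choose ζ h1 h2 using W.exists_flat_surjective hP
  have key : Flat Δ.z ∧ Surjective Δ.z :=
    flat_and_surjective_of_isColimit (D := W.tower.system ⋙ reduction p 1)
      (c := (reduction p 1).mapCone (Cone.mk Δ.T.T τ)) (i := P.i) (ζ := ζ) (z := Δ.z)
      hi (fun n => W.isAffineMorphism_system _ 1) hz h2
      (Δ.comm.trans (congrArg (fun f : Δ.T.T ⟶ P.Y => f.app 1) hτ.symm)) (h 1).2 h1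
  exact ⟨W.isRegularImmersion hP, key, key.1⟩

end FrobeniusPair

end PrismEnv

theorem mainTheorem4 (p : ℕ) [Fact p.Prime] :
    (∀ P : PrismEnv.FrobeniusPair.{u} p, ∃ Δ : P.Prism, Δ.IsPrismaticEnvelope ∧
      PrismEnv.PadicFormalScheme.IsAffineMorphism Δ.π ∧ IsAffineHom Δ.z ∧
      ∃ (D : P.toClosedPair.DilatationTower)
        (τ : (Functor.const ℕᵒᵖ).obj Δ.T.T ⟶ D.system),
        τ.app (op 0) = Δ.π ∧
        (∀ m : ℕ, Nonempty (IsLimit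
          ((PrismEnv.PadicFormalScheme.reduction p m).mapCone (Cone.mk Δ.T.T τ)))) ∧
        (PrismEnv.IsRegularImmersion P.i →
          (∀ n : ℕ, PrismEnv.IsRegularImmersion (D.pair n).i) ∧
          (Flat Δ.z ∧ Surjective Δ.z) ∧ Δ.IsSmall)) ∧
    (∃ (P : PrismEnv.FrobeniusPair.{u} p) (Δ : P.Prism), Δ.IsPrismaticEnvelope ∧
      ¬ PrismEnv.PadicFormalScheme.IsOfFiniteType Δ.π ∧
      ¬ (LocallyOfFiniteType Δ.z ∧ QuasiCompact Δ.z)) ∧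
    (∀ (P P' : PrismEnv.FrobeniusPair.{u} p) (g : PrismEnv.FrobeniusPair.Hom P' P)
      (Δ : P.Prism) (Δ' : P'.Prism), Δ.IsPrismaticEnvelope → Δ'.IsPrismaticEnvelope →
      ∃ h : Δ'.T ⟶ Δ.T,
        (h.hom ≫ Δ.π = Δ'.π ≫ g.hom ∧ h.hom.app 1 ≫ Δ.z = Δ'.z ≫ g.homX) ∧
        (∀ h' : Δ'.T ⟶ Δ.T, h'.hom ≫ Δ.π = Δ'.π ≫ g.hom →
          h'.hom.app 1 ≫ Δ.z = Δ'.z ≫ g.homX → h' = h) ∧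
        (PrismEnv.PadicFormalScheme.IsPCompletelyFlat g.hom →
          IsPullback g.homX P'.i P.i (g.hom.app 1) →
          IsPullback h.hom Δ'.π Δ.π g.hom)) :=
  ⟨PrismEnv.FrobeniusPair.exists_prismaticEnvelope,
    PrismEnv.FrobeniusPair.exists_envelope_not_isOfFiniteType p,
    fun _ _ g _ _ hΔ hΔ' => PrismEnv.FrobeniusPair.exists_envelope_map g hΔ hΔ'⟩
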